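/- **Setting.** Let $f_i,g_i:\mathbb{R}^{d_x}\times\mathbb{R}^{d_y}\to\mathbb{R}$ ($i=1,\dots,n$, $n\ge 1$), $F=\frac1n\sum_i f_i$, $G=\frac1n\sum_i g_i$. For $\gamma,\mu>0$ let $V_\gamma(x,y)=\min_\theta\{G(x,\theta)+\frac1{2\gamma}\|\theta-y\|^2\}$, let $\theta^*_\gamma(x,y)$ be its minimizer, and $\Psi_\mu=\mu F+G-V_\gamma$. **Algorithm (SUN-DSBO-GT).** Given a horizon $K$, deterministic initial points $x_i^0,y_i^0,\theta_i^0$, a weight matrix $W=(w_{ij})$, $\mu_k=\mu_0(k+1)^{-p}$, $\lambda_\theta=c_\theta n^{1/2}K^{-1/2}$, $\lambda_x=\lambda_y=c_\lambda\lambda_\theta$, at each iteration $k=0,\dots,K-1$ every agent $i$ draws samples $\xi_{f,i}^k,\xi_{g,i}^k$ and computes $$\hat D_{\theta,i}^k=\nabla_y g_i(x_i^k,\theta_i^k;\xi_{g,i}^k)+\tfrac1\gamma(\theta_i^k-y_i^k),$$ $$\hat D_{x,i}^k=\mu_k\nabla_x f_i(x_i^k,y_i^k;\xi_{f,i}^k)+\nabla_x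 g_i(x_i^k,y_i^k;\xi_{g,i}^k)-\nabla_x g_i(x_i^k,\theta_i^k;\xi_{g,i}^k),$$ $$\hat D_{y,i}^k=\mu_k\nabla_y f_i(x_i^k,y_i^k;\xi_{f,i}^k)+\nabla_y g_i(x_i^k,y_i^k;\xi_{g,i}^k)-\tfrac1\gamma(y_i^k-\theta_i^k),$$ and, for $\Diamond\in\{\theta,x,y\}$, $D_{\Diamond,i}^k=\sum_j w_{ij}(D_{\Diamond,j}^{k-1}+\hat D_{\Diamond,j}^k-\hat D_{\Diamond,j}^{k-1})$ and $\Diamond_i^{k+1}=\sum_j w_{ij}(\Diamond_j^k-\lambda_\Diamond D_{\Diamond,j}^k)$, where $D^{-1}=\hat D^{-1}=0$. Thus an iteration uses $3n$ stochastic gradient evaluations. Bars denote averages over the agents. **Assumptions.** 1. $F\ge\underline F$ for a real number $\underline F$; all $f_i$ and $g_i$ are $C^1$, with gradients that are Lipschitz in $(x,y)$ with constants $L_1>0$ and $L_2>0$, respectively. 2. The stochastic gradients $\nabla f_i(\cdot;\xi_{f,i}^k)$ and $\nabla g_i(\cdot;\xi_{g,i}^k)$ are unbiased, with variances at most $\delta_f^2$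 and $\delta_g^2$ at every point, and the pairs $(\xi_{f,i}^k,\xi_{g,i}^k)$ are independent over $(i,k)$. 3. $W$ is entrywise non-negative, symmetric and doubly stochastic, with eigenvalues $1=\lambda_1>\lambda_2\ge\dots\ge\lambda_n$ and $\rho=\max\{|\lambda_2|,|\lambda_n|\}<1$ ($\rho=0$ if $n=1$). 4. $\gamma\in(0,\frac1{2L_2})$, $\mu_0>0$, $p\in(0,\frac14)$, $c_\theta>0$, and $0<c_\lambda\le\frac{\eta}{32a_1L_\theta^2}$, where $\eta=\frac1\gamma-L_2$, $L_\theta>0$ is a Lipschitz constant of $\theta^*_\gamma$ and $a_1=\frac1{2L_\theta}\sqrt{L_2^2+\gamma^{-2}}$. 5. The size of the initial data, $$\Phi_{\mu_0}(\bar x^0,\bar y^0)+\|\bar\theta^0-\theta^*_\gamma(\bar x^0,\bar y^0)\|^2+\frac1n\sum_{i}\sum_{\Diamond\in\{\theta,x,y\}}\Big(\|\Diamond_i^0-\bar\Diamond^0\|^2+\mathbb{E}\|D_{\Diamond,i}^0-\bar D_\Diamond^0\|^2\Big),\qquad \Phi_\mu=\mu(F-\underline F)+G-V_\gamma,$$ is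 at most $B$. **Statement.** There is a constant $C>0$ that depends only on $L_1,L_2,\gamma,\mu_0,p,\delta_f,\delta_g,L_\theta,c_\theta,c_\lambda,B$ (in particular, not on $n$, $\rho$, the dimensions or the particular problem) such that, in the above setting, every $\Psi_\mu$ is differentiable and the following holds. * (Sample complexity $O(\varepsilon^{-2})$.) For every $\varepsilon\in(0,(1-\rho)^4/n^2]$ there is $K_0$ such that the total number $3nK_0$ of stochastic gradient evaluations of all agents in $K_0$ iterations is at most $C\varepsilon^{-2}$, and for every horizon $K\ge K_0$ SUN-DSBO-GT reaches an $\varepsilon$-stationary point: $\mathbb{E}\|\nabla\Psi_{\mu_k}(\bar x^k,\bar y^k)\|^2\le\varepsilon$ for some $k<K$. * (Transient iteration complexity $O(n^3/(1-\rho)^8)$.) For every $K\ge C\,n^3/(1-\rho)^8$ the linear speedup rate holds: $$\frac1K\sum_{k=0}^{K-1}\mathbb{E}\|\nabla\Psi_{\mu_k}(\bar x^k,\bar y^k)\|^2\le\frac{C}{\sqrt{nK}}.$$ -/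

import Mathlib

open MeasureTheory ProbabilityTheory
open scoped ENNReal Gradient

noncomputable section

namespace SunDSBO

/-! ### Spaces and averages -/

/-- `ℝ^d` with the Euclidean norm. -/
abbrev Vec (d : ℕ) := EuclideanSpace ℝ (Fin d)

/-- `ℝ^{dx} × ℝ^{dy}` with the Euclidean norm. -/
abbrev Pt (dx dy : ℕ) := WithLp 2 (Vec dx × Vec dy)

/-- The point `(x, y)`. -/
def pt {dx dy : ℕ} (x : Vec dx) (y : Vec dy) : Pt dx dy := WithLp.toLp 2 (x, y)

/-- Average over the agents. -/
def mean {n : ℕ} {V : Type*} [AddCommGroup V] [Module ℝ V] (v : Fin n → V) : V :=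
  (n : ℝ)⁻¹ • ∑ i, v i

/-- One round of communication: `i ↦ ∑ j, w i j • v j`. -/
def mix {n : ℕ} {V : Type*} [AddCommGroup V] [Module ℝ V] (W : Matrix (Fin n) (Fin n) ℝ)
    (v : Fin n → V) : Fin n → V :=
  fun i => ∑ j, W i j • v j

/-- The disagreement `(1/n) ∑ i, ‖v i - mean v‖²`. -/
def sqDev {n d : ℕ} (v : Fin n → Vec d) : ℝ≥0∞ :=
  (n : ℝ≥0∞)⁻¹ * ∑ i, ‖v i - mean v‖ₑ ^ 2

/-! ### The bilevel problem and its penalty reformulation -/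

/-- Data of a decentralized stochastic bilevel problem: local upper- and lower-level objectives
`f i`, `g i`, and stochastic gradients `gradf i z ξ = ∇f_i(z; ξ)`, `gradg i z ξ = ∇g_i(z; ξ)`
at `z = (x, y)`. -/
structure Problem (n dx dy : ℕ) (Sf Sg : Type*) where
  f : Fin n → Pt dx dy → ℝ
  g : Fin n → Pt dx dy → ℝ
  gradf : Fin n → Pt dx dy → Sf → Pt dx dy
  gradg : Fin n → Pt dx dy → Sg → Pt dx dy

namespace Problem

variable {n dx dy : ℕ} {Sf Sg : Type*} (P : Problem n dx dy Sf Sg)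

/-- Upper-level objective `F = (1/n) ∑ f_i`. -/
def F (z : Pt dx dy) : ℝ := (n : ℝ)⁻¹ * ∑ i, P.f i z

/-- Lower-level objective `G = (1/n) ∑ g_i`. -/
def G (z : Pt dx dy) : ℝ := (n : ℝ)⁻¹ * ∑ i, P.g i z

/-- The function `θ ↦ G(x, θ) + ‖θ - y‖² / (2γ)` at `z = (x, y)`. -/
def proxObj (γ : ℝ) (z : Pt dx dy) (θ : Vec dy) : ℝ :=
  P.G (pt z.fst θ) + 1 / (2 * γ) * ‖θ - z.snd‖ ^ 2

/-- The Moreau envelope `V_γ` of the lower-level objective. -/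
def V (γ : ℝ) (z : Pt dx dy) : ℝ := ⨅ θ, P.proxObj γ z θ

/-- `θ*_γ(z)`: the minimizer of `proxObj γ z` (it exists and is unique when `G` is `L₂`-smooth
and `γ < 1 / (2 L₂)`). -/
def thetaStar (γ : ℝ) (z : Pt dx dy) : Vec dy :=
  Classical.epsilon fun θ => ∀ θ', P.proxObj γ z θ ≤ P.proxObj γ z θ'

/-- The penalty function `Ψ_μ = μ F + G - V_γ`. -/
def Psi (γ μ : ℝ) (z : Pt dx dy) : ℝ := μ * P.F z + P.G z - P.V γ z

/-- The stochastic estimator of the `θ`-direction. -/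
def estTheta (γ : ℝ) (sg : Fin n → Sg) (x : Fin n → Vec dx) (y θ : Fin n → Vec dy) :
    Fin n → Vec dy :=
  fun i => (P.gradg i (pt (x i) (θ i)) (sg i)).snd + (1 / γ) • (θ i - y i)

/-- The stochastic estimator of the `x`-direction. -/
def estX (μ : ℝ) (sf : Fin n → Sf) (sg : Fin n → Sg) (x : Fin n → Vec dx)
    (y θ : Fin n → Vec dy) : Fin n → Vec dx :=
  fun i => μ • (P.gradf i (pt (x i) (y i)) (sf i)).fst
    + (P.gradg i (pt (x i) (y i)) (sg i)).fst - (P.gradg i (pt (x i) (θ i)) (sg i)).fst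

/-- The stochastic estimator of the `y`-direction. -/
def estY (γ μ : ℝ) (sf : Fin n → Sf) (sg : Fin n → Sg) (x : Fin n → Vec dx)
    (y θ : Fin n → Vec dy) : Fin n → Vec dy :=
  fun i => μ • (P.gradf i (pt (x i) (y i)) (sf i)).snd
    + (P.gradg i (pt (x i) (y i)) (sg i)).snd - (1 / γ) • (y i - θ i)

end Problem

/-! ### The algorithm SUN-DSBO-GT -/

/-- State of the algorithm before iteration `k`: the local variables `x_i^k, y_i^k, θ_i^k`, the
trackers `D_i^{k-1}` and the gradient estimators (called `H` here) of iteration `k - 1`. -/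
structure GTState (n dx dy : ℕ) where
  x : Fin n → Vec dx
  y : Fin n → Vec dy
  θ : Fin n → Vec dy
  Dx : Fin n → Vec dx
  Dy : Fin n → Vec dy
  Dθ : Fin n → Vec dy
  Hx : Fin n → Vec dx
  Hy : Fin n → Vec dy
  Hθ : Fin n → Vec dy

section Algorithm

variable {n dx dy : ℕ} {Sf Sg : Type*}

/-- One iteration: compute the estimators, update the trackers by gradient tracking, then update
the variables. -/
def gtStep (P : Problem n dx dy Sf Sg) (W : Matrix (Fin n) (Fin n) ℝ) (γ μ lamθ lamx lamy : ℝ)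
    (sf : Fin n → Sf) (sg : Fin n → Sg) (s : GTState n dx dy) : GTState n dx dy :=
  let hx := P.estX μ sf sg s.x s.y s.θ
  let hy := P.estY γ μ sf sg s.x s.y s.θ
  let hθ := P.estTheta γ sg s.x s.y s.θ
  let tx := mix W (s.Dx + hx - s.Hx)
  let ty := mix W (s.Dy + hy - s.Hy)
  let tθ := mix W (s.Dθ + hθ - s.Hθ)
  { x := mix W (s.x - lamx • tx)
    y := mix W (s.y - lamy • ty)
    θ := mix W (s.θ - lamθ • tθ)
    Dx := tx
    Dy := ty
    Dθ := tθ
    Hx := hx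
    Hy := hy
    Hθ := hθ }

/-- The state before iteration `k`, along the samples `sf j i`, `sg j i` drawn by agent `i` at
iteration `j`, with penalty parameters and learning rates depending on the iteration. -/
def gtRun (P : Problem n dx dy Sf Sg) (W : Matrix (Fin n) (Fin n) ℝ) (γ : ℝ)
    (μ lamθ lamx lamy : ℕ → ℝ) (x₀ : Fin n → Vec dx) (y₀ θ₀ : Fin n → Vec dy)
    (sf : ℕ → Fin n → Sf) (sg : ℕ → Fin n → Sg) : ℕ → GTState n dx dy
  | 0 => ⟨x₀, y₀, θ₀, 0, 0, 0, 0, 0, 0⟩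
  | k + 1 => gtStep P W γ (μ k) (lamθ k) (lamx k) (lamy k) (sf k) (sg k)
      (gtRun P W γ μ lamθ lamx lamy x₀ y₀ θ₀ sf sg k)

/-- Number of stochastic gradient evaluations, over all agents, in `K` iterations: in every
iteration each of the `n` agents evaluates `∇f_i(x, y; ξ_f)`, `∇g_i(x, y; ξ_g)` and
`∇g_i(x, θ; ξ_g)`. -/
def gradEvals (n K : ℕ) : ℕ := ∑ _k ∈ Finset.range K, ∑ _i : Fin n, 3

end Algorithm

/-- The penalty parameters `μ_k = μ₀ (k + 1)^{-p}`. -/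
def penalty (μ₀ p : ℝ) (k : ℕ) : ℝ := μ₀ * ((k : ℝ) + 1) ^ (-p)

/-- The learning rate `λ_θ = c_θ n^{1/2} K^{-1/2}` for a horizon of `K` iterations. -/
def rateTheta (cθ : ℝ) (n K : ℕ) : ℝ := cθ * √(n : ℝ) / √(K : ℝ)

/-- The average `(x̄^k, ȳ^k)` of the iterates of SUN-DSBO-GT run with horizon `K`, that is, with
`μ_k = μ₀ (k + 1)^{-p}`, `λ_θ = c_θ n^{1/2} K^{-1/2}` and `λ_x = λ_y = c_λ λ_θ`, along the samples
`sf`, `sg`. -/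
def avgIterate {n dx dy : ℕ} {Sf Sg : Type*}
    (P : Problem n dx dy Sf Sg) (W : Matrix (Fin n) (Fin n) ℝ) (γ μ₀ p cθ cl : ℝ)
    (x₀ : Fin n → Vec dx) (y₀ θ₀ : Fin n → Vec dy)
    (sf : ℕ → Fin n → Sf) (sg : ℕ → Fin n → Sg) (K k : ℕ) : Pt dx dy :=
  let s := gtRun P W γ (penalty μ₀ p) (fun _ => rateTheta cθ n K)
    (fun _ => cl * rateTheta cθ n K) (fun _ => cl * rateTheta cθ n K) x₀ y₀ θ₀ sf sg k
  pt (mean s.x) (mean s.y)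

/-- `𝔼 ‖∇Ψ_{μ_k}(x̄^k, ȳ^k)‖²` for SUN-DSBO-GT run with horizon `K` on random samples. -/
def stationarity {n dx dy : ℕ} {Sf Sg Ω : Type*} [MeasurableSpace Ω] (Pr : Measure Ω)
    (P : Problem n dx dy Sf Sg) (W : Matrix (Fin n) (Fin n) ℝ) (γ μ₀ p cθ cl : ℝ)
    (x₀ : Fin n → Vec dx) (y₀ θ₀ : Fin n → Vec dy)
    (ξf : ℕ → Fin n → Ω → Sf) (ξg : ℕ → Fin n → Ω → Sg) (K k : ℕ) : ℝ≥0∞ :=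
  ∫⁻ ω, ‖∇ (P.Psi γ (penalty μ₀ p k)) (avgIterate P W γ μ₀ p cθ cl x₀ y₀ θ₀
    (fun j i => ξf j i ω) (fun j i => ξg j i ω) K k)‖ₑ ^ 2 ∂Pr

/-! ### Assumptions -/

/-- The `f_i` are `C¹` and `L₁`-smooth, the `g_i` are `C¹` and `L₂`-smooth. -/
structure Smooth {n dx dy : ℕ} {Sf Sg : Type*} (P : Problem n dx dy Sf Sg) (L₁ L₂ : ℝ) :
    Prop where
  contDiff_f : ∀ i, ContDiff ℝ 1 (P.f i)
  contDiff_g : ∀ i, ContDiff ℝ 1 (P.g i)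
  smooth_f : ∀ i z z', ‖∇ (P.f i) z - ∇ (P.f i) z'‖ ≤ L₁ * ‖z - z'‖
  smooth_g : ∀ i z z', ‖∇ (P.g i) z - ∇ (P.g i) z'‖ ≤ L₂ * ‖z - z'‖

/-- Stochastic oracle: the samples of different agents or different iterations are independent,
and the stochastic gradients are unbiased with variances at most `δf²` and `δg²`. The two samples
`ξf k i` and `ξg k i` of the same agent in the same iteration may depend on each other. -/
structure Oracle {n dx dy : ℕ} {Sf Sg Ω : Type*} [MeasurableSpace Sf] [MeasurableSpace Sg]
    [MeasurableSpace Ω] (Pr : Measure Ω) (P : Problem n dx dy Sf Sg)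
    (ξf : ℕ → Fin n → Ω → Sf) (ξg : ℕ → Fin n → Ω → Sg) (δf δg : ℝ) : Prop where
  measurable_gradf : ∀ i, Measurable (Function.uncurry (P.gradf i))
  measurable_gradg : ∀ i, Measurable (Function.uncurry (P.gradg i))
  measurable_ξf : ∀ k i, Measurable (ξf k i)
  measurable_ξg : ∀ k i, Measurable (ξg k i)
  indep : iIndepFun (fun (q : ℕ × Fin n) ω => (ξf q.1 q.2 ω, ξg q.1 q.2 ω)) Pr
  unbiased_f : ∀ k i z, ∫ ω, P.gradf i z (ξf k i ω) ∂Pr = ∇ (P.f i) z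
  unbiased_g : ∀ k i z, ∫ ω, P.gradg i z (ξg k i ω) ∂Pr = ∇ (P.g i) z
  variance_f : ∀ k i z,
    ∫⁻ ω, ‖∇ (P.f i) z - P.gradf i z (ξf k i ω)‖ₑ ^ 2 ∂Pr ≤ ENNReal.ofReal (δf ^ 2)
  variance_g : ∀ k i z,
    ∫⁻ ω, ‖∇ (P.g i) z - P.gradg i z (ξg k i ω)‖ₑ ^ 2 ∂Pr ≤ ENNReal.ofReal (δg ^ 2)

/-- The connectivity parameter `ρ = max {|λ₂|, |λₙ|}` of a symmetric matrix with eigenvalues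
`λ₁ ≥ ⋯ ≥ λₙ`, that is, the maximum of `|λ_i|` over `i ≥ 2`; it is `0` if `n = 1`. (The sorted
eigenvalues `eigenvalues₀` are indexed from `0`.) -/
def connectivity {n : ℕ} {W : Matrix (Fin n) (Fin n) ℝ} (hW : W.IsHermitian) : ℝ :=
  ⨆ i : {i : Fin (Fintype.card (Fin n)) // 0 < (i : ℕ)}, |hW.eigenvalues₀ i|

/-- The size of the initial data, uniformly in the parameters of the run: the Lyapunov function
at the start with unit weights,
`Φ_{μ₀}(x̄⁰, ȳ⁰) + ‖θ̄⁰ - θ*_γ(x̄⁰, ȳ⁰)‖² + (1/n) ∑ᵢ (‖xᵢ⁰ - x̄⁰‖² + ‖yᵢ⁰ - ȳ⁰‖² + ‖θᵢ⁰ - θ̄⁰‖²)`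
`+ (1/n) ∑ᵢ 𝔼 (‖D_{x,i}⁰ - D̄_x⁰‖² + ‖D_{y,i}⁰ - D̄_y⁰‖² + ‖D_{θ,i}⁰ - D̄_θ⁰‖²)`,
where `Φ_μ = μ (F - Flow) + G - V_γ` and `D⁰` are the first trackers. -/
def initSize {n dx dy : ℕ} {Sf Sg Ω : Type*} [MeasurableSpace Ω] (Pr : Measure Ω)
    (P : Problem n dx dy Sf Sg) (W : Matrix (Fin n) (Fin n) ℝ) (γ μ₀ Flow : ℝ)
    (x₀ : Fin n → Vec dx) (y₀ θ₀ : Fin n → Vec dy)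
    (ξf : ℕ → Fin n → Ω → Sf) (ξg : ℕ → Fin n → Ω → Sg) : ℝ≥0∞ :=
  let z₀ := pt (mean x₀) (mean y₀)
  ENNReal.ofReal (μ₀ * (P.F z₀ - Flow) + P.G z₀ - P.V γ z₀)
    + ‖mean θ₀ - P.thetaStar γ z₀‖ₑ ^ 2
    + (sqDev x₀ + sqDev y₀ + sqDev θ₀)
    + ∫⁻ ω, (sqDev (mix W (P.estX μ₀ (fun i => ξf 0 i ω) (fun i => ξg 0 i ω) x₀ y₀ θ₀))
        + sqDev (mix W (P.estY γ μ₀ (fun i => ξf 0 i ω) (fun i => ξg 0 i ω) x₀ y₀ θ₀))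
        + sqDev (mix W (P.estTheta γ (fun i => ξg 0 i ω) x₀ y₀ θ₀))) ∂Pr

/-- The weight `a₁ = √(L₂² + 1/γ²) / (2 L_θ)` that enters the condition on `c_λ`. -/
def a₁ (L₂ γ Lθ : ℝ) : ℝ := 1 / (2 * Lθ) * √(L₂ ^ 2 + 1 / γ ^ 2)

end SunDSBO

end

noncomputable section

namespace SunDSBO

set_option linter.unusedSectionVars false

/-! ### Averaging and mixing -/

section Linear

variable {n : ℕ} {V V' : Type*} [AddCommGroup V] [Module ℝ V] [AddCommGroup V'] [Module ℝ V']

/-! Stack the variables as s = ((x, y), θ). SUN-DSBO-GT becomes one gradient tracking method with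
step λ = λ_θ and preconditioner Λ = diag(c_λ, c_λ, 1); its local estimators are μ_k A_i + B_i plus
noise, with A_i built from ∇f_i, and B_i from ∇g_i and the proximal term (`est_eq`,
`isTracking_gtRun`). Trackers and estimators have equal averages, so s̄ moves by -λ Λ H̄.

Descent. The Lyapunov function is U = (Ψ_μ - μ Flow) + (proxObj - V_γ). Let w be the error in the
gradient of V_γ made by using θ in place of θ*, and q the θ-gradient of proxObj. Then ∇U = (∇Ψ_μ +
w, q), while the averaged drift is (∇Ψ_μ - w, q). Their product with weight Λ is c_λ(‖∇Ψ_μ‖² - ‖w‖²)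
+ ‖q‖²: the cross terms cancel, and the bound on c_λ gives c_λ‖w‖² ≤ ‖q‖²/4 (`mul_norm_sq_le`,
`isLyapunov`). Since μ_k decreases and F ≥ Flow, U decreases in k at a fixed point, so the varying
penalty costs nothing here (`IsTracking.descent`).

Consensus. The disagreements of iterates and of trackers both contract by ρ. Eliminating the
trackers bounds the total disagreement by initial data plus λ²/(1-ρ)⁴ times the total change of the
estimators (`le_of_contraction_pair`, `IsTracking.sum_dev_le`). One part of that change is (μ_{k+1}
- μ_k) A_i(s_k), although neither gradients nor heterogeneity are assumed bounded. Compare A_i(s_k)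
with its value at the initial average: the drift is paid for by ∑ (μ_{k+1} - μ_k)²(k+1) ≤ μ₀²
(`SlowDecay.sum_sq_mul_le`), and the dispersion at the start is read off the first trackers through
a linear map that cancels the proximal terms (`dev_mix_dirA_le`).

Combination. For λ at most a constant times (1-ρ)², the feedback between consensus error, movement
and dissipation is absorbed (`exists_combined_bound`). In expectation the noise term linear in ∇U
vanishes, local noise has variance O(1) and averaged noise O(1/n). Hence λ ∑ 𝔼‖∇Ψ‖² ≤ C(1 + λ/(1-ρ)
+ λ³K/(1-ρ)⁴ + λ²K/n) (`exists_sum_integral_le`). Divide by λK with λ = c_θ√(n/K): the first and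
last terms are of order 1/√(nK), and λ²/(1-ρ)⁴ reaches that order once K ≥ n³/(1-ρ)⁸. For the sample
complexity, K₀ of order 1/(nε²) is already past the transient phase when ε ≤ (1-ρ)⁴/n². -/

theorem mean_add (u v : Fin n → V) : mean (u + v) = mean u + mean v := by
  simp [mean, Finset.sum_add_distrib]

theorem mean_sub (u v : Fin n → V) : mean (u - v) = mean u - mean v := by
  simp [mean, Finset.sum_sub_distrib, smul_sub]

theorem mean_smul (c : ℝ) (v : Fin n → V) : mean (c • v) = c • mean v := by
  simp only [mean, Pi.smul_apply, ← Finset.smul_sum, smul_comm c]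

theorem mean_const (hn : 0 < n) (c : V) : mean (fun _ : Fin n => c) = c := by
  have : (n : ℝ) ≠ 0 := by positivity
  simp [mean, ← Nat.cast_smul_eq_nsmul ℝ, smul_smul, inv_mul_cancel₀ this]

theorem mean_map (Λ : V →ₗ[ℝ] V') (v : Fin n → V) : mean (fun i => Λ (v i)) = Λ (mean v) := by
  simp [mean]

theorem mix_add (W : Matrix (Fin n) (Fin n) ℝ) (u v : Fin n → V) :
    mix W (u + v) = mix W u + mix W v := by
  ext i; simp [mix, Finset.sum_add_distrib]

theorem mix_sub (W : Matrix (Fin n) (Fin n) ℝ) (u v : Fin n → V) :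
    mix W (u - v) = mix W u - mix W v := by
  ext i; simp [mix, Finset.sum_sub_distrib, smul_sub]

theorem mix_smul (W : Matrix (Fin n) (Fin n) ℝ) (c : ℝ) (v : Fin n → V) :
    mix W (c • v) = c • mix W v := by
  ext i; simp [mix, Finset.smul_sum, smul_comm c]

theorem mix_map (W : Matrix (Fin n) (Fin n) ℝ) (Λ : V →ₗ[ℝ] V') (v : Fin n → V) :
    mix W (fun i => Λ (v i)) = fun i => Λ (mix W v i) := by
  ext i; simp [mix]

theorem mean_mix {W : Matrix (Fin n) (Fin n) ℝ} (hW : W ∈ doublyStochastic ℝ (Fin n))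
    (v : Fin n → V) : mean (mix W v) = mean v := by
  simp only [mean, mix]
  rw [Finset.sum_comm]
  congr 1
  refine Finset.sum_congr rfl fun j _ => ?_
  rw [← Finset.sum_smul, sum_col_of_mem_doublyStochastic hW, one_smul]

theorem mix_const {W : Matrix (Fin n) (Fin n) ℝ} (hW : W ∈ doublyStochastic ℝ (Fin n))
    (c : V) : mix W (fun _ => c) = fun _ => c := by
  ext i
  simp only [mix]
  rw [← Finset.sum_smul, sum_row_of_mem_doublyStochastic hW, one_smul]

end Linear

/-! ### Mean squares and disagreements -/

section Inner

variable {n : ℕ} {V V' : Type*} [NormedAddCommGroup V] [InnerProductSpace ℝ V]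
  [NormedAddCommGroup V'] [InnerProductSpace ℝ V']

/-- The mean square `(1/n) ∑ i, ‖v i‖²`. -/
def msq (v : Fin n → V) : ℝ := (n : ℝ)⁻¹ * ∑ i, ‖v i‖ ^ 2

/-- The real-valued disagreement `(1/n) ∑ i, ‖v i - mean v‖²`. -/
def dev (v : Fin n → V) : ℝ := msq (fun i => v i - mean v)

theorem msq_nonneg (v : Fin n → V) : 0 ≤ msq v := by unfold msq; positivity

theorem dev_nonneg (v : Fin n → V) : 0 ≤ dev v := msq_nonneg _

theorem msq_mono {u : Fin n → V} {v : Fin n → V'} {c : ℝ}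
    (h : ∀ i, ‖u i‖ ^ 2 ≤ c * ‖v i‖ ^ 2) : msq u ≤ c * msq v := by
  unfold msq
  rw [mul_left_comm, Finset.mul_sum _ _ c]
  exact mul_le_mul_of_nonneg_left (Finset.sum_le_sum fun i _ => h i) (by positivity)

theorem norm_add_sq_le_young (u v : V) {t : ℝ} (ht : 0 < t) :
    ‖u + v‖ ^ 2 ≤ (1 + t) * ‖u‖ ^ 2 + (1 + 1 / t) * ‖v‖ ^ 2 := by
  have h1 : ‖u + v‖ ^ 2 ≤ (‖u‖ + ‖v‖) ^ 2 := by gcongr; exact norm_add_le u v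
  have h2 : 0 ≤ (t * ‖u‖ - ‖v‖) ^ 2 / t := by positivity
  have h3 : (t * ‖u‖ - ‖v‖) ^ 2 / t = t * ‖u‖ ^ 2 - 2 * ‖u‖ * ‖v‖ + 1 / t * ‖v‖ ^ 2 := by
    field_simp
    ring
  nlinarith

theorem msq_add_le_young (u v : Fin n → V) {t : ℝ} (ht : 0 < t) :
    msq (u + v) ≤ (1 + t) * msq u + (1 + 1 / t) * msq v := by
  unfold msq
  rw [mul_left_comm, mul_left_comm (1 + 1 / t), ← mul_add, Finset.mul_sum _ _ (1 + t),
    Finset.mul_sum _ _ (1 + 1 / t), ← Finset.sum_add_distrib]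
  exact mul_le_mul_of_nonneg_left
    (Finset.sum_le_sum fun i _ => norm_add_sq_le_young _ _ ht) (by positivity)

theorem msq_add_le (u v : Fin n → V) : msq (u + v) ≤ 2 * msq u + 2 * msq v := by
  have := msq_add_le_young u v one_pos
  linarith

theorem msq_smul (c : ℝ) (v : Fin n → V) : msq (c • v) = c ^ 2 * msq v := by
  simp [msq, norm_smul, mul_pow, ← Finset.mul_sum]
  ring

theorem msq_neg (v : Fin n → V) : msq (-v) = msq v := by simp [msq]

theorem msq_sub_le (u v : Fin n → V) : msq (u - v) ≤ 2 * msq u + 2 * msq v := by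
  rw [sub_eq_add_neg, ← msq_neg v]; exact msq_add_le _ _

/-- Bias–variance decomposition: the cross term vanishes because deviations from the average sum to
zero. -/
theorem msq_eq_dev_add (hn : 0 < n) (v : Fin n → V) (c : V) :
    msq (fun i => v i - c) = dev v + ‖mean v - c‖ ^ 2 := by
  have hn' : (n : ℝ) ≠ 0 := by positivity
  have key : ∀ i, ‖v i - c‖ ^ 2
      = ‖v i - mean v‖ ^ 2 + 2 * inner ℝ (v i - mean v) (mean v - c) + ‖mean v - c‖ ^ 2 := by
    intro i
    rw [← norm_add_sq_real]; congr 2; abel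
  have h0 : ∑ i, (v i - mean v) = 0 := by
    rw [Finset.sum_sub_distrib]
    simp only [Finset.sum_const, Finset.card_univ, Fintype.card_fin, mean]
    rw [← Nat.cast_smul_eq_nsmul ℝ, smul_smul, mul_inv_cancel₀ hn', one_smul, sub_self]
  unfold dev msq
  simp_rw [key]
  rw [Finset.sum_add_distrib, Finset.sum_add_distrib, ← Finset.mul_sum, ← sum_inner, h0]
  simp only [inner_zero_left, Finset.sum_const, Finset.card_univ, Fintype.card_fin, nsmul_eq_mul]
  field_simp
  ring

theorem msq_eq (hn : 0 < n) (v : Fin n → V) : msq v = dev v + ‖mean v‖ ^ 2 := by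
  simpa using msq_eq_dev_add hn v 0

theorem dev_le_msq (hn : 0 < n) (v : Fin n → V) : dev v ≤ msq v := by
  rw [msq_eq hn]; nlinarith [sq_nonneg ‖mean v‖]

theorem norm_mean_sq_le (hn : 0 < n) (v : Fin n → V) : ‖mean v‖ ^ 2 ≤ msq v := by
  rw [msq_eq hn]; linarith [dev_nonneg v]

theorem dev_add_le_young (u v : Fin n → V) {t : ℝ} (ht : 0 < t) :
    dev (u + v) ≤ (1 + t) * dev u + (1 + 1 / t) * dev v := by
  unfold dev
  convert msq_add_le_young (fun i => u i - mean u) (fun i => v i - mean v) ht using 2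
  ext i; simp [mean_add]; abel

theorem dev_add_le (u v : Fin n → V) : dev (u + v) ≤ 2 * dev u + 2 * dev v := by
  have := dev_add_le_young u v one_pos
  linarith

theorem dev_smul (c : ℝ) (v : Fin n → V) : dev (c • v) = c ^ 2 * dev v := by
  unfold dev
  rw [← msq_smul]; congr 1; ext i; simp [mean_smul, smul_sub]

theorem dev_map_le (Λ : V →ₗ[ℝ] V') {c : ℝ} (hΛ : ∀ v, ‖Λ v‖ ^ 2 ≤ c * ‖v‖ ^ 2) (v : Fin n → V) :
    dev (fun i => Λ (v i)) ≤ c * dev v := by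
  unfold dev
  refine msq_mono fun i => ?_
  rw [mean_map, ← map_sub]; exact hΛ _

/-! ### Contraction of the disagreement -/

/-- Parseval with vector coefficients: the matrix of an orthonormal basis is orthogonal on both
sides, so no coordinates on `V` are needed. -/
theorem sum_norm_sq_orthonormalBasis (b : OrthonormalBasis (Fin n) ℝ (EuclideanSpace ℝ (Fin n)))
    (w : Fin n → V) : ∑ l, ‖∑ i, b l i • w i‖ ^ 2 = ∑ i, ‖w i‖ ^ 2 := by
  have hb : ∀ i j, ∑ l, b l i * b l j = if i = j then 1 else 0 := by
    intro i j
    have := b.sum_inner_mul_inner (EuclideanSpace.single i 1) (EuclideanSpace.single j 1)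
    simp only [EuclideanSpace.inner_single_left, EuclideanSpace.inner_single_right] at this
    simpa [eq_comm] using this
  simp_rw [← real_inner_self_eq_norm_sq, sum_inner, inner_sum, real_inner_smul_left,
    real_inner_smul_right]
  rw [Finset.sum_comm]
  refine Finset.sum_congr rfl fun i _ => ?_
  rw [Finset.sum_comm]
  simp_rw [← mul_assoc, ← Finset.sum_mul, hb]
  simp

theorem connectivity_nonneg {W : Matrix (Fin n) (Fin n) ℝ} (hW : W.IsHermitian) :
    0 ≤ connectivity hW := Real.iSup_nonneg fun _ => abs_nonneg _

/-- In an eigenbasis of `W`, mixing multiplies the coefficients of `v` by eigenvalues. Those past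
the first sorted index are controlled by `connectivity hW`, and the first eigenvector is parallel to
the ones vector, so a family with zero sum has no component along it. -/
theorem sum_norm_sq_mix_le {W : Matrix (Fin n) (Fin n) ℝ} (hW : W.IsHermitian)
    (hW' : W ∈ doublyStochastic ℝ (Fin n)) (hρ : connectivity hW < 1) (v : Fin n → V)
    (hv : ∑ i, v i = 0) :
    ∑ i, ‖mix W v i‖ ^ 2 ≤ connectivity hW ^ 2 * ∑ i, ‖v i‖ ^ 2 := by
  set b := hW.eigenvectorBasis with hb
  -- The reindexing used in the definition of `eigenvalues`, which makes `hev` hold by `rfl`.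
  set e : Fin (Fintype.card (Fin n)) ≃ Fin n := Fintype.equivOfCardEq (Fintype.card_fin _) with he
  have hev : ∀ l, hW.eigenvalues l = hW.eigenvalues₀ (e.symm l) := fun l => rfl
  have hle : ∀ l, 0 < (e.symm l : ℕ) → |hW.eigenvalues l| ≤ connectivity hW := by
    intro l hl
    rw [hev]
    exact le_ciSup (f := fun i : {i : Fin (Fintype.card (Fin n)) // 0 < (i : ℕ)} =>
      |hW.eigenvalues₀ i|) (Set.finite_range _).bddAbove ⟨e.symm l, hl⟩
  have hsymm : ∀ i j, W i j = W j i := fun i j => by simpa using (hW.apply i j).symm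
  have heig : ∀ l j, ∑ i, W i j * b l i = hW.eigenvalues l * b l j := by
    intro l j
    have := congrFun (hW.mulVec_eigenvectorBasis l) j
    simp only [Matrix.mulVec, dotProduct, Pi.smul_apply, smul_eq_mul] at this
    rw [← this]
    exact Finset.sum_congr rfl fun i _ => by rw [hsymm]
  have hcoef : ∀ l, ∑ i, b l i • mix W v i = hW.eigenvalues l • ∑ i, b l i • v i := by
    intro l
    simp only [mix, Finset.smul_sum]
    rw [Finset.sum_comm]
    refine Finset.sum_congr rfl fun j _ => ?_
    simp_rw [smul_smul]
    rw [← Finset.sum_smul, ← heig]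
    congr 1
    exact Finset.sum_congr rfl fun i _ => mul_comm _ _
  -- Unit line sums make `W` preserve the total of a vector, so an eigenvector with eigenvalue below
  -- 1 has total zero.
  have hone : ∀ l, 0 < (e.symm l : ℕ) → ∑ i, b l i = 0 := by
    intro l hl
    have h1 : ∑ j, ∑ i, W i j * b l i = ∑ i, b l i := by
      rw [Finset.sum_comm]
      refine Finset.sum_congr rfl fun i _ => ?_
      rw [← Finset.sum_mul, sum_row_of_mem_doublyStochastic hW', one_mul]
    simp_rw [heig, ← Finset.mul_sum] at h1
    have h2 := (abs_lt.1 ((hle l hl).trans_lt hρ)).2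
    have h3 : (hW.eigenvalues l - 1) * ∑ i, b l i = 0 := by linarith
    rcases mul_eq_zero.1 h3 with h | h
    · linarith
    · exact h
  have hzero : ∀ l, ¬ 0 < (e.symm l : ℕ) → ∑ i, b l i • v i = 0 := by
    intro l hl
    have huniq : ∀ l', l' ≠ l → 0 < (e.symm l' : ℕ) := by
      intro l' hne
      rcases Nat.eq_zero_or_pos (e.symm l' : ℕ) with h | h
      · exact absurd (e.symm.injective (Fin.ext (by omega))) hne
      · exact h
    -- Expand the ones vector in the basis: by `hone` only index `l` survives. That its eigenvalue
    -- is 1 is never needed.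
    have hexp : ∀ i, (∑ j, b l j) * b l i = 1 := by
      intro i
      have := b.sum_inner_mul_inner (EuclideanSpace.single i 1) (WithLp.toLp 2 1)
      simp only [PiLp.inner_apply] at this
      rw [Finset.sum_eq_single l] at this
      · simpa [mul_comm] using this
      · intro l' _ hne
        have := hone l' (huniq l' hne)
        simp [this]
      · simp
    have h1 : (∑ j, b l j) • ∑ i, b l i • v i = 0 := by
      rw [Finset.smul_sum]
      simp_rw [smul_smul, hexp, one_smul]
      exact hv
    rcases smul_eq_zero.1 h1 with h | h
    · have := hexp l
      rw [h, zero_mul] at this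
      exact absurd this zero_ne_one
    · exact h
  rw [← sum_norm_sq_orthonormalBasis b (mix W v), ← sum_norm_sq_orthonormalBasis b v,
    Finset.mul_sum]
  refine Finset.sum_le_sum fun l _ => ?_
  rw [hcoef]
  by_cases hl : 0 < (e.symm l : ℕ)
  · rw [norm_smul, mul_pow, Real.norm_eq_abs]
    gcongr
    exact hle l hl
  · rw [hzero l hl]; simp

theorem dev_mix_le {W : Matrix (Fin n) (Fin n) ℝ} (hW : W.IsHermitian)
    (hW' : W ∈ doublyStochastic ℝ (Fin n)) (hρ : connectivity hW < 1) (v : Fin n → V) :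
    dev (mix W v) ≤ connectivity hW ^ 2 * dev v := by
  rcases Nat.eq_zero_or_pos n with rfl | hn
  · simp [dev, msq]
  have hn' : (n : ℝ) ≠ 0 := by positivity
  have h0 : ∑ i, (v i - mean v) = 0 := by
    rw [Finset.sum_sub_distrib]
    simp only [Finset.sum_const, Finset.card_univ, Fintype.card_fin, mean]
    rw [← Nat.cast_smul_eq_nsmul ℝ, smul_smul, mul_inv_cancel₀ hn', one_smul, sub_self]
  have h1 := sum_norm_sq_mix_le hW hW' hρ _ h0
  have h2 : mix W (fun i => v i - mean v) = fun i => mix W v i - mean (mix W v) := by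
    rw [mean_mix hW']
    have := mix_sub W v (fun _ => mean v)
    rw [mix_const hW'] at this
    exact this
  rw [h2] at h1
  unfold dev msq
  rw [mul_left_comm]
  gcongr

/-- Young's inequality with parameter 1 - ρ: since (2 - ρ)ρ² = ρ - ρ(1 - ρ)² ≤ ρ, a contraction by ρ
remains after the perturbation is split off. -/
theorem dev_mix_add_le {W : Matrix (Fin n) (Fin n) ℝ} {ρ : ℝ} (hρ0 : 0 ≤ ρ) (hρ : ρ < 1)
    (hW : ∀ v : Fin n → V, dev (mix W v) ≤ ρ ^ 2 * dev v) (u v : Fin n → V) :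
    dev (mix W u + v) ≤ ρ * dev u + 2 / (1 - ρ) * dev v := by
  have ha : 0 < 1 - ρ := by linarith
  refine (dev_add_le_young _ _ ha).trans (add_le_add ?_ ?_)
  · calc (1 + (1 - ρ)) * dev (mix W u) ≤ (1 + (1 - ρ)) * (ρ ^ 2 * dev u) := by
          gcongr; exact hW u
      _ = ρ * dev u - ρ * (1 - ρ) ^ 2 * dev u := by ring
      _ ≤ ρ * dev u := by
          have : 0 ≤ ρ * (1 - ρ) ^ 2 * dev u := by have := dev_nonneg u; positivity
          linarith
  · refine mul_le_mul_of_nonneg_right ?_ (dev_nonneg v)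
    rw [le_div_iff₀ ha]
    have : (1 + 1 / (1 - ρ)) * (1 - ρ) = (1 - ρ) + 1 := by field_simp
    linarith

end Inner

/-! ### Pathwise analysis of gradient tracking -/

theorem sum_le_of_contraction {x r : ℕ → ℝ} {ρ : ℝ} (h : ∀ k, x (k + 1) ≤ ρ * x k + r k) (m : ℕ) :
    (1 - ρ) * ∑ k ∈ Finset.range m, x k + x m ≤ x 0 + ∑ k ∈ Finset.range m, r k := by
  induction m with
  | zero => simp
  | succ m ih =>
    rw [Finset.sum_range_succ, Finset.sum_range_succ]
    linarith [h m]

/-- The spare `x m` in `sum_le_of_contraction` dominates `(1 - ρ) * x m`, so `m` remainders suffice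
for `m + 1` terms. -/
theorem sum_succ_le_of_contraction {x r : ℕ → ℝ} {ρ : ℝ} (hρ : 0 ≤ ρ) (hx : ∀ k, 0 ≤ x k)
    (h : ∀ k, x (k + 1) ≤ ρ * x k + r k) (m : ℕ) :
    (1 - ρ) * ∑ k ∈ Finset.range (m + 1), x k ≤ x 0 + ∑ k ∈ Finset.range m, r k := by
  rw [Finset.sum_range_succ]
  have := sum_le_of_contraction h m
  nlinarith [hx m]

theorem norm_sub_zero_sq_le_sum {V : Type*} [SeminormedAddCommGroup V] (u : ℕ → V) (k : ℕ) :
    ‖u k - u 0‖ ^ 2 ≤ k * ∑ j ∈ Finset.range k, ‖u (j + 1) - u j‖ ^ 2 := by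
  calc ‖u k - u 0‖ ^ 2 = ‖∑ j ∈ Finset.range k, (u (j + 1) - u j)‖ ^ 2 := by
        rw [Finset.sum_range_sub]
    _ ≤ (∑ j ∈ Finset.range k, ‖u (j + 1) - u j‖) ^ 2 := by gcongr; exact norm_sum_le _ _
    _ ≤ _ := by
        have := sq_sum_le_card_mul_sum_sq (s := Finset.range k) (f := fun j => ‖u (j + 1) - u j‖)
        simpa using this

/-- A slowly decreasing nonnegative sequence starting from `μ₀`. -/
structure SlowDecay (μ : ℕ → ℝ) (μ₀ : ℝ) : Prop where
  zero : μ 0 = μ₀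
  nonneg : ∀ k, 0 ≤ μ k
  anti : ∀ k, μ (k + 1) ≤ μ k
  slow : ∀ k, (μ k - μ (k + 1)) * (k + 1) ≤ μ k

namespace SlowDecay

variable {μ : ℕ → ℝ} {μ₀ : ℝ} (h : SlowDecay μ μ₀)
include h

theorem le (k : ℕ) : μ k ≤ μ₀ := by
  rw [← h.zero]; exact antitone_nat_of_succ_le h.anti (Nat.zero_le k)

/-- By `slow`, one factor μ_k - μ_{k+1} times k + 1 is at most μ₀; the other factor telescopes. The
weight k + 1 pays for the Cauchy–Schwarz loss in `norm_sub_zero_sq_le_sum`. -/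
theorem sum_sq_mul_le (m : ℕ) :
    ∑ k ∈ Finset.range m, (μ (k + 1) - μ k) ^ 2 * (k + 1) ≤ μ₀ ^ 2 := by
  have h1 : ∀ k, (μ (k + 1) - μ k) ^ 2 * (k + 1) ≤ μ₀ * (μ k - μ (k + 1)) := by
    intro k
    have h2 := h.slow k
    have h3 := h.le k
    have h4 := h.anti k
    calc (μ (k + 1) - μ k) ^ 2 * (k + 1) = (μ k - μ (k + 1)) * ((μ k - μ (k + 1)) * (k + 1)) := by
          ring
      _ ≤ (μ k - μ (k + 1)) * μ₀ := by
          apply mul_le_mul_of_nonneg_left <;> linarith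
      _ = _ := mul_comm _ _
  calc _ ≤ ∑ k ∈ Finset.range m, μ₀ * (μ k - μ (k + 1)) := Finset.sum_le_sum fun k _ => h1 k
    _ = μ₀ * (μ 0 - μ m) := by rw [← Finset.mul_sum, Finset.sum_range_sub']
    _ ≤ μ₀ * μ₀ := by
        have := h.nonneg 0
        have := h.nonneg m
        rw [h.zero] at *
        gcongr
        linarith
    _ = _ := by ring

theorem sum_sq_le (m : ℕ) : ∑ k ∈ Finset.range m, (μ (k + 1) - μ k) ^ 2 ≤ μ₀ ^ 2 := by
  refine le_trans (Finset.sum_le_sum fun k _ => ?_) (h.sum_sq_mul_le m)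
  have : (0 : ℝ) ≤ (k : ℝ) := k.cast_nonneg
  nlinarith [sq_nonneg (μ (k + 1) - μ k)]

theorem sq_le (k : ℕ) : (μ (k + 1) - μ k) ^ 2 ≤ μ₀ ^ 2 := by
  refine le_trans ?_ (h.sum_sq_le (k + 1))
  exact Finset.single_le_sum (f := fun k => (μ (k + 1) - μ k) ^ 2) (fun _ _ => sq_nonneg _)
    (Finset.self_mem_range_succ k)

end SlowDecay

/-! ### Consensus errors of gradient tracking -/

section Tracking

variable {n : ℕ} {V : Type*} [NormedAddCommGroup V] [InnerProductSpace ℝ V]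

/-- Iterates `s`, trackers `D` and estimators `H` of a gradient tracking method with
preconditioner `Λ` and step size `lam`. -/
structure IsTracking (W : Matrix (Fin n) (Fin n) ℝ) (Λ : V →ₗ[ℝ] V) (lam : ℝ)
    (s D H : ℕ → Fin n → V) : Prop where
  tracker_zero : D 0 = mix W (H 0)
  tracker_succ : ∀ k, D (k + 1) = mix W (D k + H (k + 1) - H k)
  iterate_succ : ∀ k, s (k + 1) = mix W (s k - lam • fun i => Λ (D k i))

/-- A mixing matrix contracts disagreements by the factor `ρ < 1`. -/
structure Mixes (W : Matrix (Fin n) (Fin n) ℝ) (V : Type*) [NormedAddCommGroup V]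
    [InnerProductSpace ℝ V] (ρ : ℝ) : Prop where
  nonneg : 0 ≤ ρ
  lt_one : ρ < 1
  pos : 0 < n
  stoch : W ∈ doublyStochastic ℝ (Fin n)
  contract : ∀ v : Fin n → V, dev (mix W v) ≤ ρ ^ 2 * dev v

theorem Mixes.dev_mix_le {W : Matrix (Fin n) (Fin n) ℝ} {ρ : ℝ} (hW : Mixes W V ρ)
    (v : Fin n → V) : dev (mix W v) ≤ dev v := by
  refine (hW.contract v).trans ?_
  have := hW.nonneg
  have := hW.lt_one
  have : ρ ^ 2 ≤ 1 := by nlinarith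
  nlinarith [dev_nonneg v]

variable {W : Matrix (Fin n) (Fin n) ℝ} {Λ : V →ₗ[ℝ] V} {lam ρ c : ℝ} {s D H : ℕ → Fin n → V}

/-- The invariant of gradient tracking: mixing preserves averages and the corrections telescope, so
tracker errors do not enter the averaged dynamics. -/
theorem IsTracking.mean_tracker (h : IsTracking W Λ lam s D H) (hW : Mixes W V ρ) (k : ℕ) :
    mean (D k) = mean (H k) := by
  induction k with
  | zero => rw [h.tracker_zero, mean_mix hW.stoch]
  | succ k ih => rw [h.tracker_succ, mean_mix hW.stoch, mean_sub, mean_add, ih]; abel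

theorem IsTracking.mean_iterate (h : IsTracking W Λ lam s D H) (hW : Mixes W V ρ) (k : ℕ) :
    mean (s (k + 1)) = mean (s k) - lam • Λ (mean (H k)) := by
  rw [h.iterate_succ, mean_mix hW.stoch, mean_sub, mean_smul, mean_map, h.mean_tracker hW]

theorem IsTracking.dev_iterate_succ_le (h : IsTracking W Λ lam s D H) (hW : Mixes W V ρ)
    (hΛ : ∀ v, ‖Λ v‖ ^ 2 ≤ c * ‖v‖ ^ 2) (k : ℕ) :
    dev (s (k + 1)) ≤ ρ * dev (s k) + 2 / (1 - ρ) * (lam ^ 2 * (c * dev (D k))) := by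
  have ha : 0 < 1 - ρ := by linarith [hW.lt_one]
  have h1 : s (k + 1) = mix W (s k) + (-lam) • mix W (fun i => Λ (D k i)) := by
    rw [h.iterate_succ, mix_sub, mix_smul, neg_smul, sub_eq_add_neg]
  rw [h1]
  refine (dev_mix_add_le hW.nonneg hW.lt_one hW.contract _ _).trans ?_
  rw [dev_smul, neg_sq]
  gcongr
  exact (hW.dev_mix_le _).trans (dev_map_le Λ hΛ _)

theorem IsTracking.dev_tracker_succ_le (h : IsTracking W Λ lam s D H) (hW : Mixes W V ρ) (k : ℕ) :
    dev (D (k + 1)) ≤ ρ * dev (D k) + 2 / (1 - ρ) * dev (mix W (H (k + 1) - H k)) := by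
  rw [h.tracker_succ, add_sub_assoc, mix_add]
  exact dev_mix_add_le hW.nonneg hW.lt_one hW.contract _ _

/-- The estimators are `μ_k A_i + B_i` plus noise, with `A_i`, `B_i` Lipschitz. -/
structure IsEstimator (μ : ℕ → ℝ) (A B : Fin n → V → V) (L : ℝ) (s H ν : ℕ → Fin n → V) :
    Prop where
  eq : ∀ k i, H k i = μ k • A i (s k i) + B i (s k i) + ν k i
  lipA : ∀ i u v, ‖A i u - A i v‖ ≤ L * ‖u - v‖
  lipB : ∀ i u v, ‖B i u - B i v‖ ≤ L * ‖u - v‖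

variable {μ : ℕ → ℝ} {μ₀ L : ℝ} {A B : Fin n → V → V} {ν : ℕ → Fin n → V}

/-- Three sources of change: noise `N`, movement of the iterates `R`, and the change `δ` of the
penalty acting on `A`. The last is split at a reference point `z`; the values `A i z` stay under
`mix W` because the first trackers control their dispersion only after mixing. -/
theorem IsEstimator.dev_mix_sub_le (h : IsEstimator μ A B L s H ν) (hW : Mixes W V ρ)
    (hμ : SlowDecay μ μ₀) (k : ℕ) (z : V) :
    dev (mix W (H (k + 1) - H k)) ≤ 8 * msq (ν (k + 1)) + 8 * msq (ν k)
      + 8 * (L * (1 + μ₀)) ^ 2 * msq (s (k + 1) - s k)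
      + 8 * (μ (k + 1) - μ k) ^ 2 * L ^ 2 * msq (fun i => s k i - z)
      + 2 * (μ (k + 1) - μ k) ^ 2 * dev (mix W fun i => A i z) := by
  set δ := μ (k + 1) - μ k with hδ
  set N : Fin n → V := ν (k + 1) - ν k with hN
  set R : Fin n → V := fun i => μ (k + 1) • (A i (s (k + 1) i) - A i (s k i))
    + (B i (s (k + 1) i) - B i (s k i)) with hR
  set S : Fin n → V := fun i => A i (s k i) - A i z with hS
  have e1 : H (k + 1) - H k = (N + (R + δ • S)) + δ • fun i => A i z := by
    ext i
    simp only [Pi.sub_apply, Pi.add_apply, Pi.smul_apply, h.eq, hN, hR, hS, hδ]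
    module
  have b1 : dev (mix W (H (k + 1) - H k))
      ≤ 2 * msq (N + (R + δ • S)) + 2 * (δ ^ 2 * dev (mix W fun i => A i z)) := by
    rw [e1, mix_add, mix_smul]
    refine (dev_add_le _ _).trans ?_
    rw [dev_smul]
    gcongr
    exact (hW.dev_mix_le _).trans (dev_le_msq hW.pos _)
  have b2 : msq (N + (R + δ • S)) ≤ 2 * msq N + 2 * (2 * msq R + 2 * (δ ^ 2 * msq S)) := by
    refine (msq_add_le _ _).trans ?_
    gcongr
    refine (msq_add_le _ _).trans ?_
    rw [msq_smul]
  have b3 : msq N ≤ 2 * msq (ν (k + 1)) + 2 * msq (ν k) := msq_sub_le _ _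
  have b4 : msq R ≤ (L * (1 + μ₀)) ^ 2 * msq (s (k + 1) - s k) := by
    refine msq_mono fun i => ?_
    rw [← mul_pow]
    refine pow_le_pow_left₀ (norm_nonneg _) ?_ 2
    refine (norm_add_le _ _).trans ?_
    rw [norm_smul, Real.norm_of_nonneg (hμ.nonneg _)]
    have h1 := h.lipA i (s (k + 1) i) (s k i)
    have h2 := h.lipB i (s (k + 1) i) (s k i)
    have h3 := hμ.le (k + 1)
    have h4 := hμ.nonneg (k + 1)
    have h5 : μ (k + 1) * ‖A i (s (k + 1) i) - A i (s k i)‖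
        ≤ μ₀ * (L * ‖s (k + 1) i - s k i‖) :=
      mul_le_mul h3 h1 (norm_nonneg _) (h4.trans h3)
    simp only [Pi.sub_apply]
    nlinarith
  have b5 : msq S ≤ L ^ 2 * msq (fun i => s k i - z) := by
    refine msq_mono fun i => ?_
    rw [← mul_pow]
    exact pow_le_pow_left₀ (norm_nonneg _) (h.lipA i _ _) 2
  have b6 := mul_le_mul_of_nonneg_left b5 (sq_nonneg δ)
  nlinarith

/-- Each of the two contractions costs 1/a for summation and 1/a for Young's inequality; eliminating
the tracker sum `ST` compounds them to a⁻⁴. -/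
theorem le_of_contraction_pair {a c lam E X₀ D₀ SX ST Z : ℝ} (ha : 0 < a) (ha1 : a ≤ 1)
    (hc : 0 ≤ c) (hE : 0 ≤ E) (hZ : 0 ≤ Z) (hD₀ : 0 ≤ D₀)
    (hX : a * SX ≤ X₀ + 2 * lam ^ 2 * c / a * ST) (hT : a * ST ≤ D₀ + 2 / a * (E * Z)) :
    SX ≤ X₀ / a + (2 * c + 4 * c * E) * (lam ^ 2 / a ^ 4) * (D₀ + Z) := by
  have hT' : ST ≤ (D₀ + 2 * E * Z) / a ^ 2 := by
    rw [le_div_iff₀ (by positivity)]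
    have h1 := mul_le_mul_of_nonneg_left hT ha.le
    have h2 : a * (D₀ + 2 / a * (E * Z)) = a * D₀ + 2 * E * Z := by field_simp
    nlinarith
  have h1 : SX = a * SX / a := by field_simp
  calc SX ≤ (X₀ + 2 * lam ^ 2 * c / a * ((D₀ + 2 * E * Z) / a ^ 2)) / a := by
        rw [h1]; gcongr; exact hX.trans (by gcongr)
    _ = X₀ / a + 2 * lam ^ 2 * c / a ^ 4 * (D₀ + 2 * E * Z) := by field_simp
    _ ≤ X₀ / a + 2 * lam ^ 2 * c / a ^ 4 * ((1 + 2 * E) * (D₀ + Z)) := by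
        gcongr; nlinarith [mul_nonneg hE hD₀]
    _ = _ := by ring

theorem sum_range_shift_le {x : ℕ → ℝ} (hx : ∀ k, 0 ≤ x k) (m : ℕ) :
    ∑ k ∈ Finset.range m, x (k + 1) ≤ ∑ k ∈ Finset.range (m + 1), x k := by
  rw [Finset.sum_range_succ' x]; linarith [hx 0]

theorem sum_range_trunc_le {x : ℕ → ℝ} (hx : ∀ k, 0 ≤ x k) (m : ℕ) :
    ∑ k ∈ Finset.range m, x k ≤ ∑ k ∈ Finset.range (m + 1), x k := by
  rw [Finset.sum_range_succ x]; linarith [hx m]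

theorem msq_sub_le_dev (hn : 0 < n) (u v : Fin n → V) :
    msq (u - v) ≤ 2 * dev u + 2 * dev v + ‖mean u - mean v‖ ^ 2 := by
  rw [msq_eq hn, mean_sub]
  have := dev_add_le u ((-1 : ℝ) • v)
  rw [dev_smul, neg_one_smul, ← sub_eq_add_neg] at this
  linarith

/-- The reference point is the initial average. Cauchy–Schwarz bounds the drift of the average from
it by `k * SY`, to be paired with the weighted sum of squared penalty increments. -/
theorem IsEstimator.dev_mix_sub_le' (hH : IsEstimator μ A B L s H ν) (hW : Mixes W V ρ)
    (hμ : SlowDecay μ μ₀) {SY : ℝ} {k : ℕ}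
    (hSY : ∑ j ∈ Finset.range k, ‖mean (s (j + 1)) - mean (s j)‖ ^ 2 ≤ SY) :
    dev (mix W (H (k + 1) - H k)) ≤
        8 * msq (ν (k + 1)) + 8 * msq (ν k) + 16 * (L * (1 + μ₀)) ^ 2 * dev (s (k + 1))
        + 24 * (L * (1 + μ₀)) ^ 2 * dev (s k)
        + 8 * (L * (1 + μ₀)) ^ 2 * ‖mean (s (k + 1)) - mean (s k)‖ ^ 2
        + 8 * (L ^ 2 * SY) * ((μ (k + 1) - μ k) ^ 2 * (k + 1))
        + 2 * dev (mix W fun i => A i (mean (s 0))) * (μ (k + 1) - μ k) ^ 2 := by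
  set K := L * (1 + μ₀) with hK
  have hμ0 : 0 ≤ μ₀ := hμ.zero ▸ hμ.nonneg 0
  have hSY0 : 0 ≤ SY := le_trans (Finset.sum_nonneg fun _ _ => sq_nonneg _) hSY
  have hLK : μ₀ ^ 2 * L ^ 2 ≤ K ^ 2 := by
    rw [hK, ← mul_pow, mul_comm, mul_pow, mul_pow]
    gcongr
    linarith
  have hdrift : msq (fun i => s k i - mean (s 0)) ≤ dev (s k) + k * SY := by
    rw [msq_eq_dev_add hW.pos]
    gcongr
    refine (norm_sub_zero_sq_le_sum (fun k => mean (s k)) k).trans ?_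
    gcongr
  refine (hH.dev_mix_sub_le hW hμ k (mean (s 0))).trans ?_
  have h1 := mul_le_mul_of_nonneg_left (msq_sub_le_dev hW.pos (s (k + 1)) (s k))
    (by positivity : 0 ≤ 8 * K ^ 2)
  have h2 := mul_le_mul_of_nonneg_left hdrift
    (by positivity : 0 ≤ 8 * (μ (k + 1) - μ k) ^ 2 * L ^ 2)
  have h3 : (μ (k + 1) - μ k) ^ 2 * L ^ 2 * dev (s k) ≤ K ^ 2 * dev (s k) := by
    refine mul_le_mul_of_nonneg_right (le_trans ?_ hLK) (dev_nonneg _)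
    exact mul_le_mul_of_nonneg_right (hμ.sq_le k) (sq_nonneg L)
  have h4 : 0 ≤ (μ (k + 1) - μ k) ^ 2 * L ^ 2 * SY := by positivity
  linarith

theorem IsEstimator.sum_dev_mix_sub_le (hH : IsEstimator μ A B L s H ν) (hW : Mixes W V ρ)
    (hμ : SlowDecay μ μ₀) (m : ℕ) :
    ∑ k ∈ Finset.range m, dev (mix W (H (k + 1) - H k))
      ≤ (16 + 48 * (L * (1 + μ₀)) ^ 2) * (∑ k ∈ Finset.range (m + 1), msq (ν k)
          + ∑ k ∈ Finset.range (m + 1), dev (s k)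
          + ∑ k ∈ Finset.range (m + 1), ‖mean (s (k + 1)) - mean (s k)‖ ^ 2
          + μ₀ ^ 2 * dev (mix W fun i => A i (mean (s 0)))) := by
  have hμ0 : 0 ≤ μ₀ := hμ.zero ▸ hμ.nonneg 0
  set SY := ∑ k ∈ Finset.range (m + 1), ‖mean (s (k + 1)) - mean (s k)‖ ^ 2 with hSY
  have hSY0 : 0 ≤ SY := Finset.sum_nonneg fun _ _ => sq_nonneg _
  have step : ∀ k ∈ Finset.range m, _ := fun k hk =>
    hH.dev_mix_sub_le' hW hμ (k := k) (SY := SY) <|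
      Finset.sum_le_sum_of_subset_of_nonneg
        (Finset.range_mono (by have := Finset.mem_range.1 hk; omega)) fun _ _ _ => sq_nonneg _
  refine (Finset.sum_le_sum step).trans ?_
  simp only [Finset.sum_add_distrib, ← Finset.mul_sum]
  have hLK : μ₀ ^ 2 * L ^ 2 ≤ (L * (1 + μ₀)) ^ 2 := by
    rw [← mul_pow, mul_comm, mul_pow, mul_pow]
    gcongr
    linarith
  generalize L * (1 + μ₀) = K at *
  have hX0 : ∀ k, 0 ≤ dev (s k) := fun k => dev_nonneg _
  have hN0 : ∀ k, 0 ≤ msq (ν k) := fun k => msq_nonneg _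
  have t1 := sum_range_shift_le hN0 m
  have t2 := sum_range_trunc_le hN0 m
  have t3 := sum_range_shift_le hX0 m
  have t4 := sum_range_trunc_le hX0 m
  have t5 := sum_range_trunc_le (x := fun k => ‖mean (s (k + 1)) - mean (s k)‖ ^ 2)
    (fun k => sq_nonneg _) m
  have t6 := hμ.sum_sq_mul_le m
  have t7 := hμ.sum_sq_le m
  have hq0 : 0 ≤ dev (mix W fun i => A i (mean (s 0))) := dev_nonneg _
  have hSN0 : 0 ≤ ∑ k ∈ Finset.range (m + 1), msq (ν k) := Finset.sum_nonneg fun k _ => hN0 k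
  have hSX0 : 0 ≤ ∑ k ∈ Finset.range (m + 1), dev (s k) := Finset.sum_nonneg fun k _ => hX0 k
  rw [← hSY] at t5
  clear_value SY
  clear step hSY
  -- With every sum an opaque real, the rest is linear in the products prepared below.
  generalize dev (mix W fun i => A i (mean (s 0))) = q at *
  generalize ∑ k ∈ Finset.range (m + 1), msq (ν k) = SN at *
  generalize ∑ k ∈ Finset.range (m + 1), dev (s k) = SX at *
  generalize ∑ k ∈ Finset.range m, msq (ν (k + 1)) = SN1 at *
  generalize ∑ k ∈ Finset.range m, msq (ν k) = SN2 at *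
  generalize ∑ k ∈ Finset.range m, dev (s (k + 1)) = SX1 at *
  generalize ∑ k ∈ Finset.range m, dev (s k) = SX2 at *
  generalize ∑ k ∈ Finset.range m, ‖mean (s (k + 1)) - mean (s k)‖ ^ 2 = SY1 at *
  generalize ∑ k ∈ Finset.range m, (μ (k + 1) - μ k) ^ 2 * ((k : ℝ) + 1) = P at *
  generalize ∑ k ∈ Finset.range m, (μ (k + 1) - μ k) ^ 2 = R at *
  have t3 := mul_le_mul_of_nonneg_left t3 (by positivity : 0 ≤ 16 * K ^ 2)
  have t4 := mul_le_mul_of_nonneg_left t4 (by positivity : 0 ≤ 24 * K ^ 2)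
  have t5 := mul_le_mul_of_nonneg_left t5 (by positivity : 0 ≤ 8 * K ^ 2)
  have t6 := mul_le_mul_of_nonneg_left t6 (by positivity : 0 ≤ 8 * (L ^ 2 * SY))
  have t7 := mul_le_mul_of_nonneg_left t7 (by positivity : 0 ≤ 2 * q)
  have t8 := mul_le_mul_of_nonneg_right hLK hSY0
  have p1 : 0 ≤ K ^ 2 * SN := by positivity
  have p2 : 0 ≤ K ^ 2 * SX := by positivity
  have p3 : 0 ≤ K ^ 2 * SY := by positivity
  have p4 : 0 ≤ K ^ 2 * (μ₀ ^ 2 * q) := by positivity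
  have p5 : 0 ≤ μ₀ ^ 2 * q := by positivity
  linarith

/-- Consensus errors over a run, in terms of noise, movement of the average and initial data. -/
theorem IsTracking.sum_dev_le (h : IsTracking W Λ lam s D H) (hW : Mixes W V ρ)
    (hΛ : ∀ v, ‖Λ v‖ ^ 2 ≤ c * ‖v‖ ^ 2) (hc : 0 ≤ c)
    (hH : IsEstimator μ A B L s H ν) (hμ : SlowDecay μ μ₀) (m : ℕ) :
    ∑ k ∈ Finset.range (m + 1), dev (s k) ≤ dev (s 0) / (1 - ρ)
      + (2 * c + 4 * c * (16 + 48 * (L * (1 + μ₀)) ^ 2)) * (lam ^ 2 / (1 - ρ) ^ 4)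
        * (dev (D 0) + (∑ k ∈ Finset.range (m + 1), msq (ν k)
          + ∑ k ∈ Finset.range (m + 1), dev (s k)
          + ∑ k ∈ Finset.range (m + 1), ‖mean (s (k + 1)) - mean (s k)‖ ^ 2
          + μ₀ ^ 2 * dev (mix W fun i => A i (mean (s 0))))) := by
  have ha : 0 < 1 - ρ := by linarith [hW.lt_one]
  have hX0 : ∀ k, 0 ≤ dev (s k) := fun k => dev_nonneg _
  have hZ : 0 ≤ ∑ k ∈ Finset.range (m + 1), msq (ν k) + ∑ k ∈ Finset.range (m + 1), dev (s k)
      + ∑ k ∈ Finset.range (m + 1), ‖mean (s (k + 1)) - mean (s k)‖ ^ 2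
      + μ₀ ^ 2 * dev (mix W fun i => A i (mean (s 0))) :=
    add_nonneg (add_nonneg (add_nonneg (Finset.sum_nonneg fun _ _ => msq_nonneg _)
      (Finset.sum_nonneg fun _ _ => dev_nonneg _)) (Finset.sum_nonneg fun _ _ => sq_nonneg _))
      (mul_nonneg (sq_nonneg _) (dev_nonneg _))
  refine le_of_contraction_pair (ST := ∑ k ∈ Finset.range (m + 1), dev (D k)) ha
    (by linarith [hW.nonneg]) hc (by positivity) hZ (dev_nonneg _) ?_ ?_
  · refine (sum_succ_le_of_contraction hW.nonneg hX0 (h.dev_iterate_succ_le hW hΛ) m).trans ?_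
    gcongr
    have e : 2 * lam ^ 2 * c / (1 - ρ) = 2 / (1 - ρ) * (lam ^ 2 * c) := by ring
    rw [e]
    simp only [← Finset.mul_sum]
    have := mul_le_mul_of_nonneg_left (sum_range_trunc_le (fun k => dev_nonneg (D k)) m)
      (by positivity : 0 ≤ 2 / (1 - ρ) * (lam ^ 2 * c))
    simpa only [mul_assoc] using this
  · refine (sum_succ_le_of_contraction hW.nonneg (fun k => dev_nonneg (D k))
      (h.dev_tracker_succ_le hW) m).trans ?_
    rw [← Finset.mul_sum]
    gcongr
    exact hH.sum_dev_mix_sub_le hW hμ m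

/-! ### Descent -/

/-- Lyapunov functions `U k` for the averaged dynamics `v' = -Λ (mean (μ_k A_i + B_i))`, with
gradients `dU k` and dissipation `Γ k`. -/
structure IsLyapunov (μ : ℕ → ℝ) (A B : Fin n → V → V) (Λ : V →ₗ[ℝ] V) (U : ℕ → V → ℝ)
    (dU : ℕ → V → V) (Γ : ℕ → V → ℝ) (c₁ c₄ M : ℝ) : Prop where
  nonneg : ∀ k v, 0 ≤ U k v
  anti : ∀ k v, U (k + 1) v ≤ U k v
  quad : ∀ k v v', U k v' ≤ U k v + inner ℝ (dU k v) (v' - v) + M * ‖v' - v‖ ^ 2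
  dissipation : ∀ k v, c₁ * Γ k v ≤ inner ℝ (dU k v) (Λ (mean fun i => μ k • A i v + B i v))
  norm_drift : ∀ k v, ‖mean fun i => μ k • A i v + B i v‖ ^ 2 ≤ c₄ * Γ k v
  norm_grad : ∀ k v, ‖dU k v‖ ^ 2 ≤ c₄ * Γ k v

variable {U : ℕ → V → ℝ} {dU : ℕ → V → V} {Γ : ℕ → V → ℝ} {c₁ c₄ M : ℝ}

/-- The bias of the average estimator caused by disagreement. -/
def bias (μ : ℕ → ℝ) (A B : Fin n → V → V) (s : ℕ → Fin n → V) (k : ℕ) : V :=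
  mean fun i => (μ k • A i (s k i) + B i (s k i))
    - (μ k • A i (mean (s k)) + B i (mean (s k)))

theorem IsEstimator.mean_eq (hH : IsEstimator μ A B L s H ν) (k : ℕ) :
    mean (H k) = (mean fun i => μ k • A i (mean (s k)) + B i (mean (s k)))
      + bias μ A B s k + mean (ν k) := by
  rw [bias, ← mean_add, ← mean_add]
  congr 1
  ext i
  simp [hH.eq]

theorem IsEstimator.norm_bias_sq_le (hH : IsEstimator μ A B L s H ν) (hn : 0 < n)
    (hμ : SlowDecay μ μ₀) (k : ℕ) :
    ‖bias μ A B s k‖ ^ 2 ≤ (L * (1 + μ₀)) ^ 2 * dev (s k) := by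
  refine (norm_mean_sq_le hn _).trans (msq_mono fun i => ?_)
  rw [← mul_pow]
  refine pow_le_pow_left₀ (norm_nonneg _) ?_ 2
  have e : μ k • A i (s k i) + B i (s k i) - (μ k • A i (mean (s k)) + B i (mean (s k)))
      = μ k • (A i (s k i) - A i (mean (s k))) + (B i (s k i) - B i (mean (s k))) := by module
  rw [e]
  refine (norm_add_le _ _).trans ?_
  rw [norm_smul, Real.norm_of_nonneg (hμ.nonneg _)]
  have h1 := hH.lipA i (s k i) (mean (s k))
  have h2 := hH.lipB i (s k i) (mean (s k))
  have h5 := mul_le_mul (hμ.le k) h1 (norm_nonneg _) ((hμ.nonneg k).trans (hμ.le k))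
  nlinarith

theorem norm_add₃_sq_le (u v w : V) : ‖u + v + w‖ ^ 2 ≤ 3 * (‖u‖ ^ 2 + ‖v‖ ^ 2 + ‖w‖ ^ 2) := by
  have h1 : ‖u + v + w‖ ^ 2 ≤ (‖u‖ + ‖v‖ + ‖w‖) ^ 2 := by gcongr; exact norm_add₃_le
  nlinarith [sq_nonneg (‖u‖ - ‖v‖), sq_nonneg (‖u‖ - ‖w‖), sq_nonneg (‖v‖ - ‖w‖)]

theorem IsTracking.move_le (h : IsTracking W Λ lam s D H) (hW : Mixes W V ρ)
    (hΛ : ∀ v, ‖Λ v‖ ^ 2 ≤ c * ‖v‖ ^ 2) (hc : 0 ≤ c)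
    (hH : IsEstimator μ A B L s H ν) (hμ : SlowDecay μ μ₀)
    (hU : IsLyapunov μ A B Λ U dU Γ c₁ c₄ M) (k : ℕ) :
    ‖mean (s (k + 1)) - mean (s k)‖ ^ 2 ≤ 3 * c * lam ^ 2 *
      (c₄ * Γ k (mean (s k)) + (L * (1 + μ₀)) ^ 2 * dev (s k) + ‖mean (ν k)‖ ^ 2) := by
  rw [h.mean_iterate hW, sub_sub_cancel_left, norm_neg, norm_smul, mul_pow, Real.norm_eq_abs,
    sq_abs]
  calc lam ^ 2 * ‖Λ (mean (H k))‖ ^ 2 ≤ lam ^ 2 * (c * ‖mean (H k)‖ ^ 2) := by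
        gcongr; exact hΛ _
    _ ≤ lam ^ 2 * (c * (3 * (‖mean fun i => μ k • A i (mean (s k)) + B i (mean (s k))‖ ^ 2
          + ‖bias μ A B s k‖ ^ 2 + ‖mean (ν k)‖ ^ 2))) := by
        rw [hH.mean_eq]; gcongr; exact norm_add₃_sq_le _ _ _
    _ ≤ lam ^ 2 * (c * (3 * (c₄ * Γ k (mean (s k)) + (L * (1 + μ₀)) ^ 2 * dev (s k)
          + ‖mean (ν k)‖ ^ 2))) := by
        gcongr
        · exact hU.norm_drift _ _
        · exact hH.norm_bias_sq_le hW.pos hμ k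
    _ = _ := by ring

/-- The first-order term splits into dissipation, bias and noise. Young's inequality charges c₁/4 of
the dissipation for the bias, and `hlamM` another c₁/4 for the second-order term, leaving c₁/2. The
noise product is kept exactly because its expectation will vanish. -/
theorem IsTracking.descent (h : IsTracking W Λ lam s D H) (hW : Mixes W V ρ)
    (hΛ : ∀ v, ‖Λ v‖ ^ 2 ≤ c * ‖v‖ ^ 2) (hc : 0 ≤ c)
    (hH : IsEstimator μ A B L s H ν) (hμ : SlowDecay μ μ₀)
    (hU : IsLyapunov μ A B Λ U dU Γ c₁ c₄ M) (hc₁ : 0 < c₁) (hc₄ : 0 < c₄) (hM : 0 ≤ M)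
    (hlam : 0 < lam) (hlam1 : lam ≤ 1) (hlamM : 12 * M * c * c₄ * lam ≤ c₁) (k : ℕ) :
    c₁ / 2 * lam * Γ k (mean (s k)) ≤ U k (mean (s k)) - U (k + 1) (mean (s (k + 1)))
      - lam * inner ℝ (dU k (mean (s k))) (Λ (mean (ν k)))
      + lam * ((L * (1 + μ₀)) ^ 2 * (c₄ * c / c₁ + 3 * M * c)) * dev (s k)
      + 3 * M * c * lam ^ 2 * ‖mean (ν k)‖ ^ 2 := by
  set v := mean (s k) with hv
  have hΓ : 0 ≤ Γ k v := by
    have := (sq_nonneg _).trans (hU.norm_grad k v)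
    exact nonneg_of_mul_nonneg_right this hc₄
  have h1 := (hU.anti k (mean (s (k + 1)))).trans (hU.quad k v (mean (s (k + 1))))
  have h2 := mul_le_mul_of_nonneg_left (h.move_le hW hΛ hc hH hμ hU k) hM
  have h3 := hU.dissipation k v
  have e : mean (s (k + 1)) - v = -(lam • Λ (mean (H k))) := by
    rw [h.mean_iterate hW, sub_sub_cancel_left]
  have h4 : inner ℝ (dU k v) (mean (s (k + 1)) - v)
      = -lam * inner ℝ (dU k v) (Λ (mean fun i => μ k • A i v + B i v))
        - lam * inner ℝ (dU k v) (Λ (bias μ A B s k)) - lam * inner ℝ (dU k v) (Λ (mean (ν k))) := by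
    rw [e, inner_neg_right, real_inner_smul_right, hH.mean_eq, map_add, map_add, inner_add_right,
      inner_add_right]
    ring
  have h5 : -inner ℝ (dU k v) (Λ (bias μ A B s k))
      ≤ c₁ / 4 * Γ k v + c₄ * c / c₁ * ((L * (1 + μ₀)) ^ 2 * dev (s k)) := by
    have a1 : -inner ℝ (dU k v) (Λ (bias μ A B s k)) ≤ ‖dU k v‖ * ‖Λ (bias μ A B s k)‖ := by
      rw [← inner_neg_left, ← norm_neg (dU k v)]; exact real_inner_le_norm _ _
    have a2 := hU.norm_grad k v
    have a3 : ‖Λ (bias μ A B s k)‖ ^ 2 ≤ c * ((L * (1 + μ₀)) ^ 2 * dev (s k)) :=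
      (hΛ _).trans (mul_le_mul_of_nonneg_left (hH.norm_bias_sq_le hW.pos hμ k) hc)
    have a4 : ‖dU k v‖ * ‖Λ (bias μ A B s k)‖
        ≤ c₁ / (4 * c₄) * ‖dU k v‖ ^ 2 + c₄ / c₁ * ‖Λ (bias μ A B s k)‖ ^ 2 := by
      have : 0 ≤ c₄ / c₁ * (c₁ / (2 * c₄) * ‖dU k v‖ - ‖Λ (bias μ A B s k)‖) ^ 2 := by positivity
      have e2 : c₄ / c₁ * (c₁ / (2 * c₄) * ‖dU k v‖ - ‖Λ (bias μ A B s k)‖) ^ 2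
          = c₁ / (4 * c₄) * ‖dU k v‖ ^ 2 + c₄ / c₁ * ‖Λ (bias μ A B s k)‖ ^ 2
            - ‖dU k v‖ * ‖Λ (bias μ A B s k)‖ := by field_simp; ring
      linarith
    calc _ ≤ _ := a1.trans a4
      _ ≤ c₁ / (4 * c₄) * (c₄ * Γ k v)
          + c₄ / c₁ * (c * ((L * (1 + μ₀)) ^ 2 * dev (s k))) := by gcongr
      _ = _ := by field_simp
  have h6 := mul_le_mul_of_nonneg_left h5 hlam.le
  have h7 := mul_le_mul_of_nonneg_left h3 hlam.le
  have h8 := mul_le_mul_of_nonneg_right hlamM (mul_nonneg hlam.le hΓ)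
  have h9 : 3 * M * c * lam ^ 2 * ((L * (1 + μ₀)) ^ 2 * dev (s k))
      ≤ 3 * M * c * lam * ((L * (1 + μ₀)) ^ 2 * dev (s k)) := by
    have := dev_nonneg (s k)
    gcongr
    nlinarith
  rw [h4] at h1
  nlinarith

theorem IsTracking.sum_descent (h : IsTracking W Λ lam s D H) (hW : Mixes W V ρ)
    (hΛ : ∀ v, ‖Λ v‖ ^ 2 ≤ c * ‖v‖ ^ 2) (hc : 0 ≤ c)
    (hH : IsEstimator μ A B L s H ν) (hμ : SlowDecay μ μ₀)
    (hU : IsLyapunov μ A B Λ U dU Γ c₁ c₄ M) (hc₁ : 0 < c₁) (hc₄ : 0 < c₄) (hM : 0 ≤ M)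
    (hlam : 0 < lam) (hlam1 : lam ≤ 1) (hlamM : 12 * M * c * c₄ * lam ≤ c₁) (m : ℕ) :
    c₁ / 2 * lam * ∑ k ∈ Finset.range m, Γ k (mean (s k)) ≤ U 0 (mean (s 0))
      - lam * ∑ k ∈ Finset.range m, inner ℝ (dU k (mean (s k))) (Λ (mean (ν k)))
      + lam * ((L * (1 + μ₀)) ^ 2 * (c₄ * c / c₁ + 3 * M * c)) * ∑ k ∈ Finset.range m, dev (s k)
      + 3 * M * c * lam ^ 2 * ∑ k ∈ Finset.range m, ‖mean (ν k)‖ ^ 2 := by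
  have h1 := Finset.sum_le_sum fun k (_ : k ∈ Finset.range m) =>
    h.descent hW hΛ hc hH hμ hU hc₁ hc₄ hM hlam hlam1 hlamM k
  have h2 := hU.nonneg m (mean (s m))
  simp only [Finset.sum_add_distrib, Finset.sum_sub_distrib, ← Finset.mul_sum] at h1
  have h3 := Finset.sum_range_sub' (fun k => U k (mean (s k))) m
  simp only [Finset.sum_sub_distrib] at h3
  linarith

/-- Combination of the consensus, movement and descent inequalities over a run. -/
theorem exists_combined_bound {c c₁ c₄ M K K₁ C₆ : ℝ} (hc : 0 ≤ c) (hc₁ : 0 < c₁) (hc₄ : 0 < c₄)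
    (hM : 0 ≤ M) (hK₁ : 0 ≤ K₁) (hC₆ : 0 ≤ C₆) :
    ∃ C : ℝ, 1 ≤ C ∧ ∀ lam a X₀ D₀ SX SN SY Q G Nν J : ℝ, 0 < lam → 0 < a → a ≤ 1 →
      C * lam ≤ a ^ 2 → 0 ≤ X₀ → 0 ≤ D₀ → 0 ≤ SX → 0 ≤ Q → 0 ≤ G → 0 ≤ Nν → Nν ≤ SN →
      SX ≤ X₀ / a + K₁ * (lam ^ 2 / a ^ 4) * (D₀ + (SN + SX + SY + Q)) →
      SY ≤ 3 * c * lam ^ 2 * (c₄ * G + K ^ 2 * SX + Nν) →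
      (lam ≤ 1 → 12 * M * c * c₄ * lam ≤ c₁ →
        c₁ / 2 * lam * G ≤ J + lam * C₆ * SX + 3 * M * c * lam ^ 2 * Nν) →
      lam * G ≤ 4 / c₁ * J
        + C * (lam * (X₀ / a + lam ^ 2 / a ^ 4 * (D₀ + SN + Q)) + lam ^ 2 * Nν) := by
  -- One summand per requirement: `K₁ * r ≤ 1/4`, movement coefficients at most 1, the step size
  -- condition of the descent, absorption of the dissipation fed back by the consensus error, and
  -- the coefficient of the conclusion.
  set C := 1 + 4 * K₁ + 3 * c * (K ^ 2 + 1) + 12 * M * c * c₄ / c₁ + 6 * c * c₄ * C₆ / c₁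
    + 4 / c₁ * (2 * C₆ + 4 * K₁ * C₆ + 3 * M * c) with hC
  have p1 : 0 ≤ 3 * c * (K ^ 2 + 1) := by positivity
  have p2 : 0 ≤ 12 * M * c * c₄ / c₁ := by positivity
  have p3 : 0 ≤ 6 * c * c₄ * C₆ / c₁ := by positivity
  have p4 : 0 ≤ 4 / c₁ * (2 * C₆ + 4 * K₁ * C₆ + 3 * M * c) := by positivity
  have hC1 : 1 ≤ C := by rw [hC]; linarith
  refine ⟨C, hC1, fun lam a X₀ D₀ SX SN SY Q G Nν J hlam ha ha1 hla hX₀ hD₀ hSX hQ hG hNν hNS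
    h1 h2 h3 => ?_⟩
  have hCl1 : C * lam ≤ 1 := hla.trans (by nlinarith)
  have hl1 : lam ≤ 1 := by nlinarith
  have small : ∀ x, 0 ≤ x → x ≤ C → x * lam ^ 2 ≤ 1 := by
    intro x hx hxC
    calc x * lam ^ 2 = x * lam * lam := by ring
      _ ≤ C * lam * 1 := by gcongr
      _ ≤ 1 := by linarith
  have hlM : 12 * M * c * c₄ * lam ≤ c₁ := by
    have : 12 * M * c * c₄ / c₁ * lam ≤ 1 := by
      refine le_trans ?_ hCl1
      gcongr
      rw [hC]; linarith
    calc 12 * M * c * c₄ * lam = 12 * M * c * c₄ / c₁ * lam * c₁ := by field_simp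
      _ ≤ 1 * c₁ := by gcongr
      _ = c₁ := one_mul _
  have h3 := h3 hl1 hlM
  set r := lam ^ 2 / a ^ 4 with hr
  have hr0 : 0 ≤ r := by positivity
  have hrK : K₁ * r ≤ 1 / 4 := by
    -- The square of `C * lam ≤ a ^ 2`: the feedback factor lam²/a⁴ dictates this threshold for the
    -- step size.
    have e : C ^ 2 * r ≤ 1 := by
      rw [hr, ← mul_div_assoc, div_le_one (by positivity), ← mul_pow]
      calc (C * lam) ^ 2 ≤ (a ^ 2) ^ 2 := by gcongr
        _ = a ^ 4 := by ring
    have : 4 * K₁ ≤ C ^ 2 := by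
      refine le_trans ?_ (le_self_pow₀ hC1 two_ne_zero)
      rw [hC]; linarith
    linarith [mul_le_mul_of_nonneg_right this hr0]
  have hs1 : 3 * c * K ^ 2 * lam ^ 2 ≤ 1 := small _ (by positivity) (by rw [hC]; linarith)
  have hs2 : 3 * c * lam ^ 2 ≤ 1 := small _ (by positivity) (by
    have : 0 ≤ 3 * c * K ^ 2 := by positivity
    rw [hC]; linarith)
  have hs3 : 6 * c * c₄ * C₆ * lam ^ 2 ≤ c₁ := by
    have := small _ p3 (by rw [hC]; linarith)
    calc 6 * c * c₄ * C₆ * lam ^ 2 = 6 * c * c₄ * C₆ / c₁ * lam ^ 2 * c₁ := by field_simp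
      _ ≤ 1 * c₁ := by gcongr
      _ = c₁ := one_mul _
  have hSN : 0 ≤ SN := hNν.trans hNS
  set κ := K₁ * r with hκ
  have hκ0 : 0 ≤ κ := by positivity
  have h4 : SY ≤ 3 * c * c₄ * lam ^ 2 * G + SX + SN := by
    have b1 := mul_le_mul_of_nonneg_right hs1 hSX
    have b2 := mul_le_mul hs2 hNS hNν (by norm_num)
    linarith
  -- After inserting `h4`, `SX` appears on the right with factor 2κ ≤ 1/2 and is absorbed.
  have h5 : SX ≤ 2 * (X₀ / a) + 4 * κ * (D₀ + SN + Q) + 6 * κ * c * c₄ * lam ^ 2 * G := by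
    have b1 := mul_le_mul_of_nonneg_left h4 hκ0
    have b2 := mul_le_mul_of_nonneg_right hrK hSX
    have b3 : 0 ≤ κ * D₀ := by positivity
    have b4 : 0 ≤ κ * Q := by positivity
    linarith
  -- The dissipation that returns through the consensus error uses half of the available c₁/2.
  have h6 : lam * C₆ * (6 * κ * c * c₄ * lam ^ 2 * G) ≤ c₁ / 4 * lam * G := by
    calc lam * C₆ * (6 * κ * c * c₄ * lam ^ 2 * G)
        = κ * ((6 * c * c₄ * C₆ * lam ^ 2) * (lam * G)) := by ring
      _ ≤ 1 / 4 * (c₁ * (lam * G)) := by gcongr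
      _ = _ := by ring
  have h7 := mul_le_mul_of_nonneg_left h5 (mul_nonneg hlam.le hC₆)
  have h8 : c₁ / 4 * lam * G ≤ J + lam * C₆ * (2 * (X₀ / a) + 4 * κ * (D₀ + SN + Q))
      + 3 * M * c * lam ^ 2 * Nν := by linarith
  have h9 : lam * G ≤ 4 / c₁ * (J + lam * C₆ * (2 * (X₀ / a) + 4 * κ * (D₀ + SN + Q))
      + 3 * M * c * lam ^ 2 * Nν) := by
    calc lam * G = 4 / c₁ * (c₁ / 4 * lam * G) := by field_simp
      _ ≤ _ := by gcongr
  refine h9.trans ?_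
  rw [add_assoc, mul_add (4 / c₁)]
  refine add_le_add le_rfl ?_
  have hbig : 4 / c₁ * (2 * C₆ + 4 * K₁ * C₆ + 3 * M * c) ≤ C := by rw [hC]; linarith
  refine le_trans ?_ (mul_le_mul_of_nonneg_right hbig (by positivity))
  rw [mul_assoc (4 / c₁)]
  refine mul_le_mul_of_nonneg_left ?_ (by positivity)
  have g1 : 0 ≤ lam * (X₀ / a) := by positivity
  have g2 : 0 ≤ lam * (r * (D₀ + SN + Q)) := by positivity
  have g3 : 0 ≤ lam ^ 2 * Nν := by positivity
  have f1 := mul_nonneg hC₆ g1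
  have f2 := mul_nonneg hC₆ g2
  have f3 := mul_nonneg (mul_nonneg hK₁ hC₆) g1
  have f5 := mul_nonneg hC₆ g3
  have f6 := mul_nonneg (mul_nonneg hK₁ hC₆) g3
  have f7 := mul_nonneg (mul_nonneg hM hc) g1
  have f8 := mul_nonneg (mul_nonneg hM hc) g2
  simp only [hκ]
  linarith

end Tracking

/-! ### Functions with quadratic first-order error -/

section QuadGrad

variable {E : Type*} [NormedAddCommGroup E] [InnerProductSpace ℝ E]

/-- `g` is a gradient of `f` with first-order error at most `M ‖z' - z‖²`. -/
def HasQuadGrad (f : E → ℝ) (g : E → E) (M : ℝ) : Prop :=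
  ∀ z z', |f z' - f z - inner ℝ (g z) (z' - z)| ≤ M * ‖z' - z‖ ^ 2

theorem HasQuadGrad.add {f f' : E → ℝ} {g g' : E → E} {M M' : ℝ} (h : HasQuadGrad f g M)
    (h' : HasQuadGrad f' g' M') : HasQuadGrad (fun z => f z + f' z) (fun z => g z + g' z) (M + M') :=
  fun z z' => by
    rw [inner_add_left, add_mul]
    refine le_trans (le_of_eq ?_) ((abs_add_le _ _).trans (add_le_add (h z z') (h' z z')))
    congr 1; ring

theorem HasQuadGrad.const_mul {f : E → ℝ} {g : E → E} {M : ℝ} (h : HasQuadGrad f g M) (c : ℝ) :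
    HasQuadGrad (fun z => c * f z) (fun z => c • g z) (|c| * M) := fun z z' => by
  rw [real_inner_smul_left, mul_assoc, ← mul_sub, ← mul_sub, abs_mul]
  exact mul_le_mul_of_nonneg_left (h z z') (abs_nonneg c)

theorem HasQuadGrad.sub_const {f : E → ℝ} {g : E → E} {M : ℝ} (h : HasQuadGrad f g M) (c : ℝ) :
    HasQuadGrad (fun z => f z - c) g M := fun z z' => by simpa using h z z'

theorem HasQuadGrad.sum {ι : Type*} (t : Finset ι) {f : ι → E → ℝ} {g : ι → E → E} {M : ℝ}
    (h : ∀ i, HasQuadGrad (f i) (g i) M) :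
    HasQuadGrad (fun z => ∑ i ∈ t, f i z) (fun z => ∑ i ∈ t, g i z) (t.card * M) := fun z z' => by
  rw [sum_inner, ← Finset.sum_sub_distrib, ← Finset.sum_sub_distrib]
  refine (Finset.abs_sum_le_sum_abs _ _).trans ((Finset.sum_le_sum fun i _ => h i z z').trans ?_)
  simp [mul_assoc]

theorem HasQuadGrad.le {f : E → ℝ} {g : E → E} {M : ℝ} (h : HasQuadGrad f g M) (z z' : E) :
    f z' ≤ f z + inner ℝ (g z) (z' - z) + M * ‖z' - z‖ ^ 2 := by
  linarith [(abs_le.1 (h z z')).2]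

theorem HasQuadGrad.ge {f : E → ℝ} {g : E → E} {M : ℝ} (h : HasQuadGrad f g M) (z z' : E) :
    f z + inner ℝ (g z) (z' - z) - M * ‖z' - z‖ ^ 2 ≤ f z' := by
  linarith [(abs_le.1 (h z z')).1]

/-- A quadratic error is o(‖z' - z‖). This is how explicit gradient formulas are identified with
`∇`. -/
theorem HasQuadGrad.hasGradientAt [CompleteSpace E] {f : E → ℝ} {g : E → E} {M : ℝ}
    (h : HasQuadGrad f g M) (z : E) : HasGradientAt f (g z) z := by
  rw [hasGradientAt_iff_isLittleO]
  have h1 : (fun z' => f z' - f z - inner ℝ (g z) (z' - z)) =O[nhds z]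
      fun z' => ‖z' - z‖ ^ 2 := by
    refine Asymptotics.IsBigO.of_bound M (Filter.Eventually.of_forall fun z' => ?_)
    rw [Real.norm_eq_abs, Real.norm_of_nonneg (sq_nonneg _)]
    exact h z z'
  refine h1.trans_isLittleO ?_
  have h2 := Asymptotics.isLittleO_norm_pow_id (E' := E) one_lt_two
  have h3 : Filter.Tendsto (fun z' => z' - z) (nhds z) (nhds 0) := by
    have : Filter.Tendsto (fun z' => z' - z) (nhds z) (nhds (z - z)) :=
      (continuous_id.sub continuous_const).tendsto z
    rwa [sub_self] at this
  exact h2.comp_tendsto h3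

theorem hasQuadGrad_gradient [CompleteSpace E] {f : E → ℝ} {L : ℝ} (hL : 0 ≤ L)
    (hf : Differentiable ℝ f) (h : ∀ z z', ‖∇ f z - ∇ f z'‖ ≤ L * ‖z - z'‖) :
    HasQuadGrad f (fun z => ∇ f z) L := fun z z' => by
  have key := Convex.norm_image_sub_le_of_norm_fderiv_le' (𝕜 := ℝ) (f := f) (s := segment ℝ z z')
    (x := z) (y := z') (φ := fderiv ℝ f z) (C := L * ‖z' - z‖) (fun x _ => hf x) ?_
    (convex_segment z z') (left_mem_segment ℝ z z') (right_mem_segment ℝ z z')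
  · rw [← toDual_gradient, InnerProductSpace.toDual_apply_apply, Real.norm_eq_abs] at key
    rwa [pow_two, ← mul_assoc]
  · intro x hx
    rw [← toDual_gradient, ← toDual_gradient, ← map_sub, LinearIsometryEquiv.norm_map]
    refine (h x z).trans ?_
    gcongr
    obtain ⟨a, b, ha, hb, hab, rfl⟩ := hx
    have : a • z + b • z' - z = b • (z' - z) := by
      have : a = 1 - b := by linarith
      subst this; module
    rw [this, norm_smul, Real.norm_of_nonneg hb]
    have : b ≤ 1 := by linarith
    nlinarith [norm_nonneg (z' - z)]

/-- Test at z' + t w with w = g z - g z' and ‖t w‖ = ‖z' - z‖; the three expansions lose 4M, M and M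
times ‖z' - z‖². It serves to make gradients along the run measurable and square integrable. -/
theorem HasQuadGrad.lipschitz {f : E → ℝ} {g : E → E} {M : ℝ} (h : HasQuadGrad f g M) (z z' : E) :
    ‖g z - g z'‖ ≤ 6 * M * ‖z - z'‖ := by
  rcases eq_or_ne z z' with rfl | hz
  · simp
  have hd : 0 < ‖z' - z‖ := norm_pos_iff.2 (sub_ne_zero.2 hz.symm)
  have hM : 0 ≤ M :=
    nonneg_of_mul_nonneg_left ((abs_nonneg _).trans (h z z')) (by positivity : 0 < ‖z' - z‖ ^ 2)
  rw [norm_sub_rev z z']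
  rcases (norm_nonneg (g z - g z')).eq_or_lt with hw | hw
  · rw [← hw]; positivity
  set w := g z - g z' with hwdef
  set t := ‖z' - z‖ / ‖w‖ with ht
  have htw : ‖t • w‖ = ‖z' - z‖ := by
    rw [norm_smul, Real.norm_of_nonneg (by positivity), ht, div_mul_cancel₀ _ hw.ne']
  have h1 := h.ge z (z' + t • w)
  have h2 := h.le z' (z' + t • w)
  have h3 := h.le z z'
  have e : z' + t • w - z = (z' - z) + t • w := by abel
  have h4 : ‖(z' - z) + t • w‖ ^ 2 ≤ 4 * ‖z' - z‖ ^ 2 := by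
    have := norm_add_le (z' - z) (t • w)
    rw [htw] at this
    nlinarith [norm_nonneg ((z' - z) + t • w)]
  have h5 := mul_le_mul_of_nonneg_left h4 hM
  rw [e, inner_add_right] at h1
  rw [add_sub_cancel_left, htw] at h2
  have h6 : inner ℝ (g z) (t • w) - inner ℝ (g z') (t • w) = ‖z' - z‖ * ‖w‖ := by
    rw [← inner_sub_left, ← hwdef, real_inner_smul_right, real_inner_self_eq_norm_sq, ht]
    field_simp
  refine le_of_mul_le_mul_left ?_ hd
  linarith

theorem HasQuadGrad.grad_eq_zero {f : E → ℝ} {g : E → E} {M : ℝ} (h : HasQuadGrad f g M) {z : E}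
    (hz : ∀ z', f z ≤ f z') : g z = 0 := by
  -- With M t ≤ 1/2, the step from `z` to `z - t • g z` would decrease `f` unless `g z = 0`.
  set t : ℝ := 1 / (2 * (|M| + 1)) with ht
  have ht0 : 0 < t := by positivity
  have h1 := (hz (z - t • g z)).trans (h.le z (z - t • g z))
  rw [sub_sub_cancel_left, inner_neg_right, real_inner_smul_right, real_inner_self_eq_norm_sq,
    norm_neg, norm_smul, Real.norm_of_nonneg ht0.le] at h1
  have h2 : t * (|M| + 1) = 1 / 2 := by rw [ht]; field_simp
  have h3 : M * t ≤ 1 / 2 := by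
    have := le_abs_self M
    nlinarith
  have h4 : t * ‖g z‖ ^ 2 ≤ t * ‖g z‖ ^ 2 * (M * t) := by nlinarith
  have h5 : 0 ≤ t * ‖g z‖ ^ 2 := by positivity
  have h6 : t * ‖g z‖ ^ 2 ≤ 0 := by nlinarith
  have h7 : ‖g z‖ ^ 2 ≤ 0 := by
    by_contra hcon
    push Not at hcon
    nlinarith [mul_pos ht0 hcon]
  simpa using h7

end QuadGrad

/-! ### The combined variable `(x, y, θ)` -/

/-- The space of the combined variables `((x, y), θ)`. -/
abbrev St (dx dy : ℕ) := WithLp 2 (Pt dx dy × Vec dy)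

/-- The combined variable `(z, θ)`. -/
def st {dx dy : ℕ} (z : Pt dx dy) (θ : Vec dy) : St dx dy := WithLp.toLp 2 (z, θ)

section Pairs

variable {dx dy : ℕ}

@[simp] theorem pt_fst (x : Vec dx) (y : Vec dy) : (pt x y).fst = x := rfl
@[simp] theorem pt_snd (x : Vec dx) (y : Vec dy) : (pt x y).snd = y := rfl
@[simp] theorem st_fst (z : Pt dx dy) (θ : Vec dy) : (st z θ).fst = z := rfl
@[simp] theorem st_snd (z : Pt dx dy) (θ : Vec dy) : (st z θ).snd = θ := rfl

theorem pt_ext {z z' : Pt dx dy} (h₁ : z.fst = z'.fst) (h₂ : z.snd = z'.snd) : z = z' :=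
  WithLp.ofLp_injective 2 (Prod.ext h₁ h₂)

theorem st_ext {s s' : St dx dy} (h₁ : s.fst = s'.fst) (h₂ : s.snd = s'.snd) : s = s' :=
  WithLp.ofLp_injective 2 (Prod.ext h₁ h₂)

theorem norm_sq_pt (z : Pt dx dy) : ‖z‖ ^ 2 = ‖z.fst‖ ^ 2 + ‖z.snd‖ ^ 2 :=
  WithLp.prod_norm_sq_eq_of_L2 z

theorem norm_sq_st (s : St dx dy) : ‖s‖ ^ 2 = ‖s.fst‖ ^ 2 + ‖s.snd‖ ^ 2 :=
  WithLp.prod_norm_sq_eq_of_L2 s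

theorem inner_pt (z z' : Pt dx dy) : inner ℝ z z' = inner ℝ z.fst z'.fst + inner ℝ z.snd z'.snd :=
  WithLp.prod_inner_apply z z'

theorem inner_st (s s' : St dx dy) : inner ℝ s s' = inner ℝ s.fst s'.fst + inner ℝ s.snd s'.snd :=
  WithLp.prod_inner_apply s s'

theorem norm_pt_le (z : Pt dx dy) : ‖z‖ ≤ ‖z.fst‖ + ‖z.snd‖ := by
  refine le_of_sq_le_sq ?_ (by positivity)
  rw [norm_sq_pt]
  nlinarith [norm_nonneg z.fst, norm_nonneg z.snd]

theorem norm_st_le (s : St dx dy) : ‖s‖ ≤ ‖s.fst‖ + ‖s.snd‖ := by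
  refine le_of_sq_le_sq ?_ (by positivity)
  rw [norm_sq_st]
  nlinarith [norm_nonneg s.fst, norm_nonneg s.snd]

theorem HasQuadGrad.comp_fst {f : Pt dx dy → ℝ} {g : Pt dx dy → Pt dx dy} {M : ℝ}
    (h : HasQuadGrad f g M) (hM : 0 ≤ M) :
    HasQuadGrad (fun s : St dx dy => f s.fst) (fun s => st (g s.fst) 0) M := fun s s' => by
  rw [inner_st]
  simp only [st_fst, st_snd, inner_zero_left, add_zero, WithLp.sub_fst]
  refine (h _ _).trans ?_
  gcongr
  exact WithLp.norm_fst_le _ (s' - s)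

end Pairs

/-! ### The proximal lower-level problem -/

namespace Problem

variable {n dx dy : ℕ} {Sf Sg : Type*} (P : Problem n dx dy Sf Sg)

/-- The gradient of `F`. -/
def gF (z : Pt dx dy) : Pt dx dy := mean fun i => ∇ (P.f i) z

/-- The gradient of `G`. -/
def gG (z : Pt dx dy) : Pt dx dy := mean fun i => ∇ (P.g i) z

/-- The gradient of `proxObj` in `z = (x, y)`. -/
def gPz (γ : ℝ) (z : Pt dx dy) (θ : Vec dy) : Pt dx dy :=
  pt (P.gG (pt z.fst θ)).fst ((1 / γ) • (z.snd - θ))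

/-- The gradient of `proxObj` in `θ`. -/
def gPθ (γ : ℝ) (z : Pt dx dy) (θ : Vec dy) : Vec dy :=
  (P.gG (pt z.fst θ)).snd + (1 / γ) • (θ - z.snd)

/-- The gradient of the Moreau envelope. -/
def gV (γ : ℝ) (z : Pt dx dy) : Pt dx dy := P.gPz γ z (P.thetaStar γ z)

/-- The gradient of the penalty function `Ψ_μ`. -/
def gPsi (γ μ : ℝ) (z : Pt dx dy) : Pt dx dy := μ • P.gF z + P.gG z - P.gV γ z

variable {P} {L₁ L₂ γ Lθ : ℝ}

theorem lipschitz_mean {n : ℕ} (hn : 0 < n) {E E' : Type*} [NormedAddCommGroup E]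
    [NormedAddCommGroup E'] [InnerProductSpace ℝ E'] {L : ℝ} {g : Fin n → E → E'}
    (h : ∀ i z z', ‖g i z - g i z'‖ ≤ L * ‖z - z'‖) (z z' : E) :
    ‖(mean fun i => g i z) - mean fun i => g i z'‖ ≤ L * ‖z - z'‖ := by
  have hn' : (0 : ℝ) < n := by positivity
  rw [← mean_sub, mean, norm_smul, norm_inv, Real.norm_natCast, inv_mul_le_iff₀ hn']
  refine (norm_sum_le _ _).trans ((Finset.sum_le_sum fun i _ => h i z z').trans ?_)
  simp

theorem hasQuadGrad_mean {n : ℕ} (hn : 0 < n) {E : Type*} [NormedAddCommGroup E]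
    [InnerProductSpace ℝ E] {M : ℝ} {f : Fin n → E → ℝ} {g : Fin n → E → E}
    (h : ∀ i, HasQuadGrad (f i) (g i) M) :
    HasQuadGrad (fun z => (n : ℝ)⁻¹ * ∑ i, f i z) (fun z => mean fun i => g i z) M := by
  have hn' : (n : ℝ) ≠ 0 := by positivity
  have := (HasQuadGrad.sum Finset.univ h).const_mul (n : ℝ)⁻¹
  have e : |(n : ℝ)⁻¹| * (((Finset.univ : Finset (Fin n)).card : ℝ) * M) = M := by
    rw [abs_of_nonneg (by positivity), Finset.card_univ, Fintype.card_fin, ← mul_assoc,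
      inv_mul_cancel₀ hn', one_mul]
  rwa [e] at this

section

variable (hn : 0 < n) (hS : Smooth P L₁ L₂) (hL₁ : 0 < L₁) (hL₂ : 0 < L₂)
include hn hS

theorem gG_lipschitz (z z' : Pt dx dy) : ‖P.gG z - P.gG z'‖ ≤ L₂ * ‖z - z'‖ :=
  lipschitz_mean hn hS.smooth_g z z'

include hL₁ in
theorem hasQuadGrad_F : HasQuadGrad P.F P.gF L₁ :=
  hasQuadGrad_mean hn fun i => hasQuadGrad_gradient hL₁.le
    ((hS.contDiff_f i).differentiable one_ne_zero) (hS.smooth_f i)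

include hL₂

theorem hasQuadGrad_G : HasQuadGrad P.G P.gG L₂ :=
  hasQuadGrad_mean hn fun i => hasQuadGrad_gradient hL₂.le
    ((hS.contDiff_g i).differentiable one_ne_zero) (hS.smooth_g i)

variable (hγ : 0 < γ)
include hγ

/-- The proximal term is exactly quadratic in b = θ - y, and ‖b' - b‖² ≤ 2‖s' - s‖² turns 1/(2γ)
into 1/γ. -/
theorem hasQuadGrad_proxObj : HasQuadGrad (fun s : St dx dy => P.proxObj γ s.fst s.snd)
    (fun s => st (P.gPz γ s.fst s.snd) (P.gPθ γ s.fst s.snd)) (L₂ + 1 / γ) := by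
  intro s s'
  have h1 := hasQuadGrad_G hn hS hL₂ (pt s.fst.fst s.snd) (pt s'.fst.fst s'.snd)
  set b := s.snd - s.fst.snd with hb
  set b' := s'.snd - s'.fst.snd with hb'
  have h2 : ‖b'‖ ^ 2 = ‖b‖ ^ 2 + 2 * inner ℝ b (b' - b) + ‖b' - b‖ ^ 2 := by
    rw [← norm_add_sq_real]; congr 2; abel
  have h3 : b' - b = (s' - s).snd - (s' - s).fst.snd := by
    simp only [hb, hb', WithLp.sub_fst, WithLp.sub_snd]; abel
  have n1 : ‖s' - s‖ ^ 2
      = ‖(s' - s).fst.fst‖ ^ 2 + ‖(s' - s).fst.snd‖ ^ 2 + ‖(s' - s).snd‖ ^ 2 := by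
    rw [norm_sq_st, norm_sq_pt]
  have h4 : ‖b' - b‖ ^ 2 ≤ 2 * ‖s' - s‖ ^ 2 := by
    rw [h3]
    have : ‖(s' - s).snd - (s' - s).fst.snd‖ ^ 2
        ≤ (‖(s' - s).snd‖ + ‖(s' - s).fst.snd‖) ^ 2 := by gcongr; exact norm_sub_le _ _
    nlinarith [sq_nonneg (‖(s' - s).snd‖ - ‖(s' - s).fst.snd‖), sq_nonneg ‖(s' - s).fst.fst‖]
  have h5 : ‖pt s'.fst.fst s'.snd - pt s.fst.fst s.snd‖ ^ 2 ≤ ‖s' - s‖ ^ 2 := by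
    rw [n1, norm_sq_pt]
    simp only [WithLp.sub_fst, WithLp.sub_snd, pt_fst, pt_snd]
    nlinarith [sq_nonneg ‖s'.fst.snd - s.fst.snd‖]
  have h6 : P.proxObj γ s'.fst s'.snd - P.proxObj γ s.fst s.snd
      - inner ℝ (st (P.gPz γ s.fst s.snd) (P.gPθ γ s.fst s.snd)) (s' - s)
      = (P.G (pt s'.fst.fst s'.snd) - P.G (pt s.fst.fst s.snd)
        - inner ℝ (P.gG (pt s.fst.fst s.snd)) (pt s'.fst.fst s'.snd - pt s.fst.fst s.snd))
        + 1 / (2 * γ) * ‖b' - b‖ ^ 2 := by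
    have e1 : inner ℝ (P.gG (pt s.fst.fst s.snd)) (pt s'.fst.fst s'.snd - pt s.fst.fst s.snd)
        = inner ℝ (P.gG (pt s.fst.fst s.snd)).fst (s' - s).fst.fst
          + inner ℝ (P.gG (pt s.fst.fst s.snd)).snd (s' - s).snd := by
      rw [inner_pt]; rfl
    have e2 : inner ℝ (st (P.gPz γ s.fst s.snd) (P.gPθ γ s.fst s.snd)) (s' - s)
        = inner ℝ (P.gG (pt s.fst.fst s.snd)).fst (s' - s).fst.fst
          + inner ℝ (P.gG (pt s.fst.fst s.snd)).snd (s' - s).snd + 1 / γ * inner ℝ b (b' - b) := by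
      rw [inner_st, inner_pt, h3]
      simp only [st_fst, st_snd, gPz, gPθ, pt_fst, pt_snd, inner_add_left, real_inner_smul_left]
      rw [inner_sub_right, ← neg_sub s.snd, ← hb, inner_neg_left]
      ring
    rw [e1, e2]
    simp only [proxObj]
    rw [← hb, ← hb', h2]
    field_simp
    ring
  rw [h6]
  refine (abs_add_le _ _).trans ?_
  rw [add_mul, abs_of_nonneg (by positivity : 0 ≤ 1 / (2 * γ) * ‖b' - b‖ ^ 2)]
  refine add_le_add (h1.trans (by gcongr)) ?_
  calc 1 / (2 * γ) * ‖b' - b‖ ^ 2 ≤ 1 / (2 * γ) * (2 * ‖s' - s‖ ^ 2) := by gcongr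
    _ = _ := by field_simp

theorem hasQuadGrad_proxObj_right (z : Pt dx dy) :
    HasQuadGrad (P.proxObj γ z) (P.gPθ γ z) (L₂ + 1 / γ) := fun θ θ' => by
  have := hasQuadGrad_proxObj hn hS hL₂ hγ (st z θ) (st z θ')
  have e : st z θ' - st z θ = st 0 (θ' - θ) := st_ext (by simp) (by simp)
  rw [e, inner_st, norm_sq_st] at this
  simpa using this

/-- The proximal part expands exactly and `G` loses at most L₂‖θ' - θ‖². For γ < 1/(2L₂) the modulus
is positive, which gives coercivity and quadratic growth without convexity of `G`. -/
theorem proxObj_ge (z : Pt dx dy) (θ θ' : Vec dy) :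
    P.proxObj γ z θ + inner ℝ (P.gPθ γ z θ) (θ' - θ) + (1 / (2 * γ) - L₂) * ‖θ' - θ‖ ^ 2
      ≤ P.proxObj γ z θ' := by
  have h1 := (hasQuadGrad_G hn hS hL₂).ge (pt z.fst θ) (pt z.fst θ')
  have e : pt z.fst θ' - pt z.fst θ = pt 0 (θ' - θ) := pt_ext (by simp) (by simp)
  rw [e, inner_pt, norm_sq_pt] at h1
  simp only [pt_fst, pt_snd, inner_zero_right, norm_zero, zero_add, ne_eq, OfNat.ofNat_ne_zero,
    not_false_eq_true, zero_pow] at h1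
  have h2 : ‖θ' - z.snd‖ ^ 2 = ‖θ - z.snd‖ ^ 2 + 2 * inner ℝ (θ - z.snd) (θ' - θ)
      + ‖θ' - θ‖ ^ 2 := by
    rw [← norm_add_sq_real]; congr 2; abel
  have h3 : inner ℝ (P.gPθ γ z θ) (θ' - θ)
      = inner ℝ (P.gG (pt z.fst θ)).snd (θ' - θ) + 1 / γ * inner ℝ (θ - z.snd) (θ' - θ) := by
    rw [gPθ, inner_add_left, real_inner_smul_left]
  simp only [proxObj]
  rw [h3, h2]
  have h4 : 1 / (2 * γ) * (2 * inner ℝ (θ - z.snd) (θ' - θ))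
      = 1 / γ * inner ℝ (θ - z.snd) (θ' - θ) := by field_simp
  linarith

variable (hγL : γ < 1 / (2 * L₂))
include hγL

theorem prox_modulus_pos : 0 < 1 / (2 * γ) - L₂ := by
  rw [lt_div_iff₀ (by positivity)] at hγL
  rw [sub_pos, lt_div_iff₀ (by positivity)]
  linarith

theorem exists_minimizer (z : Pt dx dy) : ∃ θ, ∀ θ', P.proxObj γ z θ ≤ P.proxObj γ z θ' := by
  have hm := prox_modulus_pos hn hS hL₂ hγ hγL
  set m := 1 / (2 * γ) - L₂
  have hcont : Continuous (P.proxObj γ z) := continuous_iff_continuousAt.2 fun θ =>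
    ((hasQuadGrad_proxObj_right hn hS hL₂ hγ z).hasGradientAt θ).differentiableAt.continuousAt
  refine hcont.exists_forall_le' z.snd ?_
  filter_upwards [(isCompact_closedBall z.snd
    (‖P.gPθ γ z z.snd‖ / m)).compl_mem_cocompact] with θ hθ
  rw [Set.mem_compl_iff, Metric.mem_closedBall, dist_eq_norm, not_le, div_lt_iff₀ hm] at hθ
  have h1 := proxObj_ge hn hS hL₂ hγ z z.snd θ
  have h2 := neg_le_of_abs_le (abs_real_inner_le_norm (P.gPθ γ z z.snd) (θ - z.snd))
  nlinarith [norm_nonneg (θ - z.snd)]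

theorem thetaStar_le (z : Pt dx dy) (θ : Vec dy) :
    P.proxObj γ z (P.thetaStar γ z) ≤ P.proxObj γ z θ :=
  Classical.epsilon_spec (exists_minimizer hn hS hL₂ hγ hγL z) θ

theorem V_eq (z : Pt dx dy) : P.V γ z = P.proxObj γ z (P.thetaStar γ z) :=
  le_antisymm (ciInf_le ⟨_, Set.forall_mem_range.2 (thetaStar_le hn hS hL₂ hγ hγL z)⟩ _)
    (le_ciInf (thetaStar_le hn hS hL₂ hγ hγL z))

theorem gPθ_thetaStar (z : Pt dx dy) : P.gPθ γ z (P.thetaStar γ z) = 0 :=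
  (hasQuadGrad_proxObj_right hn hS hL₂ hγ z).grad_eq_zero (thetaStar_le hn hS hL₂ hγ hγL z)

theorem proxObj_sub_V_le (z : Pt dx dy) (θ : Vec dy) :
    P.proxObj γ z θ - P.V γ z ≤ (L₂ + 1 / γ) * ‖θ - P.thetaStar γ z‖ ^ 2 := by
  have := (hasQuadGrad_proxObj_right hn hS hL₂ hγ z).le (P.thetaStar γ z) θ
  rw [gPθ_thetaStar hn hS hL₂ hγ hγL, inner_zero_left] at this
  rw [V_eq hn hS hL₂ hγ hγL]
  linarith

/-- `G z` is the value of `proxObj` at θ = y, so quadratic growth at the minimizer applies. It gives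
both G ≥ V_γ and, for the initial data, control of y - θ*. -/
theorem le_G_sub_V (z : Pt dx dy) :
    (1 / (2 * γ) - L₂) * ‖z.snd - P.thetaStar γ z‖ ^ 2 ≤ P.G z - P.V γ z := by
  have := proxObj_ge hn hS hL₂ hγ z (P.thetaStar γ z) z.snd
  rw [gPθ_thetaStar hn hS hL₂ hγ hγL, inner_zero_left] at this
  rw [V_eq hn hS hL₂ hγ hγL]
  have e : P.proxObj γ z z.snd = P.G z := by
    simp only [proxObj, sub_self, norm_zero, ne_eq, OfNat.ofNat_ne_zero, not_false_eq_true,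
      zero_pow, mul_zero, add_zero]
    rfl
  linarith

theorem V_le (z : Pt dx dy) (θ : Vec dy) : P.V γ z ≤ P.proxObj γ z θ := by
  rw [V_eq hn hS hL₂ hγ hγL]; exact thetaStar_le hn hS hL₂ hγ hγL z θ

/-- Subtract the optimality condition at θ* and use the Lipschitz bound on ∇G: the modulus is the η
of the condition on `cl`. -/
theorem norm_gPθ_ge (z : Pt dx dy) (θ : Vec dy) :
    (1 / γ - L₂) * ‖θ - P.thetaStar γ z‖ ≤ ‖P.gPθ γ z θ‖ := by
  set e := θ - P.thetaStar γ z with he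
  have h1 : P.gPθ γ z θ = ((P.gG (pt z.fst θ)).snd - (P.gG (pt z.fst (P.thetaStar γ z))).snd)
      + (1 / γ) • e := by
    rw [← sub_zero (P.gPθ γ z θ), ← gPθ_thetaStar hn hS hL₂ hγ hγL z, gPθ, gPθ, he]
    module
  have h2 : ‖(P.gG (pt z.fst θ)).snd - (P.gG (pt z.fst (P.thetaStar γ z))).snd‖ ≤ L₂ * ‖e‖ := by
    refine (WithLp.norm_snd_le _ (P.gG (pt z.fst θ) - P.gG (pt z.fst (P.thetaStar γ z)))).trans ?_
    refine (gG_lipschitz hn hS _ _).trans (le_of_eq ?_)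
    congr 1
    have : pt z.fst θ - pt z.fst (P.thetaStar γ z) = pt 0 e := pt_ext (by simp) (by simp [he])
    rw [this, pt, WithLp.norm_toLp_snd]
  have h3 : ‖(1 / γ) • e‖ = 1 / γ * ‖e‖ := by
    rw [norm_smul, Real.norm_of_nonneg (by positivity)]
  have h4 : ‖(1 / γ) • e‖ ≤ ‖P.gPθ γ z θ‖
      + ‖(P.gG (pt z.fst θ)).snd - (P.gG (pt z.fst (P.thetaStar γ z))).snd‖ := by
    have : (1 / γ) • e = P.gPθ γ z θ
        - ((P.gG (pt z.fst θ)).snd - (P.gG (pt z.fst (P.thetaStar γ z))).snd) := by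
      rw [h1]; abel
    rw [this]; exact norm_sub_le _ _
  linarith

theorem norm_gPz_sub_gV_sq_le (z : Pt dx dy) (θ : Vec dy) :
    ‖P.gPz γ z θ - P.gV γ z‖ ^ 2 ≤ (L₂ ^ 2 + 1 / γ ^ 2) * ‖θ - P.thetaStar γ z‖ ^ 2 := by
  set e := θ - P.thetaStar γ z with he
  have h2 : ‖(P.gG (pt z.fst θ)).fst - (P.gG (pt z.fst (P.thetaStar γ z))).fst‖ ≤ L₂ * ‖e‖ := by
    refine (WithLp.norm_fst_le _ (P.gG (pt z.fst θ) - P.gG (pt z.fst (P.thetaStar γ z)))).trans ?_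
    refine (gG_lipschitz hn hS _ _).trans (le_of_eq ?_)
    congr 1
    have : pt z.fst θ - pt z.fst (P.thetaStar γ z) = pt 0 e := pt_ext (by simp) (by simp [he])
    rw [this, pt, WithLp.norm_toLp_snd]
  have h3 : (1 / γ) • (z.snd - θ) - (1 / γ) • (z.snd - P.thetaStar γ z) = -((1 / γ) • e) := by
    rw [he]; module
  rw [norm_sq_pt]
  simp only [gV, gPz, WithLp.sub_fst, WithLp.sub_snd, pt_fst, pt_snd]
  rw [h3, norm_neg, norm_smul, Real.norm_of_nonneg (by positivity : 0 ≤ 1 / γ), add_mul]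
  refine add_le_add ?_ (le_of_eq (by ring))
  rw [← mul_pow]
  gcongr

variable (hθ : ∀ z z', ‖P.thetaStar γ z - P.thetaStar γ z'‖ ≤ Lθ * ‖z - z'‖)
include hθ

/-- Envelope theorem with explicit error. From above, test the minimum at z' with θ*(z). From below,
expand `proxObj` at (z, θ*(z)), where its θ-gradient vanishes, and bound the shift of the minimizer
by `Lθ`. -/
theorem hasQuadGrad_V : HasQuadGrad (P.V γ) (P.gV γ) ((L₂ + 1 / γ) * (1 + Lθ ^ 2)) := by
  intro z z'
  have hM : 0 < L₂ + 1 / γ := by positivity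
  have hQ := hasQuadGrad_proxObj hn hS hL₂ hγ
  have up : P.V γ z' ≤ P.V γ z + inner ℝ (P.gV γ z) (z' - z) + (L₂ + 1 / γ) * ‖z' - z‖ ^ 2 := by
    have h1 := hQ.le (st z (P.thetaStar γ z)) (st z' (P.thetaStar γ z))
    have e : st z' (P.thetaStar γ z) - st z (P.thetaStar γ z) = st (z' - z) 0 :=
      st_ext (by simp) (by simp)
    rw [e, inner_st, norm_sq_st] at h1
    simp only [st_fst, st_snd, inner_zero_right, norm_zero, add_zero, ne_eq, OfNat.ofNat_ne_zero,
      not_false_eq_true, zero_pow] at h1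
    rw [V_eq hn hS hL₂ hγ hγL z]
    exact (V_le hn hS hL₂ hγ hγL z' (P.thetaStar γ z)).trans h1
  have lo : P.V γ z + inner ℝ (P.gV γ z) (z' - z)
      - (L₂ + 1 / γ) * (‖z' - z‖ ^ 2 + ‖P.thetaStar γ z' - P.thetaStar γ z‖ ^ 2) ≤ P.V γ z' := by
    have h1 := hQ.ge (st z (P.thetaStar γ z)) (st z' (P.thetaStar γ z'))
    have e : st z' (P.thetaStar γ z') - st z (P.thetaStar γ z)
        = st (z' - z) (P.thetaStar γ z' - P.thetaStar γ z) := st_ext (by simp) (by simp)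
    rw [e, inner_st, norm_sq_st] at h1
    simp only [st_fst, st_snd] at h1
    rw [gPθ_thetaStar hn hS hL₂ hγ hγL, inner_zero_left, add_zero] at h1
    rw [V_eq hn hS hL₂ hγ hγL z, V_eq hn hS hL₂ hγ hγL z']
    exact h1
  have hl : ‖P.thetaStar γ z' - P.thetaStar γ z‖ ^ 2 ≤ Lθ ^ 2 * ‖z' - z‖ ^ 2 := by
    rw [← mul_pow]; exact pow_le_pow_left₀ (norm_nonneg _) (hθ _ _) 2
  have hl' := mul_le_mul_of_nonneg_left hl hM.le
  have : 0 ≤ (L₂ + 1 / γ) * (Lθ ^ 2 * ‖z' - z‖ ^ 2) := by positivity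
  rw [abs_le]
  constructor <;> linarith

include hL₁ in
theorem hasQuadGrad_Psi (μ : ℝ) : HasQuadGrad (P.Psi γ μ) (P.gPsi γ μ)
    (|μ| * L₁ + L₂ + |-1| * ((L₂ + 1 / γ) * (1 + Lθ ^ 2))) := by
  have := (((hasQuadGrad_F hn hS hL₁).const_mul μ).add (hasQuadGrad_G hn hS hL₂)).add
    ((hasQuadGrad_V hn hS hL₂ hγ hγL hθ).const_mul (-1))
  simp only [neg_one_mul, neg_one_smul, ← sub_eq_add_neg] at this
  exact this

end

end Problem

/-! ### The Lyapunov function of the averaged dynamics -/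

/-- With S = √(L₂² + γ⁻²) and η = 1/γ - L₂, the hypothesis reads cl S ≤ η/(16 Lθ). It remains to see
S ≤ 4 Lθ η, which follows from S ≤ (8/3) η, due to γ < 1/(2L₂), and Lθ ≥ 2/3. -/
theorem mul_sq_add_sq_le_of_le_a₁ {L₂ γ Lθ cl : ℝ} (hL₂ : 0 < L₂) (hγ : 0 < γ)
    (hγL : γ < 1 / (2 * L₂)) (hLθ : 2 / 3 ≤ Lθ)
    (hcl' : cl ≤ (1 / γ - L₂) / (32 * a₁ L₂ γ Lθ * Lθ ^ 2)) :
    cl * (L₂ ^ 2 + 1 / γ ^ 2) ≤ (1 / γ - L₂) ^ 2 / 4 := by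
  have hLθ0 : 0 < Lθ := by linarith
  have h1 : 2 * L₂ < 1 / γ := by
    rw [lt_div_iff₀ (by positivity)] at hγL ⊢
    linarith
  have e : 1 / γ ^ 2 = (1 / γ) ^ 2 := by rw [one_div, one_div, inv_pow]
  have hS0 : 0 < √(L₂ ^ 2 + 1 / γ ^ 2) := by positivity
  have hS2 : √(L₂ ^ 2 + 1 / γ ^ 2) ^ 2 = L₂ ^ 2 + 1 / γ ^ 2 := Real.sq_sqrt (by positivity)
  rw [a₁] at hcl'
  rw [← hS2]
  rw [e] at hS0 hS2 hcl' ⊢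
  set S := √(L₂ ^ 2 + (1 / γ) ^ 2)
  set g := 1 / γ
  have h2 : S ≤ 4 * Lθ * (g - L₂) := by
    have h3 : S ≤ 8 / 3 * (g - L₂) := by
      refine le_of_sq_le_sq ?_ (by linarith)
      rw [hS2]; nlinarith
    nlinarith
  have h4 : cl * S ≤ (g - L₂) / (16 * Lθ) := by
    have e2 : 32 * (1 / (2 * Lθ) * S) * Lθ ^ 2 = 16 * Lθ * S := by field_simp; ring
    rw [e2, le_div_iff₀ (by positivity)] at hcl'
    rw [le_div_iff₀ (by positivity)]
    linarith
  have h5 : 0 < g - L₂ := by linarith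
  calc cl * S ^ 2 = cl * S * S := by ring
    _ ≤ (g - L₂) / (16 * Lθ) * S := by gcongr
    _ ≤ (g - L₂) / (16 * Lθ) * (4 * Lθ * (g - L₂)) := by gcongr
    _ = _ := by field_simp; ring

namespace Problem

variable {n dx dy : ℕ} {Sf Sg : Type*} (P : Problem n dx dy Sf Sg)

/-- The upper-level part of the local directions. -/
def dirA (i : Fin n) (s : St dx dy) : St dx dy := st (∇ (P.f i) s.fst) 0

/-- The lower-level part of the local directions. -/
def dirB (γ : ℝ) (i : Fin n) (s : St dx dy) : St dx dy :=
  st (∇ (P.g i) s.fst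
      - pt (∇ (P.g i) (pt s.fst.fst s.snd)).fst ((1 / γ) • (s.fst.snd - s.snd)))
    ((∇ (P.g i) (pt s.fst.fst s.snd)).snd + (1 / γ) • (s.snd - s.fst.snd))

/-- The Lyapunov function `Ψ_μ - μ Flow + (proxObj - V)`. -/
def lyap (γ Flow μ : ℝ) (s : St dx dy) : ℝ :=
  μ * (P.F s.fst - Flow) + P.G s.fst + P.proxObj γ s.fst s.snd + -2 * P.V γ s.fst

/-- The gradient of `lyap`. -/
def gLyap (γ μ : ℝ) (s : St dx dy) : St dx dy :=
  st (P.gPsi γ μ s.fst + (P.gPz γ s.fst s.snd - P.gV γ s.fst)) (P.gPθ γ s.fst s.snd)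

/-- The dissipation of `lyap`. -/
def dissip (γ μ : ℝ) (s : St dx dy) : ℝ :=
  ‖P.gPsi γ μ s.fst‖ ^ 2 + ‖P.gPθ γ s.fst s.snd‖ ^ 2

end Problem

/-- The ratio of the learning rates as a linear map. -/
def precond (dx dy : ℕ) (cl : ℝ) : St dx dy →ₗ[ℝ] St dx dy where
  toFun s := st (cl • s.fst) s.snd
  map_add' s t := st_ext (by simp) (by simp)
  map_smul' c s := st_ext (by simp [smul_comm cl c]) (by simp)

theorem norm_precond_sq_le {dx dy : ℕ} (cl : ℝ) (s : St dx dy) :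
    ‖precond dx dy cl s‖ ^ 2 ≤ (cl ^ 2 + 1) * ‖s‖ ^ 2 := by
  rw [norm_sq_st, norm_sq_st s]
  simp only [precond, LinearMap.coe_mk, AddHom.coe_mk, st_fst, st_snd, norm_smul, mul_pow,
    Real.norm_eq_abs, sq_abs]
  nlinarith [sq_nonneg ‖s.fst‖, mul_nonneg (sq_nonneg cl) (sq_nonneg ‖s.snd‖)]

theorem mean_fst {n dx dy : ℕ} (v : Fin n → St dx dy) : (mean v).fst = mean fun i => (v i).fst :=
  (mean_map (WithLp.fstₗ 2 ℝ (Pt dx dy) (Vec dy)) v).symm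

theorem mean_snd {n dx dy : ℕ} (v : Fin n → St dx dy) : (mean v).snd = mean fun i => (v i).snd :=
  (mean_map (WithLp.sndₗ 2 ℝ (Pt dx dy) (Vec dy)) v).symm

theorem mean_pt_fst {n dx dy : ℕ} (v : Fin n → Pt dx dy) :
    (mean v).fst = mean fun i => (v i).fst :=
  (mean_map (WithLp.fstₗ 2 ℝ (Vec dx) (Vec dy)) v).symm

theorem mean_pt_snd {n dx dy : ℕ} (v : Fin n → Pt dx dy) :
    (mean v).snd = mean fun i => (v i).snd :=
  (mean_map (WithLp.sndₗ 2 ℝ (Vec dx) (Vec dy)) v).symm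

namespace Problem

variable {n dx dy : ℕ} {Sf Sg : Type*} {P : Problem n dx dy Sf Sg} {L₁ L₂ γ Lθ : ℝ}

/-- The averaged direction is ∇Ψ_μ with the envelope gradient taken at θ instead of θ*, so the error
`gPz - gV` enters with the sign opposite to that in `gLyap`. -/
theorem mean_dir (hn : 0 < n) (μ : ℝ) (s : St dx dy) :
    (mean fun i => μ • P.dirA i s + P.dirB γ i s)
      = st (P.gPsi γ μ s.fst - (P.gPz γ s.fst s.snd - P.gV γ s.fst)) (P.gPθ γ s.fst s.snd) := by
  have h1 : mean (fun i => μ • ∇ (P.f i) s.fst) = μ • P.gF s.fst := mean_smul μ _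
  refine st_ext ?_ ?_
  · rw [mean_fst]
    have e : (fun i => (μ • P.dirA i s + P.dirB γ i s).fst)
        = (fun i => μ • ∇ (P.f i) s.fst) + (fun i => ∇ (P.g i) s.fst)
          - fun i => pt (∇ (P.g i) (pt s.fst.fst s.snd)).fst ((1 / γ) • (s.fst.snd - s.snd)) := by
      ext1 i
      simp only [dirA, dirB, WithLp.add_fst, WithLp.smul_fst, st_fst, Pi.add_apply, Pi.sub_apply]
      abel
    have h2 : (mean fun i => pt (∇ (P.g i) (pt s.fst.fst s.snd)).fst
        ((1 / γ) • (s.fst.snd - s.snd))) = P.gPz γ s.fst s.snd := by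
      refine pt_ext ?_ ?_
      · rw [mean_pt_fst, gPz, gG, pt_fst, mean_pt_fst]; rfl
      · rw [mean_pt_snd]; exact mean_const hn _
    rw [e, mean_sub, mean_add, h1, h2, st_fst, gPsi, gG]
    abel
  · rw [mean_snd]
    have e : (fun i => (μ • P.dirA i s + P.dirB γ i s).snd)
        = (fun i => (∇ (P.g i) (pt s.fst.fst s.snd)).snd)
          + fun _ => (1 / γ) • (s.snd - s.fst.snd) := by
      ext1 i
      simp only [dirA, dirB, WithLp.add_snd, WithLp.smul_snd, st_snd, Pi.add_apply, smul_zero,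
        zero_add]
    rw [e, mean_add, mean_const hn, st_snd, gPθ, gG, mean_pt_snd]

theorem norm_dirA_sub_le (hS : Smooth P L₁ L₂) (hL₁ : 0 < L₁) (i : Fin n) (s t : St dx dy) :
    ‖P.dirA i s - P.dirA i t‖ ≤ L₁ * ‖s - t‖ := by
  refine (norm_st_le _).trans ?_
  simp only [dirA, WithLp.sub_fst, WithLp.sub_snd, st_fst, st_snd, sub_self, norm_zero, add_zero]
  refine (hS.smooth_f i _ _).trans ?_
  gcongr
  exact WithLp.norm_fst_le _ (s - t)

theorem norm_dirB_sub_le (hS : Smooth P L₁ L₂) (hL₂ : 0 < L₂) (hγ : 0 < γ) (i : Fin n)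
    (s t : St dx dy) : ‖P.dirB γ i s - P.dirB γ i t‖ ≤ (3 * L₂ + 4 / γ) * ‖s - t‖ := by
  have hf : ‖s.fst - t.fst‖ ≤ ‖s - t‖ := WithLp.norm_fst_le _ (s - t)
  have hs : ‖s.snd - t.snd‖ ≤ ‖s - t‖ := WithLp.norm_snd_le _ (s - t)
  have hff : ‖s.fst.snd - t.fst.snd‖ ≤ ‖s - t‖ :=
    (WithLp.norm_snd_le _ (s.fst - t.fst)).trans hf
  have hp : ‖pt s.fst.fst s.snd - pt t.fst.fst t.snd‖ ≤ ‖s - t‖ := by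
    refine le_of_sq_le_sq ?_ (norm_nonneg _)
    rw [norm_sq_pt, norm_sq_st, norm_sq_pt]
    simp only [WithLp.sub_fst, WithLp.sub_snd, pt_fst, pt_snd]
    nlinarith [sq_nonneg ‖s.fst.snd - t.fst.snd‖]
  have g1 := (hS.smooth_g i s.fst t.fst).trans (mul_le_mul_of_nonneg_left hf hL₂.le)
  have g2 := (hS.smooth_g i (pt s.fst.fst s.snd) (pt t.fst.fst t.snd)).trans
    (mul_le_mul_of_nonneg_left hp hL₂.le)
  have g3 := (WithLp.norm_fst_le _ (∇ (P.g i) (pt s.fst.fst s.snd)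
    - ∇ (P.g i) (pt t.fst.fst t.snd))).trans g2
  have g4 := (WithLp.norm_snd_le _ (∇ (P.g i) (pt s.fst.fst s.snd)
    - ∇ (P.g i) (pt t.fst.fst t.snd))).trans g2
  simp only [WithLp.sub_fst, WithLp.sub_snd] at g3 g4
  have g5 : ‖(1 / γ) • ((s.snd - t.snd) - (s.fst.snd - t.fst.snd))‖ ≤ 2 / γ * ‖s - t‖ := by
    rw [norm_smul, Real.norm_of_nonneg (by positivity)]
    have : ‖(s.snd - t.snd) - (s.fst.snd - t.fst.snd)‖ ≤ 2 * ‖s - t‖ :=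
      (norm_sub_le _ _).trans (by linarith)
    calc _ ≤ 1 / γ * (2 * ‖s - t‖) := by gcongr
      _ = _ := by ring
  refine (norm_st_le _).trans ?_
  set d := (1 / γ) • ((s.snd - t.snd) - (s.fst.snd - t.fst.snd)) with hd
  have e1 : (P.dirB γ i s - P.dirB γ i t).fst = (∇ (P.g i) s.fst - ∇ (P.g i) t.fst)
      - pt ((∇ (P.g i) (pt s.fst.fst s.snd)).fst - (∇ (P.g i) (pt t.fst.fst t.snd)).fst) (-d) := by
    simp only [dirB, WithLp.sub_fst, st_fst]
    refine pt_ext ?_ ?_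
    · simp only [WithLp.sub_fst, pt_fst]; abel
    · simp only [WithLp.sub_snd, pt_snd, hd]; module
  have e2 : (P.dirB γ i s - P.dirB γ i t).snd = ((∇ (P.g i) (pt s.fst.fst s.snd)).snd
      - (∇ (P.g i) (pt t.fst.fst t.snd)).snd) + d := by
    simp only [dirB, WithLp.sub_snd, st_snd, hd]; module
  rw [e1, e2]
  have n1 := norm_sub_le (∇ (P.g i) s.fst - ∇ (P.g i) t.fst)
    (pt ((∇ (P.g i) (pt s.fst.fst s.snd)).fst - (∇ (P.g i) (pt t.fst.fst t.snd)).fst) (-d))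
  have n2 := norm_pt_le
    (pt ((∇ (P.g i) (pt s.fst.fst s.snd)).fst - (∇ (P.g i) (pt t.fst.fst t.snd)).fst) (-d))
  rw [pt_fst, pt_snd, norm_neg] at n2
  have n3 := norm_add_le ((∇ (P.g i) (pt s.fst.fst s.snd)).snd
      - (∇ (P.g i) (pt t.fst.fst t.snd)).snd) d
  have e3 : (3 * L₂ + 4 / γ) * ‖s - t‖
      = 3 * (L₂ * ‖s - t‖) + 2 * (2 / γ * ‖s - t‖) := by ring
  rw [e3]
  linarith

section

variable (hn : 0 < n) (hS : Smooth P L₁ L₂) (hL₁ : 0 < L₁) (hL₂ : 0 < L₂) (hγ : 0 < γ)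
  (hγL : γ < 1 / (2 * L₂)) (hθ : ∀ z z', ‖P.thetaStar γ z - P.thetaStar γ z'‖ ≤ Lθ * ‖z - z'‖)
include hn hS hL₂ hγ hγL hθ

/-- Shift y by a unit vector e. The difference of the two optimality conditions is e = Δθ + γ Δ∇_yG,
hence 1 ≤ (1 + γL₂)‖Δθ‖ ≤ (3/2) Lθ. -/
theorem two_thirds_le_of_lipschitz (hdy : 0 < dy) : 2 / 3 ≤ Lθ := by
  set e : Vec dy := EuclideanSpace.single ⟨0, hdy⟩ 1 with he
  have hne : ‖e‖ = 1 := by simp [he]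
  set z : Pt dx dy := pt 0 0 with hz
  set z' : Pt dx dy := pt 0 e with hz'
  have h0 := gPθ_thetaStar hn hS hL₂ hγ hγL z
  have h1 := gPθ_thetaStar hn hS hL₂ hγ hγL z'
  have hl := hθ z' z
  set t := P.thetaStar γ z
  set t' := P.thetaStar γ z'
  have e1 : z' - z = pt 0 e := pt_ext (by simp [hz, hz']) (by simp [hz, hz'])
  have e2 : ‖z' - z‖ = 1 := by rw [e1, pt, WithLp.norm_toLp_snd, hne]
  rw [e2, mul_one] at hl
  have h2 : ‖P.gG (pt 0 t') - P.gG (pt 0 t)‖ ≤ L₂ * ‖t' - t‖ := by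
    refine (gG_lipschitz hn hS _ _).trans (le_of_eq ?_)
    congr 1
    have : pt 0 t' - pt 0 t = pt (0 : Vec dx) (t' - t) := pt_ext (by simp) (by simp)
    rw [this, pt, WithLp.norm_toLp_snd]
  have h3 : ‖(P.gG (pt 0 t')).snd - (P.gG (pt 0 t)).snd‖ ≤ L₂ * ‖t' - t‖ :=
    (WithLp.norm_snd_le _ (P.gG (pt 0 t') - P.gG (pt 0 t))).trans h2
  have h4 : e = (t' - t) + γ • ((P.gG (pt 0 t')).snd - (P.gG (pt 0 t)).snd) := by
    have k0 : γ • (P.gG (pt 0 t)).snd = -t := by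
      have : γ • P.gPθ γ z t = 0 := by rw [h0, smul_zero]
      simp only [gPθ, hz, pt_fst, pt_snd, smul_add, smul_smul, mul_one_div_cancel hγ.ne',
        one_smul, sub_zero] at this
      exact eq_neg_of_add_eq_zero_left this
    have k1 : γ • (P.gG (pt 0 t')).snd = e - t' := by
      have : γ • P.gPθ γ z' t' = 0 := by rw [h1, smul_zero]
      simp only [gPθ, hz', pt_fst, pt_snd, smul_add, smul_smul, mul_one_div_cancel hγ.ne',
        one_smul] at this
      rw [eq_neg_of_add_eq_zero_left this]; abel
    rw [smul_sub, k0, k1]; abel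
  have h5 : ‖e‖ ≤ ‖t' - t‖ + γ * (L₂ * ‖t' - t‖) := by
    conv_lhs => rw [h4]
    refine (norm_add_le _ _).trans ?_
    rw [norm_smul, Real.norm_of_nonneg hγ.le]
    gcongr
  rw [hne] at h5
  rw [lt_div_iff₀ (by positivity)] at hγL
  nlinarith [norm_nonneg (t' - t)]

theorem mul_norm_sq_le {cl : ℝ} (hcl : 0 < cl)
    (hcl' : cl ≤ (1 / γ - L₂) / (32 * a₁ L₂ γ Lθ * Lθ ^ 2)) (z : Pt dx dy) (θ : Vec dy) :
    cl * ‖P.gPz γ z θ - P.gV γ z‖ ^ 2 ≤ 1 / 4 * ‖P.gPθ γ z θ‖ ^ 2 := by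
  have h1 := mul_le_mul_of_nonneg_left (norm_gPz_sub_gV_sq_le hn hS hL₂ hγ hγL z θ) hcl.le
  refine h1.trans ?_
  -- If dy = 0 there is no unit vector to bound `Lθ` from below, but then θ = θ* and the left side
  -- vanishes.
  rcases Nat.eq_zero_or_pos dy with rfl | hdy
  · have : θ - P.thetaStar γ z = 0 := Subsingleton.elim _ _
    rw [this, norm_zero]
    simp only [ne_eq, OfNat.ofNat_ne_zero, not_false_eq_true, zero_pow, mul_zero]
    positivity
  have h2 := mul_sq_add_sq_le_of_le_a₁ hL₂ hγ hγL
    (two_thirds_le_of_lipschitz hn hS hL₂ hγ hγL hθ hdy) hcl'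
  have h3 := norm_gPθ_ge hn hS hL₂ hγ hγL z θ
  have h4 : 0 < 1 / γ - L₂ := by
    have := prox_modulus_pos hn hS hL₂ hγ hγL
    have e : 1 / (2 * γ) = 1 / γ / 2 := by field_simp
    rw [e] at this
    have : 0 < 1 / γ := by positivity
    linarith
  have h5 := pow_le_pow_left₀ (by positivity) h3 2
  have h6 := mul_le_mul_of_nonneg_right h2 (sq_nonneg ‖θ - P.thetaStar γ z‖)
  rw [mul_pow] at h5
  linarith

include hL₁

theorem hasQuadGrad_lyap (Flow μ : ℝ) : HasQuadGrad (P.lyap γ Flow μ) (P.gLyap γ μ)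
    (|μ| * L₁ + L₂ + (L₂ + 1 / γ) + |-2| * ((L₂ + 1 / γ) * (1 + Lθ ^ 2))) := by
  have hM : 0 < L₂ + 1 / γ := by positivity
  have h := (((((hasQuadGrad_F hn hS hL₁).sub_const Flow).const_mul μ).comp_fst
    (by positivity)).add ((hasQuadGrad_G hn hS hL₂).comp_fst hL₂.le)).add
    (hasQuadGrad_proxObj hn hS hL₂ hγ)
  have h' := h.add (((hasQuadGrad_V hn hS hL₂ hγ hγL hθ).const_mul (-2)).comp_fst
    (by positivity))
  have e : (fun s : St dx dy => st (μ • P.gF s.fst) 0 + st (P.gG s.fst) 0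
      + st (P.gPz γ s.fst s.snd) (P.gPθ γ s.fst s.snd) + st ((-2 : ℝ) • P.gV γ s.fst) 0)
      = P.gLyap γ μ := by
    ext1 s
    refine st_ext ?_ ?_
    · simp only [WithLp.add_fst, st_fst, gLyap, gPsi]; module
    · simp only [WithLp.add_snd, st_snd, gLyap, zero_add, add_zero]
  rw [← e]
  exact h'

theorem isLyapunov {cl Flow : ℝ} (hF : ∀ z, Flow ≤ P.F z) (hcl : 0 < cl)
    (hcl' : cl ≤ (1 / γ - L₂) / (32 * a₁ L₂ γ Lθ * Lθ ^ 2)) {μ : ℕ → ℝ} {μ₀ : ℝ}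
    (hμ : SlowDecay μ μ₀) :
    IsLyapunov μ P.dirA (P.dirB γ) (precond dx dy cl) (fun k => P.lyap γ Flow (μ k))
      (fun k => P.gLyap γ (μ k)) (fun k => P.dissip γ (μ k)) (min cl (3 / 4)) (2 + 1 / (2 * cl))
      (μ₀ * L₁ + L₂ + (L₂ + 1 / γ) + 2 * ((L₂ + 1 / γ) * (1 + Lθ ^ 2))) := by
  have hw : ∀ s : St dx dy, 2 * ‖P.gPz γ s.fst s.snd - P.gV γ s.fst‖ ^ 2
      ≤ 1 / (2 * cl) * ‖P.gPθ γ s.fst s.snd‖ ^ 2 := by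
    intro s
    have h := mul_norm_sq_le hn hS hL₂ hγ hγL hθ hcl hcl' s.fst s.snd
    calc 2 * ‖P.gPz γ s.fst s.snd - P.gV γ s.fst‖ ^ 2
        = 2 / cl * (cl * ‖P.gPz γ s.fst s.snd - P.gV γ s.fst‖ ^ 2) := by field_simp
      _ ≤ 2 / cl * (1 / 4 * ‖P.gPθ γ s.fst s.snd‖ ^ 2) := by gcongr
      _ = _ := by field_simp; ring
  have hq : ∀ (k : ℕ) (s : St dx dy) (v : Pt dx dy),
      ‖v‖ ^ 2 ≤ 2 * ‖P.gPsi γ (μ k) s.fst‖ ^ 2 + 2 * ‖P.gPz γ s.fst s.snd - P.gV γ s.fst‖ ^ 2 →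
      ‖st v (P.gPθ γ s.fst s.snd)‖ ^ 2 ≤ (2 + 1 / (2 * cl)) * P.dissip γ (μ k) s := by
    intro k s v h
    rw [norm_sq_st, st_fst, st_snd, dissip]
    have h1 := hw s
    have h2 : 0 ≤ 1 / (2 * cl) * ‖P.gPsi γ (μ k) s.fst‖ ^ 2 := by positivity
    linarith [sq_nonneg ‖P.gPθ γ s.fst s.snd‖]
  have hpar : ∀ u w : Pt dx dy, ‖u + w‖ ^ 2 ≤ 2 * ‖u‖ ^ 2 + 2 * ‖w‖ ^ 2 ∧
      ‖u - w‖ ^ 2 ≤ 2 * ‖u‖ ^ 2 + 2 * ‖w‖ ^ 2 := by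
    intro u w
    have := parallelogram_law_with_norm ℝ u w
    constructor <;> nlinarith [mul_self_nonneg ‖u + w‖, mul_self_nonneg ‖u - w‖]
  have hdiff : ∀ u w : Pt dx dy, inner ℝ (u + w) (u - w) = ‖u‖ ^ 2 - ‖w‖ ^ 2 := by
    intro u w
    rw [inner_add_left, inner_sub_right, inner_sub_right, real_inner_self_eq_norm_sq,
      real_inner_self_eq_norm_sq, real_inner_comm]; ring
  refine ⟨fun k s => ?_, fun k s => ?_, fun k s t => ?_, fun k s => ?_, fun k s => ?_,
    fun k s => ?_⟩
  · have h1 := le_G_sub_V hn hS hL₂ hγ hγL s.fst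
    have h2 := V_le hn hS hL₂ hγ hγL s.fst s.snd
    have h3 := mul_nonneg (hμ.nonneg k) (sub_nonneg.2 (hF s.fst))
    have h4 := mul_nonneg (prox_modulus_pos hn hS hL₂ hγ hγL).le
      (sq_nonneg ‖s.fst.snd - P.thetaStar γ s.fst‖)
    simp only [lyap]
    linarith
  · have := mul_le_mul_of_nonneg_right (hμ.anti k) (sub_nonneg.2 (hF s.fst))
    simp only [lyap]
    linarith
  · have h := (hasQuadGrad_lyap hn hS hL₁ hL₂ hγ hγL hθ Flow (μ k)).le s t
    refine h.trans ?_
    rw [abs_of_nonneg (hμ.nonneg k), abs_neg, abs_two]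
    gcongr
    exact hμ.le k
  · rw [mean_dir hn, inner_st]
    simp only [precond, LinearMap.coe_mk, AddHom.coe_mk, st_fst, st_snd, gLyap, dissip]
    set u := P.gPsi γ (μ k) s.fst
    set w := P.gPz γ s.fst s.snd - P.gV γ s.fst with hw_def
    set q := P.gPθ γ s.fst s.snd
    -- The opposite signs of `w` give a difference of squares without cross terms; `cl * ‖w‖ ^ 2`
    -- costs a quarter of `‖q‖ ^ 2`, whence the 3/4 in the constant.
    rw [real_inner_smul_right, hdiff, real_inner_self_eq_norm_sq]
    have h := mul_norm_sq_le hn hS hL₂ hγ hγL hθ hcl hcl' s.fst s.snd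
    rw [← hw_def] at h
    have m1 := mul_le_mul_of_nonneg_right (min_le_left cl (3 / 4)) (sq_nonneg ‖u‖)
    have m2 := mul_le_mul_of_nonneg_right (min_le_right cl (3 / 4)) (sq_nonneg ‖q‖)
    rw [mul_add, mul_sub]
    linarith
  · rw [mean_dir hn]
    exact hq k s _ (hpar _ _).2
  · exact hq k s _ (hpar _ _).1

end

end Problem

/-! ### Square-integrable random vectors and independent noise -/

theorem continuous_of_norm_sub_le {V V' : Type*} [SeminormedAddCommGroup V]
    [SeminormedAddCommGroup V'] {f : V → V'} {L : ℝ} (hf : ∀ u v, ‖f u - f v‖ ≤ L * ‖u - v‖) :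
    Continuous f :=
  (LipschitzWith.of_dist_le_mul (K := Real.toNNReal L) fun u v => by
    rw [dist_eq_norm, dist_eq_norm]
    exact (hf u v).trans
      (mul_le_mul_of_nonneg_right (Real.le_coe_toNNReal L) (norm_nonneg _))).continuous

section Noise

variable {Ω E T V : Type*} {m : MeasurableSpace Ω} [mΩ : MeasurableSpace Ω]
  {Pr : Measure Ω} [IsProbabilityMeasure Pr]
  [MeasurableSpace E] [MeasurableSpace T] [NormedAddCommGroup V] [InnerProductSpace ℝ V]
  [FiniteDimensional ℝ V] [MeasurableSpace V] [BorelSpace V]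

theorem integral_norm_sq_le_of_lintegral_le {h : Ω → V} (hm : AEStronglyMeasurable h Pr) {c : ℝ}
    (hc : 0 ≤ c) (hle : ∫⁻ ω, ‖h ω‖ₑ ^ 2 ∂Pr ≤ ENNReal.ofReal c) :
    MemLp h 2 Pr ∧ ∫ ω, ‖h ω‖ ^ 2 ∂Pr ≤ c := by
  have e : ∀ ω, ENNReal.ofReal (‖h ω‖ ^ 2) = ‖h ω‖ₑ ^ 2 := fun ω => by
    rw [ENNReal.ofReal_pow (norm_nonneg _), ofReal_norm]
  have hm2 : AEStronglyMeasurable (fun ω => ‖h ω‖ ^ 2) Pr := hm.norm.pow 2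
  constructor
  · rw [memLp_two_iff_integrable_sq_norm hm]
    refine ⟨hm2, ?_⟩
    rw [hasFiniteIntegral_iff_ofReal (Filter.Eventually.of_forall fun ω => sq_nonneg _)]
    simp_rw [e]
    exact hle.trans_lt ENNReal.ofReal_lt_top
  · rw [integral_eq_lintegral_of_nonneg_ae (Filter.Eventually.of_forall fun ω => sq_nonneg _) hm2]
    simp_rw [e]
    exact ENNReal.toReal_le_of_le_ofReal hc hle

theorem lintegral_enorm_sq_eq {h : Ω → V} (hh : MemLp h 2 Pr) :
    ∫⁻ ω, ‖h ω‖ₑ ^ 2 ∂Pr = ENNReal.ofReal (∫ ω, ‖h ω‖ ^ 2 ∂Pr) := by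
  rw [ofReal_integral_eq_lintegral_ofReal ((memLp_two_iff_integrable_sq_norm hh.1).1 hh)
    (Filter.Eventually.of_forall fun ω => sq_nonneg _)]
  refine lintegral_congr fun ω => ?_
  rw [ENNReal.ofReal_pow (norm_nonneg _), ofReal_norm]

theorem integrable_norm_sq {h : Ω → V} (hh : MemLp h 2 Pr) :
    Integrable (fun ω => ‖h ω‖ ^ 2) Pr := (memLp_two_iff_integrable_sq_norm hh.1).1 hh

theorem integrable_inner {u v : Ω → V} (hu : MemLp u 2 Pr) (hv : MemLp v 2 Pr) :
    Integrable (fun ω => inner ℝ (u ω) (v ω)) Pr := by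
  refine Integrable.mono' ((integrable_norm_sq hu).add (integrable_norm_sq hv))
    (hu.1.inner hv.1) (Filter.Eventually.of_forall fun ω => ?_)
  refine (norm_inner_le_norm (𝕜 := ℝ) (u ω) (v ω)).trans ?_
  simp only [Pi.add_apply]
  nlinarith [sq_nonneg (‖u ω‖ - ‖v ω‖), sq_nonneg ‖u ω‖, sq_nonneg ‖v ω‖]

theorem memLp_lipschitz_comp {V' : Type*} [NormedAddCommGroup V'] [InnerProductSpace ℝ V']
    {f : V → V'} {L : ℝ}
    (hf : ∀ u v, ‖f u - f v‖ ≤ L * ‖u - v‖) {s : Ω → V} (hs : MemLp s 2 Pr) :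
    MemLp (fun ω => f (s ω)) 2 Pr := by
  have hL : ∀ u v, ‖f u - f v‖ ≤ |L| * ‖u - v‖ := fun u v =>
    (hf u v).trans (mul_le_mul_of_nonneg_right (le_abs_self L) (norm_nonneg _))
  have hc : Continuous f := continuous_of_norm_sub_le hf
  have hg : MemLp (fun ω => ‖f 0‖ + |L| * ‖s ω‖) 2 Pr := by
    have h1 : MemLp (fun _ : Ω => ‖f 0‖) 2 Pr := memLp_const _
    have h2 : MemLp (fun ω => |L| * ‖s ω‖) 2 Pr := hs.norm.const_mul _
    exact h1.add h2
  have hb : ∀ ω, ‖f (s ω)‖ ≤ ‖‖f 0‖ + |L| * ‖s ω‖‖ := fun ω => by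
    rw [Real.norm_of_nonneg (by positivity)]
    have h1 := hL (s ω) 0
    rw [sub_zero] at h1
    have h2 := norm_sub_norm_le (f (s ω)) (f 0)
    linarith
  exact hg.mono (hc.comp_aestronglyMeasurable hs.1) (Filter.Eventually.of_forall hb)

variable {ξ : Ω → T} {z : Ω → E} {N : E → T → V} {σ2 : ℝ}

theorem map_prodMk_eq_prod {E' : Type*} [MeasurableSpace E'] {w : Ω → E'} (hm : m ≤ mΩ)
    (hξ : Measurable ξ) (hind : Indep m (MeasurableSpace.comap ξ inferInstance) Pr)
    (hw : Measurable[m] w) :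
    Pr.map (fun ω => (w ω, ξ ω)) = (Pr.map w).prod (Pr.map ξ) := by
  have h1 : IndepFun w ξ Pr :=
    (IndepFun_iff_Indep w ξ Pr).2 (indep_of_indep_of_le_left hind hw.comap_le)
  exact (indepFun_iff_map_prod_eq_prod_map_map (hw.mono hm le_rfl).aemeasurable
    hξ.aemeasurable).1 h1

/-- A noise with second moment at most `σ2` at every point has second moment at most `σ2` at an
independent random point. -/
theorem noise_memLp (hm : m ≤ mΩ) (hξ : Measurable ξ)
    (hind : Indep m (MeasurableSpace.comap ξ inferInstance) Pr) (hz : Measurable[m] z)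
    (hN : Measurable (Function.uncurry N)) (hσ : 0 ≤ σ2)
    (hvar : ∀ e, ∫⁻ ω, ‖N e (ξ ω)‖ₑ ^ 2 ∂Pr ≤ ENNReal.ofReal σ2) :
    MemLp (fun ω => N (z ω) (ξ ω)) 2 Pr ∧ ∫ ω, ‖N (z ω) (ξ ω)‖ ^ 2 ∂Pr ≤ σ2 := by
  have hz' : Measurable z := hz.mono hm le_rfl
  have hmeas : Measurable fun ω => N (z ω) (ξ ω) := hN.comp (hz'.prodMk hξ)
  refine integral_norm_sq_le_of_lintegral_le hmeas.aestronglyMeasurable hσ ?_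
  have hsq : Measurable fun q : E × T => ‖N q.1 q.2‖ₑ ^ 2 := hN.enorm.pow_const 2
  have : IsProbabilityMeasure (Pr.map z) := Measure.isProbabilityMeasure_map hz'.aemeasurable
  have : IsProbabilityMeasure (Pr.map ξ) := Measure.isProbabilityMeasure_map hξ.aemeasurable
  calc ∫⁻ ω, ‖N (z ω) (ξ ω)‖ₑ ^ 2 ∂Pr
      = ∫⁻ q, ‖N q.1 q.2‖ₑ ^ 2 ∂(Pr.map fun ω => (z ω, ξ ω)) :=
        (lintegral_map hsq (hz'.prodMk hξ)).symm
    _ = ∫⁻ e, ∫⁻ t, ‖N e t‖ₑ ^ 2 ∂(Pr.map ξ) ∂(Pr.map z) := by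
        rw [map_prodMk_eq_prod hm hξ hind hz, lintegral_prod _ hsq.aemeasurable]
    _ ≤ ∫⁻ _, ENNReal.ofReal σ2 ∂(Pr.map z) := by
        refine lintegral_mono fun e => ?_
        have hNe : Measurable fun t => ‖N e t‖ₑ ^ 2 := hsq.comp measurable_prodMk_left
        rw [lintegral_map hNe hξ]
        exact hvar e
    _ = ENNReal.ofReal σ2 := by simp

/-- Centered noise at an independent random point is orthogonal to the past. -/
theorem integral_inner_noise_eq_zero (hm : m ≤ mΩ) (hξ : Measurable ξ)
    (hind : Indep m (MeasurableSpace.comap ξ inferInstance) Pr) (hz : Measurable[m] z)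
    (hN : Measurable (Function.uncurry N)) (hσ : 0 ≤ σ2)
    (hvar : ∀ e, ∫⁻ ω, ‖N e (ξ ω)‖ₑ ^ 2 ∂Pr ≤ ENNReal.ofReal σ2)
    (hzero : ∀ e, ∫ ω, N e (ξ ω) ∂Pr = 0) {φ : Ω → V} (hφ : Measurable[m] φ)
    (hφ2 : MemLp φ 2 Pr) :
    ∫ ω, inner ℝ (φ ω) (N (z ω) (ξ ω)) ∂Pr = 0 := by
  have hN2 := (noise_memLp hm hξ hind hz hN hσ hvar).1
  -- Point and test vector both depend on the past; as a pair they are independent of ξ, and Fubini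
  -- integrates ξ out first.
  set w : Ω → E × V := fun ω => (z ω, φ ω) with hw
  have hwm : Measurable[m] w := hz.prodMk hφ
  have hw' : Measurable w := hwm.mono hm le_rfl
  set g : (E × V) × T → ℝ := fun q => inner ℝ q.1.2 (N q.1.1 q.2) with hg
  have hgm : Measurable g := by
    have h1 : Measurable fun q : (E × V) × T => q.1.2 := measurable_snd.comp measurable_fst
    have h2 : Measurable fun q : (E × V) × T => N q.1.1 q.2 :=
      hN.comp ((measurable_fst.comp measurable_fst).prodMk measurable_snd)
    exact h1.inner h2
  have hmap := map_prodMk_eq_prod hm hξ hind hwm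
  have hint : Integrable g ((Pr.map w).prod (Pr.map ξ)) := by
    rw [← hmap, integrable_map_measure hgm.aestronglyMeasurable (hw'.prodMk hξ).aemeasurable]
    exact integrable_inner hφ2 hN2
  have : IsProbabilityMeasure (Pr.map w) := Measure.isProbabilityMeasure_map hw'.aemeasurable
  have : IsProbabilityMeasure (Pr.map ξ) := Measure.isProbabilityMeasure_map hξ.aemeasurable
  calc ∫ ω, inner ℝ (φ ω) (N (z ω) (ξ ω)) ∂Pr
      = ∫ q, g q ∂(Pr.map fun ω => (w ω, ξ ω)) :=
        (integral_map (hw'.prodMk hξ).aemeasurable hgm.aestronglyMeasurable).symm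
    _ = ∫ e, ∫ t, g (e, t) ∂(Pr.map ξ) ∂(Pr.map w) := by rw [hmap, integral_prod _ hint]
    _ = ∫ _, (0 : ℝ) ∂(Pr.map w) := by
        refine integral_congr_ae (Filter.Eventually.of_forall fun e => ?_)
        have hNe : Measurable fun t => N e.1 t := hN.comp measurable_prodMk_left
        simp only [hg]
        rw [integral_map hξ.aemeasurable
          ((measurable_const.inner hNe).aestronglyMeasurable)]
        have h1 := (integral_norm_sq_le_of_lintegral_le
          (hNe.comp hξ).aestronglyMeasurable hσ (hvar e.1)).1
        have h2 : Integrable (fun ω => N e.1 (ξ ω)) Pr := h1.integrable one_le_two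
        rw [integral_inner h2, hzero, inner_zero_right]
    _ = 0 := by simp

/-- Only the n diagonal terms of the expanded square survive, against a prefactor n⁻². This is the
origin of the linear speedup. -/
theorem integral_norm_mean_sq_le {n : ℕ} (hn : 0 < n) {v : Fin n → Ω → V}
    (hv : ∀ i, MemLp (v i) 2 Pr) (hvar : ∀ i, ∫ ω, ‖v i ω‖ ^ 2 ∂Pr ≤ σ2)
    (horth : ∀ i j, i ≠ j → ∫ ω, inner ℝ (v i ω) (v j ω) ∂Pr = 0) :
    ∫ ω, ‖mean fun i => v i ω‖ ^ 2 ∂Pr ≤ σ2 / n := by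
  have hn' : (0 : ℝ) < n := by positivity
  have e : ∀ ω, ‖mean fun i => v i ω‖ ^ 2
      = ((n : ℝ)⁻¹) ^ 2 * ∑ i, ∑ j, inner ℝ (v i ω) (v j ω) := by
    intro ω
    rw [mean, norm_smul, mul_pow, Real.norm_of_nonneg (by positivity), ← real_inner_self_eq_norm_sq,
      sum_inner]
    simp_rw [inner_sum]
  simp_rw [e]
  rw [integral_const_mul, integral_finsetSum _ fun i _ => integrable_finsetSum _ fun j _ =>
    integrable_inner (hv i) (hv j)]
  have h2 : ∀ i, ∫ ω, ∑ j, inner ℝ (v i ω) (v j ω) ∂Pr ≤ σ2 := by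
    intro i
    rw [integral_finsetSum _ fun j _ => integrable_inner (hv i) (hv j),
      Finset.sum_eq_single i (fun j _ hj => horth i j hj.symm) (by simp)]
    simp_rw [real_inner_self_eq_norm_sq]
    exact hvar i
  calc ((n : ℝ)⁻¹) ^ 2 * ∑ i, ∫ ω, ∑ j, inner ℝ (v i ω) (v j ω) ∂Pr
      ≤ ((n : ℝ)⁻¹) ^ 2 * ∑ _i : Fin n, σ2 := by gcongr with i; exact h2 i
    _ = σ2 / n := by simp; field_simp

end Noise

/-! ### The noise of the local estimators -/

/-- The map `z ↦ (z, 0)` as a linear map. -/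
def stInlₗ (dx dy : ℕ) : Pt dx dy →ₗ[ℝ] St dx dy where
  toFun z := st z 0
  map_add' _ _ := st_ext rfl (by simp)
  map_smul' _ _ := st_ext rfl (by simp)

/-- The map `(a, b) ↦ ((-a, 0), b)` as a linear map. -/
def stTwistₗ (dx dy : ℕ) : Pt dx dy →ₗ[ℝ] St dx dy where
  toFun z := st (pt (-z.fst) 0) z.snd
  map_add' _ _ := st_ext (pt_ext (by simp [add_comm]) (by simp)) rfl
  map_smul' _ _ := st_ext (pt_ext (by simp) (by simp)) rfl

/-- The map `z ↦ (z, 0)` as a continuous linear map. -/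
def stInl (dx dy : ℕ) : Pt dx dy →L[ℝ] St dx dy :=
  (stInlₗ dx dy).mkContinuous 1 fun z => by
    refine le_of_sq_le_sq ?_ (by positivity)
    rw [one_mul, norm_sq_st]
    simp [stInlₗ]

/-- The map `(a, b) ↦ ((-a, 0), b)` as a continuous linear map. -/
def stTwist (dx dy : ℕ) : Pt dx dy →L[ℝ] St dx dy :=
  (stTwistₗ dx dy).mkContinuous 1 fun z => by
    refine le_of_sq_le_sq ?_ (by positivity)
    rw [one_mul, norm_sq_st, norm_sq_pt, norm_sq_pt]
    simp [stTwistₗ]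

theorem stInl_apply {dx dy : ℕ} (z : Pt dx dy) : stInl dx dy z = st z 0 := rfl

theorem stTwist_apply {dx dy : ℕ} (z : Pt dx dy) :
    stTwist dx dy z = st (pt (-z.fst) 0) z.snd := rfl

theorem norm_stInl {dx dy : ℕ} (z : Pt dx dy) : ‖stInl dx dy z‖ ^ 2 = ‖z‖ ^ 2 := by
  rw [stInl_apply, norm_sq_st]; simp

theorem norm_stTwist {dx dy : ℕ} (z : Pt dx dy) : ‖stTwist dx dy z‖ ^ 2 = ‖z‖ ^ 2 := by
  rw [stTwist_apply, norm_sq_st, norm_sq_pt, norm_sq_pt]; simp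

theorem measurable_pt {dx dy : ℕ} {α : Type*} [MeasurableSpace α] {x : α → Vec dx}
    {y : α → Vec dy} (hx : Measurable x) (hy : Measurable y) :
    Measurable fun a => pt (x a) (y a) :=
  (WithLp.measurable_toLp 2 _).comp (hx.prodMk hy)

theorem measurable_st_fst {dx dy : ℕ} : Measurable fun s : St dx dy => s.fst :=
  measurable_fst.comp (WithLp.measurable_ofLp 2 _)

theorem measurable_st_snd {dx dy : ℕ} : Measurable fun s : St dx dy => s.snd :=
  measurable_snd.comp (WithLp.measurable_ofLp 2 _)

theorem measurable_pt_fst {dx dy : ℕ} : Measurable fun s : Pt dx dy => s.fst :=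
  measurable_fst.comp (WithLp.measurable_ofLp 2 _)

namespace Problem

variable {n dx dy : ℕ} {Sf Sg : Type*} (P : Problem n dx dy Sf Sg)

/-- The point `(x, θ)` of the combined variable `((x, y), θ)`. -/
def lowPt (s : St dx dy) : Pt dx dy := pt s.fst.fst s.snd

/-- The noise of the estimators of agent `i` at `s` for the samples `t`. -/
def noise (μ : ℝ) (i : Fin n) (s : St dx dy) (t : Sf × Sg) : St dx dy :=
  stInl dx dy (μ • (P.gradf i s.fst t.1 - ∇ (P.f i) s.fst))
    + stInl dx dy (P.gradg i s.fst t.2 - ∇ (P.g i) s.fst)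
    + stTwist dx dy (P.gradg i (lowPt s) t.2 - ∇ (P.g i) (lowPt s))

variable {P} {L₁ L₂ : ℝ}

/-- The error of ∇g_i at (x, θ) enters the x-direction with a minus sign, the θ-direction with a
plus sign and the y-direction not at all; this is the role of `stTwist`. -/
theorem est_eq (γ μ : ℝ) (sf : Fin n → Sf) (sg : Fin n → Sg) (x : Fin n → Vec dx)
    (y θ : Fin n → Vec dy) (i : Fin n) :
    st (pt (P.estX μ sf sg x y θ i) (P.estY γ μ sf sg x y θ i)) (P.estTheta γ sg x y θ i)
      = μ • P.dirA i (st (pt (x i) (y i)) (θ i)) + P.dirB γ i (st (pt (x i) (y i)) (θ i))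
        + P.noise μ i (st (pt (x i) (y i)) (θ i)) (sf i, sg i) := by
  refine st_ext (pt_ext ?_ ?_) ?_
  · simp only [estX, dirA, dirB, noise, lowPt, stInl_apply, stTwist_apply, WithLp.add_fst,
      WithLp.smul_fst, WithLp.sub_fst, st_fst, st_snd, pt_fst]
    module
  · simp only [estY, dirA, dirB, noise, lowPt, stInl_apply, stTwist_apply, WithLp.add_fst,
      WithLp.smul_fst, WithLp.sub_fst, WithLp.add_snd, WithLp.smul_snd, WithLp.sub_snd, st_fst,
      st_snd, pt_fst, pt_snd]
    module
  · simp only [estTheta, dirA, dirB, noise, lowPt, stInl_apply, stTwist_apply, WithLp.add_snd,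
      WithLp.smul_snd, WithLp.sub_snd, st_fst, st_snd, pt_fst, pt_snd]
    module

theorem norm_noise_sq_le (μ : ℝ) (i : Fin n) (s : St dx dy) (t : Sf × Sg) :
    ‖P.noise μ i s t‖ ^ 2 ≤ 3 * (μ ^ 2 * ‖P.gradf i s.fst t.1 - ∇ (P.f i) s.fst‖ ^ 2
      + ‖P.gradg i s.fst t.2 - ∇ (P.g i) s.fst‖ ^ 2
      + ‖P.gradg i (lowPt s) t.2 - ∇ (P.g i) (lowPt s)‖ ^ 2) := by
  refine (norm_add₃_sq_le _ _ _).trans (le_of_eq ?_)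
  rw [norm_stInl, norm_stInl, norm_stTwist, norm_smul, mul_pow, Real.norm_eq_abs, sq_abs]

section

variable {Ω : Type*} [MeasurableSpace Sf] [MeasurableSpace Sg] [MeasurableSpace Ω]
  {Pr : Measure Ω} [IsProbabilityMeasure Pr] {ξf : ℕ → Fin n → Ω → Sf} {ξg : ℕ → Fin n → Ω → Sg}
  {δf δg : ℝ}

theorem continuous_gradient_f (hS : Smooth P L₁ L₂) (i : Fin n) :
    Continuous fun z => ∇ (P.f i) z :=
  continuous_of_norm_sub_le (hS.smooth_f i)

theorem continuous_gradient_g (hS : Smooth P L₁ L₂) (i : Fin n) :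
    Continuous fun z => ∇ (P.g i) z :=
  continuous_of_norm_sub_le (hS.smooth_g i)

variable (hS : Smooth P L₁ L₂) (hO : Oracle Pr P ξf ξg δf δg)
include hS hO

theorem measurable_noise (μ : ℝ) (i : Fin n) : Measurable (Function.uncurry (P.noise μ i)) := by
  have hlow : Measurable fun q : St dx dy × (Sf × Sg) => (lowPt q.1 : Pt dx dy) :=
    measurable_pt (measurable_pt_fst.comp (measurable_st_fst.comp measurable_fst))
      (measurable_st_snd.comp measurable_fst)
  have hfst : Measurable fun q : St dx dy × (Sf × Sg) => q.1.fst :=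
    measurable_st_fst.comp measurable_fst
  have ht1 : Measurable fun q : St dx dy × (Sf × Sg) => q.2.1 := measurable_fst.comp measurable_snd
  have ht2 : Measurable fun q : St dx dy × (Sf × Sg) => q.2.2 := measurable_snd.comp measurable_snd
  have h1 : Measurable fun q : St dx dy × (Sf × Sg) =>
      P.gradf i q.1.fst q.2.1 - ∇ (P.f i) q.1.fst :=
    ((hO.measurable_gradf i).comp (hfst.prodMk ht1)).sub
      ((continuous_gradient_f hS i).measurable.comp hfst)
  have h2 : Measurable fun q : St dx dy × (Sf × Sg) =>
      P.gradg i q.1.fst q.2.2 - ∇ (P.g i) q.1.fst :=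
    ((hO.measurable_gradg i).comp (hfst.prodMk ht2)).sub
      ((continuous_gradient_g hS i).measurable.comp hfst)
  have h3 : Measurable fun q : St dx dy × (Sf × Sg) =>
      P.gradg i (lowPt q.1) q.2.2 - ∇ (P.g i) (lowPt q.1) :=
    ((hO.measurable_gradg i).comp (hlow.prodMk ht2)).sub
      ((continuous_gradient_g hS i).measurable.comp hlow)
  exact (((stInl dx dy).measurable.comp (h1.const_smul μ)).add
    ((stInl dx dy).measurable.comp h2)).add ((stTwist dx dy).measurable.comp h3)

theorem memLp_error_f (k : ℕ) (i : Fin n) (z : Pt dx dy) :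
    MemLp (fun ω => P.gradf i z (ξf k i ω) - ∇ (P.f i) z) 2 Pr ∧
      ∫ ω, ‖P.gradf i z (ξf k i ω) - ∇ (P.f i) z‖ ^ 2 ∂Pr ≤ δf ^ 2 := by
  have hm : Measurable fun ω => P.gradf i z (ξf k i ω) - ∇ (P.f i) z :=
    (((hO.measurable_gradf i).comp measurable_prodMk_left).comp (hO.measurable_ξf k i)).sub_const _
  refine integral_norm_sq_le_of_lintegral_le hm.aestronglyMeasurable (sq_nonneg _) ?_
  refine le_trans (le_of_eq (lintegral_congr fun ω => ?_)) (hO.variance_f k i z)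
  rw [← enorm_neg, neg_sub]

theorem memLp_error_g (k : ℕ) (i : Fin n) (z : Pt dx dy) :
    MemLp (fun ω => P.gradg i z (ξg k i ω) - ∇ (P.g i) z) 2 Pr ∧
      ∫ ω, ‖P.gradg i z (ξg k i ω) - ∇ (P.g i) z‖ ^ 2 ∂Pr ≤ δg ^ 2 := by
  have hm : Measurable fun ω => P.gradg i z (ξg k i ω) - ∇ (P.g i) z :=
    (((hO.measurable_gradg i).comp measurable_prodMk_left).comp (hO.measurable_ξg k i)).sub_const _
  refine integral_norm_sq_le_of_lintegral_le hm.aestronglyMeasurable (sq_nonneg _) ?_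
  refine le_trans (le_of_eq (lintegral_congr fun ω => ?_)) (hO.variance_g k i z)
  rw [← enorm_neg, neg_sub]

theorem integral_error_f (k : ℕ) (i : Fin n) (z : Pt dx dy) :
    ∫ ω, (P.gradf i z (ξf k i ω) - ∇ (P.f i) z) ∂Pr = 0 := by
  have h1 := ((memLp_error_f hS hO k i z).1.integrable one_le_two).add
    (integrable_const (∇ (P.f i) z))
  -- Unbiasedness alone does not give integrability, as the Bochner integral defaults to 0; the
  -- variance bound does.
  have h2 : Integrable (fun ω => P.gradf i z (ξf k i ω)) Pr :=
    h1.congr (Filter.Eventually.of_forall fun ω => by simp)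
  rw [integral_sub h2 (integrable_const _), hO.unbiased_f]
  simp

theorem integral_error_g (k : ℕ) (i : Fin n) (z : Pt dx dy) :
    ∫ ω, (P.gradg i z (ξg k i ω) - ∇ (P.g i) z) ∂Pr = 0 := by
  have h1 := ((memLp_error_g hS hO k i z).1.integrable one_le_two).add
    (integrable_const (∇ (P.g i) z))
  have h2 : Integrable (fun ω => P.gradg i z (ξg k i ω)) Pr :=
    h1.congr (Filter.Eventually.of_forall fun ω => by simp)
  rw [integral_sub h2 (integrable_const _), hO.unbiased_g]
  simp

theorem integral_noise_eq_zero (μ : ℝ) (k : ℕ) (i : Fin n) (s : St dx dy) :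
    ∫ ω, P.noise μ i s (ξf k i ω, ξg k i ω) ∂Pr = 0 := by
  have h1 : Integrable (fun ω => μ • (P.gradf i s.fst (ξf k i ω) - ∇ (P.f i) s.fst)) Pr :=
    ((memLp_error_f hS hO k i s.fst).1.integrable one_le_two).smul μ
  have h2 := (memLp_error_g hS hO k i s.fst).1.integrable one_le_two
  have h3 := (memLp_error_g hS hO k i (lowPt s)).1.integrable one_le_two
  have i1 := (stInl dx dy).integrable_comp h1
  have i2 := (stInl dx dy).integrable_comp h2
  have i3 := (stTwist dx dy).integrable_comp h3
  have i12 : Integrable (fun ω =>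
      stInl dx dy (μ • (P.gradf i s.fst (ξf k i ω) - ∇ (P.f i) s.fst))
        + stInl dx dy (P.gradg i s.fst (ξg k i ω) - ∇ (P.g i) s.fst)) Pr := i1.add i2
  simp only [noise]
  rw [integral_add i12 i3, integral_add i1 i2, ContinuousLinearMap.integral_comp_comm _ h1,
    ContinuousLinearMap.integral_comp_comm _ h2, ContinuousLinearMap.integral_comp_comm _ h3,
    integral_smul, integral_error_f hS hO, integral_error_g hS hO, integral_error_g hS hO]
  simp

/-- The three errors may be correlated, two of them sharing a sample, so they are only combined by
‖u + v + w‖² ≤ 3(‖u‖² + ‖v‖² + ‖w‖²). -/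
theorem lintegral_noise_le {μ μ₀ : ℝ} (hμ : 0 ≤ μ) (hμ' : μ ≤ μ₀) (k : ℕ) (i : Fin n)
    (s : St dx dy) : ∫⁻ ω, ‖P.noise μ i s (ξf k i ω, ξg k i ω)‖ₑ ^ 2 ∂Pr
      ≤ ENNReal.ofReal (3 * (μ₀ ^ 2 * δf ^ 2 + δg ^ 2 + δg ^ 2)) := by
  have hf := memLp_error_f hS hO k i s.fst
  have hg := memLp_error_g hS hO k i s.fst
  have hg' := memLp_error_g hS hO k i (lowPt s)
  have i1 := (integrable_norm_sq hf.1).const_mul (μ ^ 2)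
  have i2 := integrable_norm_sq hg.1
  have i3 := integrable_norm_sq hg'.1
  have hm : Measurable fun ω => P.noise μ i s (ξf k i ω, ξg k i ω) :=
    ((measurable_noise hS hO μ i).comp measurable_prodMk_left).comp
      ((hO.measurable_ξf k i).prodMk (hO.measurable_ξg k i))
  have hN : MemLp (fun ω => P.noise μ i s (ξf k i ω, ξg k i ω)) 2 Pr := by
    rw [memLp_two_iff_integrable_sq_norm hm.aestronglyMeasurable]
    refine (((i1.add i2).add i3).const_mul 3).mono' (hm.norm.pow_const 2).aestronglyMeasurable
      (Filter.Eventually.of_forall fun ω => ?_)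
    rw [Real.norm_of_nonneg (sq_nonneg _)]
    exact norm_noise_sq_le μ i s _
  rw [lintegral_enorm_sq_eq hN]
  refine ENNReal.ofReal_le_ofReal ?_
  refine (integral_mono (integrable_norm_sq hN) (((i1.add i2).add i3).const_mul 3)
    fun ω => norm_noise_sq_le μ i s _).trans ?_
  rw [integral_const_mul]
  simp only [Pi.add_apply]
  have i12 : Integrable (fun ω => μ ^ 2 * ‖P.gradf i s.fst (ξf k i ω) - ∇ (P.f i) s.fst‖ ^ 2
    + ‖P.gradg i s.fst (ξg k i ω) - ∇ (P.g i) s.fst‖ ^ 2) Pr := i1.add i2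
  rw [integral_add i12 i3, integral_add i1 i2, integral_const_mul]
  have h4 : μ ^ 2 * ∫ ω, ‖P.gradf i s.fst (ξf k i ω) - ∇ (P.f i) s.fst‖ ^ 2 ∂Pr
      ≤ μ₀ ^ 2 * δf ^ 2 := by
    refine mul_le_mul (pow_le_pow_left₀ hμ hμ' 2) hf.2 ?_ (sq_nonneg _)
    exact integral_nonneg fun ω => sq_nonneg _
  have h5 := hg.2
  have h6 := hg'.2
  linarith

end

end Problem

/-! ### The run as a gradient tracking method in the combined variable -/

section Combine

variable {n dx dy : ℕ}

/-- Combination of the local variables `x_i`, `y_i`, `θ_i`. -/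
def comb (x : Fin n → Vec dx) (y θ : Fin n → Vec dy) : Fin n → St dx dy :=
  fun i => st (pt (x i) (y i)) (θ i)

theorem mean_comb (x : Fin n → Vec dx) (y θ : Fin n → Vec dy) :
    mean (comb x y θ) = st (pt (mean x) (mean y)) (mean θ) := by
  refine st_ext (pt_ext ?_ ?_) ?_
  · rw [mean_fst, mean_pt_fst]; rfl
  · rw [mean_fst, mean_pt_snd]; rfl
  · rw [mean_snd]; rfl

theorem mix_comb (W : Matrix (Fin n) (Fin n) ℝ) (x : Fin n → Vec dx) (y θ : Fin n → Vec dy) :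
    mix W (comb x y θ) = comb (mix W x) (mix W y) (mix W θ) := by
  ext1 i
  have h1 := congrFun (mix_map W (WithLp.fstₗ 2 ℝ (Pt dx dy) (Vec dy)) (comb x y θ)) i
  have h2 := congrFun (mix_map W (WithLp.sndₗ 2 ℝ (Pt dx dy) (Vec dy)) (comb x y θ)) i
  have h3 := congrFun (mix_map W (WithLp.fstₗ 2 ℝ (Vec dx) (Vec dy))
    fun i => (comb x y θ i).fst) i
  have h4 := congrFun (mix_map W (WithLp.sndₗ 2 ℝ (Vec dx) (Vec dy))
    fun i => (comb x y θ i).fst) i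
  simp only [WithLp.fstₗ_apply, WithLp.sndₗ_apply] at h1 h2 h3 h4
  refine st_ext (pt_ext ?_ ?_) ?_
  · rw [← h1]; exact h3.symm
  · rw [← h1]; exact h4.symm
  · exact h2.symm

theorem dev_comb (x : Fin n → Vec dx) (y θ : Fin n → Vec dy) :
    dev (comb x y θ) = dev x + dev y + dev θ := by
  unfold dev msq
  rw [mean_comb, ← mul_add, ← mul_add, ← Finset.sum_add_distrib, ← Finset.sum_add_distrib]
  congr 1
  refine Finset.sum_congr rfl fun i _ => ?_
  rw [norm_sq_st, norm_sq_pt]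
  rfl

theorem sqDev_eq {d : ℕ} (hn : 0 < n) (v : Fin n → Vec d) : sqDev v = ENNReal.ofReal (dev v) := by
  unfold sqDev dev msq
  rw [ENNReal.ofReal_mul (by positivity), ENNReal.ofReal_inv_of_pos (by positivity),
    ENNReal.ofReal_natCast, ENNReal.ofReal_sum_of_nonneg fun i _ => sq_nonneg _]
  congr 1
  refine Finset.sum_congr rfl fun i _ => ?_
  rw [ENNReal.ofReal_pow (norm_nonneg _), ofReal_norm]

end Combine

section Run

variable {n dx dy : ℕ} {Sf Sg : Type*}

/-- The combined local variables of a run. -/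
def runS (r : ℕ → GTState n dx dy) (k : ℕ) : Fin n → St dx dy := comb (r k).x (r k).y (r k).θ

/-- The combined trackers of a run. -/
def runD (r : ℕ → GTState n dx dy) (k : ℕ) : Fin n → St dx dy :=
  comb (r (k + 1)).Dx (r (k + 1)).Dy (r (k + 1)).Dθ

/-- The combined estimators of a run. -/
def runH (r : ℕ → GTState n dx dy) (k : ℕ) : Fin n → St dx dy :=
  comb (r (k + 1)).Hx (r (k + 1)).Hy (r (k + 1)).Hθ

variable (P : Problem n dx dy Sf Sg) (W : Matrix (Fin n) (Fin n) ℝ) (γ cl lam : ℝ) (μ : ℕ → ℝ)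
  (x₀ : Fin n → Vec dx) (y₀ θ₀ : Fin n → Vec dy) (sf : ℕ → Fin n → Sf) (sg : ℕ → Fin n → Sg)

theorem isTracking_gtRun {r : ℕ → GTState n dx dy}
    (hr : r = gtRun P W γ μ (fun _ => lam) (fun _ => cl * lam) (fun _ => cl * lam) x₀ y₀ θ₀ sf sg) :
    IsTracking W (precond dx dy cl) lam (runS r) (runD r) (runH r) := by
  refine ⟨?_, fun k => ?_, fun k => ?_⟩
  -- State 0 stores zero trackers and estimators, the convention D⁻¹ = Ĥ⁻¹ = 0; `runD` and `runH`
  -- read state k + 1 to obtain those of iteration k.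
  · rw [runD, runH, mix_comb, hr]
    simp only [gtRun, gtStep, zero_add, sub_zero]
  · have e : runD r k + runH r (k + 1) - runH r k
        = comb ((r (k + 1)).Dx + (r (k + 2)).Hx - (r (k + 1)).Hx)
          ((r (k + 1)).Dy + (r (k + 2)).Hy - (r (k + 1)).Hy)
          ((r (k + 1)).Dθ + (r (k + 2)).Hθ - (r (k + 1)).Hθ) := rfl
    rw [e, mix_comb, hr]
    rfl
  · have e : (runS r k - lam • fun i => precond dx dy cl (runD r k i))
        = comb ((r k).x - (cl * lam) • (r (k + 1)).Dx) ((r k).y - (cl * lam) • (r (k + 1)).Dy)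
          ((r k).θ - lam • (r (k + 1)).Dθ) := by
      ext1 i
      refine st_ext (pt_ext ?_ ?_) ?_
      · have : lam • cl • (r (k + 1)).Dx i = (cl * lam) • (r (k + 1)).Dx i := by
          rw [smul_smul, mul_comm]
        exact congrArg (fun v => (r k).x i - v) this
      · have : lam • cl • (r (k + 1)).Dy i = (cl * lam) • (r (k + 1)).Dy i := by
          rw [smul_smul, mul_comm]
        exact congrArg (fun v => (r k).y i - v) this
      · rfl
    rw [e, mix_comb, hr]
    rfl

theorem runH_eq {lamθ lamx lamy : ℕ → ℝ} {r : ℕ → GTState n dx dy}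
    (hr : r = gtRun P W γ μ lamθ lamx lamy x₀ y₀ θ₀ sf sg) (k : ℕ) (i : Fin n) :
    runH r k i = μ k • P.dirA i (runS r k i) + P.dirB γ i (runS r k i)
      + P.noise (μ k) i (runS r k i) (sf k i, sg k i) := by
  have e : runH r k i = st (pt (P.estX (μ k) (sf k) (sg k) (r k).x (r k).y (r k).θ i)
      (P.estY γ (μ k) (sf k) (sg k) (r k).x (r k).y (r k).θ i))
      (P.estTheta γ (sg k) (r k).x (r k).y (r k).θ i) := by rw [hr]; rfl
  rw [e, Problem.est_eq]
  rfl

end Run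

/-- The slow decay condition says that k μ_k increases to (k + 1) μ_{k+1}. It follows from r ≤ r^p
for r = (k+1)/(k+2) and p ≤ 1, together with k(k + 2) ≤ (k + 1)². -/
theorem slowDecay_penalty {μ₀ p : ℝ} (hμ₀ : 0 < μ₀) (hp : 0 < p) (hp1 : p ≤ 1) :
    SlowDecay (penalty μ₀ p) μ₀ := by
  have key : ∀ k : ℕ, ((k : ℝ) + 1) ^ (-p) * k ≤ ((k : ℝ) + 1 + 1) ^ (-p) * (k + 1) := by
    intro k
    have h1 : (0 : ℝ) < (k : ℝ) + 1 := by positivity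
    have h2 : (0 : ℝ) < (k : ℝ) + 1 + 1 := by positivity
    have h3 : ((k : ℝ) + 1) / ((k : ℝ) + 1 + 1) ≤ (((k : ℝ) + 1) / ((k : ℝ) + 1 + 1)) ^ p := by
      have := Real.rpow_le_rpow_of_exponent_ge (x := ((k : ℝ) + 1) / ((k : ℝ) + 1 + 1))
        (by positivity) (by rw [div_le_one h2]; linarith) hp1
      rwa [Real.rpow_one] at this
    rw [Real.div_rpow h1.le h2.le, div_le_div_iff₀ h2 (by positivity)] at h3
    rw [Real.rpow_neg h1.le, Real.rpow_neg h2.le, inv_mul_eq_div, inv_mul_eq_div,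
      div_le_div_iff₀ (by positivity) (by positivity)]
    have h4 : 0 < ((k : ℝ) + 1 + 1) ^ p := by positivity
    have h5 : (0 : ℝ) ≤ k := k.cast_nonneg
    have h6 : (k : ℝ) * ((k + 1) * ((k : ℝ) + 1 + 1) ^ p)
        ≤ k * (((k : ℝ) + 1) ^ p * (k + 1 + 1)) := by gcongr
    nlinarith [Real.rpow_pos_of_pos h1 p]
  refine ⟨by simp [penalty], fun k => by unfold penalty; positivity, fun k => ?_, fun k => ?_⟩
  · unfold penalty
    refine mul_le_mul_of_nonneg_left ?_ hμ₀.le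
    refine Real.rpow_le_rpow_of_nonpos (by positivity) ?_ (by linarith)
    push_cast; linarith
  · unfold penalty
    have := mul_le_mul_of_nonneg_left (key k) hμ₀.le
    push_cast
    linarith

/-! ### Random runs -/

section Samples

variable {n : ℕ} {Sf Sg Ω : Type*} [MeasurableSpace Sf] [MeasurableSpace Sg]
  [mΩ : MeasurableSpace Ω]

/-- The samples of agent `q.2` at iteration `q.1`. -/
def sample (ξf : ℕ → Fin n → Ω → Sf) (ξg : ℕ → Fin n → Ω → Sg) (q : ℕ × Fin n) (ω : Ω) : Sf × Sg :=
  (ξf q.1 q.2 ω, ξg q.1 q.2 ω)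

/-- The σ-algebra generated by the samples with index in `Q`. -/
@[reducible] def sampleAlg (ξf : ℕ → Fin n → Ω → Sf) (ξg : ℕ → Fin n → Ω → Sg) (Q : Set (ℕ × Fin n)) :
    MeasurableSpace Ω :=
  ⨆ q ∈ Q, MeasurableSpace.comap (sample ξf ξg q) inferInstance

variable {ξf : ℕ → Fin n → Ω → Sf} {ξg : ℕ → Fin n → Ω → Sg}

theorem sampleAlg_mono {Q Q' : Set (ℕ × Fin n)} (h : Q ⊆ Q') :
    sampleAlg ξf ξg Q ≤ sampleAlg ξf ξg Q' := biSup_mono fun _ hq => h hq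

theorem measurable_sample_sampleAlg {Q : Set (ℕ × Fin n)} {q : ℕ × Fin n} (hq : q ∈ Q) :
    Measurable[sampleAlg ξf ξg Q] (sample ξf ξg q) := by
  rw [measurable_iff_comap_le]
  exact le_biSup (fun q => MeasurableSpace.comap (sample ξf ξg q) inferInstance) hq

variable {dx dy : ℕ} {P : Problem n dx dy Sf Sg} {Pr : Measure Ω} [IsProbabilityMeasure Pr]
  {δf δg : ℝ}

theorem Oracle.measurable_sample (hO : Oracle Pr P ξf ξg δf δg) (q : ℕ × Fin n) :
    Measurable (sample ξf ξg q) := (hO.measurable_ξf q.1 q.2).prodMk (hO.measurable_ξg q.1 q.2)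

theorem Oracle.sampleAlg_le (hO : Oracle Pr P ξf ξg δf δg) (Q : Set (ℕ × Fin n)) :
    sampleAlg ξf ξg Q ≤ mΩ := iSup₂_le fun q _ => (hO.measurable_sample q).comap_le

theorem Oracle.indep_sampleAlg (hO : Oracle Pr P ξf ξg δf δg) {Q : Set (ℕ × Fin n)}
    {q : ℕ × Fin n} (hq : q ∉ Q) :
    Indep (sampleAlg ξf ξg Q) (MeasurableSpace.comap (sample ξf ξg q) inferInstance) Pr := by
  have h := indep_iSup_of_disjoint (fun q => (hO.measurable_sample q).comap_le) hO.indep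
    (Set.disjoint_singleton_right.2 hq)
  simp only [Set.mem_singleton_iff, iSup_iSup_eq_left] at h
  exact h

end Samples

/-! ### Closure properties of measurability and square integrability -/

section Vector

variable {n : ℕ} {Ω V : Type*} {m : MeasurableSpace Ω} [mΩ : MeasurableSpace Ω] {Pr : Measure Ω}
  [IsProbabilityMeasure Pr] [NormedAddCommGroup V] [InnerProductSpace ℝ V]
  [FiniteDimensional ℝ V] [MeasurableSpace V] [BorelSpace V]

theorem measurable_uncurry_comp {E T : Type*} [MeasurableSpace E] [MeasurableSpace T]
    {N : E → T → V} (hN : Measurable (Function.uncurry N)) {z : Ω → E} {ξ : Ω → T}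
    (hz : Measurable[m] z) (hξ : Measurable[m] ξ) : Measurable[m] fun ω => N (z ω) (ξ ω) :=
  hN.comp (hz.prodMk hξ)

theorem measurable_vec_smul (c : ℝ) {u : Ω → V} (hu : Measurable[m] u) :
    Measurable[m] fun ω => c • u ω := (continuous_const_smul c).measurable.comp hu

theorem measurable_vec_add {u v : Ω → V} (hu : Measurable[m] u) (hv : Measurable[m] v) :
    Measurable[m] fun ω => u ω + v ω := Measurable.add hu hv

theorem measurable_vec_sub {u v : Ω → V} (hu : Measurable[m] u) (hv : Measurable[m] v) :
    Measurable[m] fun ω => u ω - v ω := Measurable.sub hu hv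

theorem measurable_vec_comp {V' : Type*} [NormedAddCommGroup V'] [MeasurableSpace V']
    [BorelSpace V'] {L : ℝ} {f : V → V'} (hf : ∀ u v, ‖f u - f v‖ ≤ L * ‖u - v‖) {u : Ω → V}
    (hu : Measurable[m] u) : Measurable[m] fun ω => f (u ω) :=
  (continuous_of_norm_sub_le hf).measurable.comp hu

theorem measurable_mix (W : Matrix (Fin n) (Fin n) ℝ) {v : Fin n → Ω → V}
    (hv : ∀ i, Measurable[m] (v i)) (i : Fin n) :
    Measurable[m] fun ω => mix W (fun j => v j ω) i :=
  Finset.measurable_fun_sum _ fun j _ => measurable_vec_smul (W i j) (hv j)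

theorem measurable_mean {v : Fin n → Ω → V} (hv : ∀ i, Measurable[m] (v i)) :
    Measurable[m] fun ω => mean fun j => v j ω :=
  measurable_vec_smul _ (Finset.measurable_fun_sum _ fun j _ => hv j)

theorem memLp_vec_smul (c : ℝ) {u : Ω → V} (hu : MemLp u 2 Pr) :
    MemLp (fun ω => c • u ω) 2 Pr := hu.const_smul c

theorem memLp_vec_add {u v : Ω → V} (hu : MemLp u 2 Pr) (hv : MemLp v 2 Pr) :
    MemLp (fun ω => u ω + v ω) 2 Pr := hu.add hv

theorem memLp_vec_sub {u v : Ω → V} (hu : MemLp u 2 Pr) (hv : MemLp v 2 Pr) :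
    MemLp (fun ω => u ω - v ω) 2 Pr := hu.sub hv

theorem memLp_mix (W : Matrix (Fin n) (Fin n) ℝ) {v : Fin n → Ω → V}
    (hv : ∀ i, MemLp (v i) 2 Pr) (i : Fin n) : MemLp (fun ω => mix W (fun j => v j ω) i) 2 Pr :=
  memLp_finsetSum _ fun j _ => memLp_vec_smul (W i j) (hv j)

theorem memLp_mean {v : Fin n → Ω → V} (hv : ∀ i, MemLp (v i) 2 Pr) :
    MemLp (fun ω => mean fun j => v j ω) 2 Pr :=
  memLp_vec_smul _ (memLp_finsetSum _ fun j _ => hv j)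

theorem integrable_msq {v : Fin n → Ω → V} (hv : ∀ i, MemLp (v i) 2 Pr) :
    Integrable (fun ω => msq fun i => v i ω) Pr :=
  (integrable_finsetSum _ fun i _ => integrable_norm_sq (hv i)).const_mul _

theorem integral_msq_le (hn : 0 < n) {v : Fin n → Ω → V} (hv : ∀ i, MemLp (v i) 2 Pr)
    {σ2 : ℝ} (hσ : ∀ i, ∫ ω, ‖v i ω‖ ^ 2 ∂Pr ≤ σ2) : ∫ ω, msq (fun i => v i ω) ∂Pr ≤ σ2 := by
  have hn' : (0 : ℝ) < n := by positivity
  unfold msq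
  rw [integral_const_mul, integral_finsetSum _ fun i _ => integrable_norm_sq (hv i),
    inv_mul_le_iff₀ hn']
  refine (Finset.sum_le_sum fun i _ => hσ i).trans ?_
  simp

theorem integrable_dev {v : Fin n → Ω → V} (hv : ∀ i, MemLp (v i) 2 Pr) :
    Integrable (fun ω => dev fun i => v i ω) Pr :=
  integrable_msq (v := fun i ω => v i ω - mean fun j => v j ω)
    fun i => memLp_vec_sub (hv i) (memLp_mean hv)

theorem inner_mean (u : V) (v : Fin n → V) :
    inner ℝ u (mean v) = (n : ℝ)⁻¹ * ∑ i, inner ℝ u (v i) := by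
  rw [mean, real_inner_smul_right, inner_sum]

end Vector

theorem norm_precond_sub_le {dx dy : ℕ} (cl : ℝ) (u v : St dx dy) :
    ‖precond dx dy cl u - precond dx dy cl v‖ ≤ (|cl| + 1) * ‖u - v‖ := by
  rw [← map_sub]
  refine le_of_sq_le_sq ((norm_precond_sq_le cl _).trans ?_) (by positivity)
  rw [mul_pow]
  gcongr
  nlinarith [abs_nonneg cl, sq_abs cl]

theorem inner_precond_right {dx dy : ℕ} (cl : ℝ) (u v : St dx dy) :
    inner ℝ u (precond dx dy cl v) = inner ℝ (precond dx dy cl u) v := by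
  rw [inner_st, inner_st]
  simp only [precond, LinearMap.coe_mk, AddHom.coe_mk, st_fst, st_snd, real_inner_smul_left,
    real_inner_smul_right]

/-! ### Measurability, moments and noise of a random run -/

section RandomRun

variable {n dx dy : ℕ} {Sf Sg Ω : Type*} [MeasurableSpace Sf] [MeasurableSpace Sg]
  {m : MeasurableSpace Ω} [mΩ : MeasurableSpace Ω] {Pr : Measure Ω} [IsProbabilityMeasure Pr]
  {P : Problem n dx dy Sf Sg} {W : Matrix (Fin n) (Fin n) ℝ} {ξf : ℕ → Fin n → Ω → Sf} {ξg : ℕ → Fin n → Ω → Sg}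
  {δf δg L₁ L₂ γ cl lam μ₀ : ℝ} {μ : ℕ → ℝ} {S D H : ℕ → Fin n → Ω → St dx dy}

/-- The noise of agent `i` at iteration `k` of a random run. -/
def runNoise (P : Problem n dx dy Sf Sg) (μ : ℕ → ℝ) (ξf : ℕ → Fin n → Ω → Sf)
    (ξg : ℕ → Fin n → Ω → Sg) (S : ℕ → Fin n → Ω → St dx dy) (k : ℕ) (i : Fin n) (ω : Ω) :
    St dx dy := P.noise (μ k) i (S k i ω) (sample ξf ξg (k, i) ω)

/-- The iterates `S`, trackers `D` and estimators `H` of a random run. -/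
structure IsRandomRun (P : Problem n dx dy Sf Sg) (W : Matrix (Fin n) (Fin n) ℝ) (γ cl lam : ℝ)
    (μ : ℕ → ℝ) (ξf : ℕ → Fin n → Ω → Sf) (ξg : ℕ → Fin n → Ω → Sg)
    (S D H : ℕ → Fin n → Ω → St dx dy) : Prop where
  tracking : ∀ ω, IsTracking W (precond dx dy cl) lam (fun k i => S k i ω) (fun k i => D k i ω)
    (fun k i => H k i ω)
  est : ∀ k i ω, H k i ω = μ k • P.dirA i (S k i ω) + P.dirB γ i (S k i ω)
    + runNoise P μ ξf ξg S k i ω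
  init : ∃ s₀ : Fin n → St dx dy, ∀ i ω, S 0 i ω = s₀ i

theorem IsRandomRun.isEstimator (hR : IsRandomRun P W γ cl lam μ ξf ξg S D H)
    (hS : Smooth P L₁ L₂) (hL₁ : 0 < L₁) (hL₂ : 0 < L₂) (hγ : 0 < γ) (ω : Ω) :
    IsEstimator μ P.dirA (P.dirB γ) (L₁ + (3 * L₂ + 4 / γ)) (fun k i => S k i ω)
      (fun k i => H k i ω) (fun k i => runNoise P μ ξf ξg S k i ω) := by
  have h1 : 0 < 3 * L₂ + 4 / γ := by positivity
  refine ⟨fun k i => hR.est k i ω, fun i u v => ?_, fun i u v => ?_⟩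
  · refine (Problem.norm_dirA_sub_le hS hL₁ i u v).trans ?_
    exact mul_le_mul_of_nonneg_right (by linarith) (norm_nonneg _)
  · refine (Problem.norm_dirB_sub_le hS hL₂ hγ i u v).trans ?_
    exact mul_le_mul_of_nonneg_right (by linarith) (norm_nonneg _)

variable (hS : Smooth P L₁ L₂) (hL₁ : 0 < L₁) (hL₂ : 0 < L₂) (hγ : 0 < γ)
  (hO : Oracle Pr P ξf ξg δf δg) (hμ : SlowDecay μ μ₀)
  (hR : IsRandomRun P W γ cl lam μ ξf ξg S D H)

include hS hO in
theorem measurable_runNoise {k : ℕ} {i : Fin n}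
    (hs : Measurable[m] (S k i)) (ht : Measurable[m] (sample ξf ξg (k, i))) :
    Measurable[m] (runNoise P μ ξf ξg S k i) :=
  measurable_uncurry_comp (N := P.noise (μ k) i) (Problem.measurable_noise hS hO (μ k) i) hs ht

include hS hL₁ hL₂ hγ hO hR

theorem measurable_run_step {k : ℕ}
    (hs : ∀ i, Measurable[m] (S k i)) (ht : ∀ i, Measurable[m] (sample ξf ξg (k, i))) (i : Fin n) :
    Measurable[m] (H k i) := by
  have e : H k i = fun ω => μ k • P.dirA i (S k i ω) + P.dirB γ i (S k i ω)
    + runNoise P μ ξf ξg S k i ω := funext fun ω => hR.est k i ω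
  rw [e]
  exact measurable_vec_add (measurable_vec_add (measurable_vec_smul (μ k)
    (measurable_vec_comp (Problem.norm_dirA_sub_le hS hL₁ i) (hs i)))
    (measurable_vec_comp (Problem.norm_dirB_sub_le hS hL₂ hγ i) (hs i)))
    (measurable_runNoise hS hO (hs i) (ht i))

/-- Iterates at time k see only earlier samples, while estimators and trackers also see those of
iteration k; independence of the fresh noise rests on this offset. -/
theorem measurable_run (k : ℕ) :
    (∀ i, Measurable[sampleAlg ξf ξg {q | q.1 < k}] (S k i)) ∧
    (∀ i, Measurable[sampleAlg ξf ξg {q | q.1 < k + 1}] (H k i)) ∧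
    (∀ i, Measurable[sampleAlg ξf ξg {q | q.1 < k + 1}] (D k i)) := by
  induction k with
  | zero =>
    obtain ⟨s₀, hs₀⟩ := hR.init
    have hs : ∀ (m : MeasurableSpace Ω) i, Measurable[m] (S 0 i) := fun m i => by
      have : S 0 i = fun _ => s₀ i := funext fun ω => hs₀ i ω
      rw [this]; exact measurable_const
    have hH : ∀ i, Measurable[sampleAlg ξf ξg {q | q.1 < 0 + 1}] (H 0 i) :=
      measurable_run_step hS hL₁ hL₂ hγ hO hR (fun i => hs _ i)
        fun i => measurable_sample_sampleAlg (by simp)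
    refine ⟨hs _, hH, fun i => ?_⟩
    have e : D 0 i = fun ω => mix W (fun j => H 0 j ω) i :=
      funext fun ω => congrFun (hR.tracking ω).tracker_zero i
    rw [e]; exact measurable_mix W hH i
  | succ k ih =>
    obtain ⟨ihs, ihH, ihD⟩ := ih
    have hle : sampleAlg ξf ξg {q : ℕ × Fin n | q.1 < k + 1}
        ≤ sampleAlg ξf ξg {q | q.1 < k + 1 + 1} :=
      sampleAlg_mono fun q hq => Nat.lt_succ_of_lt hq
    have hs : ∀ i, Measurable[sampleAlg ξf ξg {q | q.1 < k + 1}] (S (k + 1) i) := fun i => by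
      have e : S (k + 1) i = fun ω => mix W (fun j => S k j ω - lam • precond dx dy cl (D k j ω)) i :=
        funext fun ω => congrFun ((hR.tracking ω).iterate_succ k) i
      have hle' : sampleAlg ξf ξg {q : ℕ × Fin n | q.1 < k} ≤ sampleAlg ξf ξg {q | q.1 < k + 1} :=
        sampleAlg_mono fun q hq => Nat.lt_succ_of_lt hq
      rw [e]
      exact measurable_mix W (fun j => measurable_vec_sub ((ihs j).mono hle' le_rfl)
        (measurable_vec_smul lam (measurable_vec_comp (norm_precond_sub_le cl) (ihD j)))) i
    have hH : ∀ i, Measurable[sampleAlg ξf ξg {q | q.1 < k + 1 + 1}] (H (k + 1) i) :=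
      measurable_run_step hS hL₁ hL₂ hγ hO hR (fun i => (hs i).mono hle le_rfl)
        fun i => measurable_sample_sampleAlg (Nat.lt_succ_self (k + 1))
    refine ⟨hs, hH, fun i => ?_⟩
    have e : D (k + 1) i = fun ω => mix W (fun j => D k j ω + H (k + 1) j ω - H k j ω) i :=
      funext fun ω => congrFun ((hR.tracking ω).tracker_succ k) i
    rw [e]
    exact measurable_mix W (fun j => measurable_vec_sub
      (measurable_vec_add ((ihD j).mono hle le_rfl) (hH j)) ((ihH j).mono hle le_rfl)) i

include hμ

theorem runNoise_memLp (k : ℕ) (i : Fin n) :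
    MemLp (runNoise P μ ξf ξg S k i) 2 Pr ∧ ∫ ω, ‖runNoise P μ ξf ξg S k i ω‖ ^ 2 ∂Pr
      ≤ 3 * (μ₀ ^ 2 * δf ^ 2 + δg ^ 2 + δg ^ 2) :=
  noise_memLp (N := P.noise (μ k) i) (z := S k i) (ξ := sample ξf ξg (k, i))
    (hO.sampleAlg_le {q | q.1 < k}) (hO.measurable_sample (k, i))
    (hO.indep_sampleAlg (Q := {q | q.1 < k}) (q := (k, i)) fun h => lt_irrefl k h) ((measurable_run hS hL₁ hL₂ hγ hO hR k).1 i)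
    (Problem.measurable_noise hS hO (μ k) i) (by positivity)
    (Problem.lintegral_noise_le hS hO (hμ.nonneg k) (hμ.le k) k i)

/-- The test vector may depend on every sample other than (k, i). This covers functions of the past
and the noise of other agents in the same iteration at once. -/
theorem integral_inner_runNoise {k : ℕ} {i : Fin n} {φ : Ω → St dx dy}
    (hφ : Measurable[sampleAlg ξf ξg {q | q ≠ (k, i)}] φ) (hφ2 : MemLp φ 2 Pr) :
    ∫ ω, inner ℝ (φ ω) (runNoise P μ ξf ξg S k i ω) ∂Pr = 0 := by
  have hle : sampleAlg ξf ξg {q : ℕ × Fin n | q.1 < k} ≤ sampleAlg ξf ξg {q | q ≠ (k, i)} :=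
    sampleAlg_mono fun q hq h => by
      have h1 : q.1 < k := hq
      rw [h] at h1
      exact lt_irrefl _ h1
  exact integral_inner_noise_eq_zero (N := P.noise (μ k) i) (z := S k i)
    (ξ := sample ξf ξg (k, i)) (hO.sampleAlg_le {q | q ≠ (k, i)})
    (hO.measurable_sample (k, i))
    (hO.indep_sampleAlg (Q := {q | q ≠ (k, i)}) (q := (k, i)) fun h => h rfl)
    (((measurable_run hS hL₁ hL₂ hγ hO hR k).1 i).mono hle le_rfl)
    (Problem.measurable_noise hS hO (μ k) i) (by positivity)
    (Problem.lintegral_noise_le hS hO (hμ.nonneg k) (hμ.le k) k i)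
    (Problem.integral_noise_eq_zero hS hO (μ k) k i) hφ hφ2

theorem memLp_run_estimator {k : ℕ} (hs : ∀ i, MemLp (S k i) 2 Pr) (i : Fin n) :
    MemLp (H k i) 2 Pr := by
  have e : H k i = fun ω => μ k • P.dirA i (S k i ω) + P.dirB γ i (S k i ω)
    + runNoise P μ ξf ξg S k i ω := funext fun ω => hR.est k i ω
  rw [e]
  exact memLp_vec_add (memLp_vec_add (memLp_vec_smul (μ k)
    (memLp_lipschitz_comp (Problem.norm_dirA_sub_le hS hL₁ i) (hs i)))
    (memLp_lipschitz_comp (Problem.norm_dirB_sub_le hS hL₂ hγ i) (hs i)))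
    (runNoise_memLp hS hL₁ hL₂ hγ hO hμ hR k i).1

/-- The initial points are deterministic and each update is Lipschitz up to square-integrable noise,
so second moments stay finite. -/
theorem memLp_run (k : ℕ) : (∀ i, MemLp (S k i) 2 Pr) ∧ (∀ i, MemLp (D k i) 2 Pr) := by
  induction k with
  | zero =>
    obtain ⟨s₀, hs₀⟩ := hR.init
    have hs : ∀ i, MemLp (S 0 i) 2 Pr := fun i => by
      have : S 0 i = fun _ => s₀ i := funext fun ω => hs₀ i ω
      rw [this]; exact memLp_const _
    refine ⟨hs, fun i => ?_⟩
    have e : D 0 i = fun ω => mix W (fun j => H 0 j ω) i :=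
      funext fun ω => congrFun (hR.tracking ω).tracker_zero i
    rw [e]
    exact memLp_mix W (memLp_run_estimator hS hL₁ hL₂ hγ hO hμ hR hs) i
  | succ k ih =>
    have hs : ∀ i, MemLp (S (k + 1) i) 2 Pr := fun i => by
      have e : S (k + 1) i = fun ω => mix W (fun j => S k j ω - lam • precond dx dy cl (D k j ω)) i :=
        funext fun ω => congrFun ((hR.tracking ω).iterate_succ k) i
      rw [e]
      exact memLp_mix W (fun j => memLp_vec_sub (ih.1 j)
        (memLp_vec_smul lam (memLp_lipschitz_comp (norm_precond_sub_le cl) (ih.2 j)))) i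
    refine ⟨hs, fun i => ?_⟩
    have e : D (k + 1) i = fun ω => mix W (fun j => D k j ω + H (k + 1) j ω - H k j ω) i :=
      funext fun ω => congrFun ((hR.tracking ω).tracker_succ k) i
    rw [e]
    exact memLp_mix W (fun j => memLp_vec_sub (memLp_vec_add (ih.2 j)
      (memLp_run_estimator hS hL₁ hL₂ hγ hO hμ hR hs j))
      (memLp_run_estimator hS hL₁ hL₂ hγ hO hμ hR ih.1 j)) i

theorem integral_norm_mean_noise_le (hn : 0 < n) (k : ℕ) :
    ∫ ω, ‖mean fun i => runNoise P μ ξf ξg S k i ω‖ ^ 2 ∂Pr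
      ≤ 3 * (μ₀ ^ 2 * δf ^ 2 + δg ^ 2 + δg ^ 2) / n := by
  refine integral_norm_mean_sq_le hn (fun i => (runNoise_memLp hS hL₁ hL₂ hγ hO hμ hR k i).1)
    (fun i => (runNoise_memLp hS hL₁ hL₂ hγ hO hμ hR k i).2) fun i j hij => ?_
  -- The noise of agent i uses the past and sample (k, i) only, so it is an admissible test vector
  -- for agent j.
  refine integral_inner_runNoise hS hL₁ hL₂ hγ hO hμ hR ?_
    (runNoise_memLp hS hL₁ hL₂ hγ hO hμ hR k i).1
  refine measurable_runNoise hS hO ?_ (measurable_sample_sampleAlg ?_)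
  · refine ((measurable_run hS hL₁ hL₂ hγ hO hR k).1 i).mono (sampleAlg_mono fun q hq h => ?_) le_rfl
    have h1 : q.1 < k := hq
    rw [h] at h1
    exact lt_irrefl _ h1
  · intro h
    exact hij (Prod.mk.inj h).2

/-- The preconditioner is self-adjoint and moves onto the gradient, which depends only on the past;
each agent's noise is then orthogonal to it. -/
theorem integral_inner_mean_noise {dU : St dx dy → St dx dy} {L : ℝ}
    (hdU : ∀ u v, ‖dU u - dU v‖ ≤ L * ‖u - v‖) (k : ℕ) :
    Integrable (fun ω => inner ℝ (dU (mean fun i => S k i ω))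
      (precond dx dy cl (mean fun i => runNoise P μ ξf ξg S k i ω))) Pr ∧
    ∫ ω, inner ℝ (dU (mean fun i => S k i ω))
      (precond dx dy cl (mean fun i => runNoise P μ ξf ξg S k i ω)) ∂Pr = 0 := by
  have hs := (memLp_run hS hL₁ hL₂ hγ hO hμ hR k).1
  have hν := fun i => (runNoise_memLp hS hL₁ hL₂ hγ hO hμ hR k i).1
  have hd : MemLp (fun ω => dU (mean fun i => S k i ω)) 2 Pr :=
    memLp_lipschitz_comp hdU (memLp_mean hs)
  have hφ : MemLp (fun ω => precond dx dy cl (dU (mean fun i => S k i ω))) 2 Pr :=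
    memLp_lipschitz_comp (norm_precond_sub_le cl) hd
  refine ⟨integrable_inner hd (memLp_lipschitz_comp (norm_precond_sub_le cl) (memLp_mean hν)), ?_⟩
  have e : ∀ ω, inner ℝ (dU (mean fun i => S k i ω))
      (precond dx dy cl (mean fun i => runNoise P μ ξf ξg S k i ω))
      = (n : ℝ)⁻¹ * ∑ i, inner ℝ (precond dx dy cl (dU (mean fun i => S k i ω)))
        (runNoise P μ ξf ξg S k i ω) := fun ω => by
    rw [inner_precond_right, inner_mean]
  simp_rw [e]
  rw [integral_const_mul, integral_finsetSum _ fun i _ => integrable_inner hφ (hν i)]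
  refine mul_eq_zero_of_right _ (Finset.sum_eq_zero fun i _ => ?_)
  refine integral_inner_runNoise hS hL₁ hL₂ hγ hO hμ hR ?_ hφ
  refine measurable_vec_comp (norm_precond_sub_le cl) (measurable_vec_comp hdU ?_)
  refine measurable_mean fun j => ((measurable_run hS hL₁ hL₂ hγ hO hR k).1 j).mono
    (sampleAlg_mono fun q hq h => ?_) le_rfl
  have h1 : q.1 < k := hq
  rw [h] at h1
  exact lt_irrefl _ h1

end RandomRun

/-! ### Bound along one sample path -/

/-- The total dissipation of a gradient tracking method along one path of the noise. -/
theorem exists_sum_dissipation_bound {c c₁ c₄ M L μ₀ : ℝ} (hc : 0 ≤ c) (hc₁ : 0 < c₁)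
    (hc₄ : 0 < c₄) (hM : 0 ≤ M) :
    ∃ C : ℝ, 1 ≤ C ∧ ∀ {n : ℕ} {V : Type*} [NormedAddCommGroup V] [InnerProductSpace ℝ V]
      {W : Matrix (Fin n) (Fin n) ℝ} {Λ : V →ₗ[ℝ] V} {lam ρ : ℝ} {s D H : ℕ → Fin n → V}
      {A B : Fin n → V → V} {ν : ℕ → Fin n → V} {μ : ℕ → ℝ} {U : ℕ → V → ℝ} {dU : ℕ → V → V}
      {Γ : ℕ → V → ℝ}, IsTracking W Λ lam s D H → Mixes W V ρ → (∀ v, ‖Λ v‖ ^ 2 ≤ c * ‖v‖ ^ 2) →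
      IsEstimator μ A B L s H ν → SlowDecay μ μ₀ → IsLyapunov μ A B Λ U dU Γ c₁ c₄ M →
      0 < lam → C * lam ≤ (1 - ρ) ^ 2 → ∀ m : ℕ,
      lam * ∑ k ∈ Finset.range (m + 1), Γ k (mean (s k)) ≤ 4 / c₁ * (U 0 (mean (s 0))
          - lam * ∑ k ∈ Finset.range (m + 1), inner ℝ (dU k (mean (s k))) (Λ (mean (ν k))))
        + C * (lam * (dev (s 0) / (1 - ρ) + lam ^ 2 / (1 - ρ) ^ 4 * (dev (D 0)
          + ∑ k ∈ Finset.range (m + 1), msq (ν k)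
          + μ₀ ^ 2 * dev (mix W fun i => A i (mean (s 0)))))
          + lam ^ 2 * ∑ k ∈ Finset.range (m + 1), ‖mean (ν k)‖ ^ 2) := by
  obtain ⟨C, hC1, hC⟩ := exists_combined_bound (K := L * (1 + μ₀)) hc hc₁ hc₄ hM
    (by positivity : 0 ≤ 2 * c + 4 * c * (16 + 48 * (L * (1 + μ₀)) ^ 2))
    (by positivity : 0 ≤ (L * (1 + μ₀)) ^ 2 * (c₄ * c / c₁ + 3 * M * c))
  refine ⟨C, hC1, fun {n V} _ _ {W Λ lam ρ s D H A B ν μ U dU Γ} h hW hΛ hH hμ hU hlam hClam m => ?_⟩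
  have ha : 0 < 1 - ρ := by linarith [hW.lt_one]
  have ha1 : 1 - ρ ≤ 1 := by linarith [hW.nonneg]
  refine hC lam (1 - ρ) _ _ (∑ k ∈ Finset.range (m + 1), dev (s k)) _
    (∑ k ∈ Finset.range (m + 1), ‖mean (s (k + 1)) - mean (s k)‖ ^ 2) _ _ _ _ hlam ha ha1 hClam
    (dev_nonneg _) (dev_nonneg _)
    (Finset.sum_nonneg fun _ _ => dev_nonneg _)
    (mul_nonneg (sq_nonneg _) (dev_nonneg _))
    (Finset.sum_nonneg fun k _ => ?_) (Finset.sum_nonneg fun _ _ => sq_nonneg _)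
    (Finset.sum_le_sum fun k _ => norm_mean_sq_le hW.pos _)
    (h.sum_dev_le hW hΛ hc hH hμ m) ?_ fun h1 h2 => h.sum_descent hW hΛ hc hH hμ hU hc₁ hc₄ hM
      hlam h1 h2 (m + 1)
  · exact nonneg_of_mul_nonneg_right ((sq_nonneg _).trans (hU.norm_drift k _)) hc₄
  · rw [Finset.mul_sum, Finset.mul_sum, ← Finset.sum_add_distrib, ← Finset.sum_add_distrib,
      Finset.mul_sum]
    exact Finset.sum_le_sum fun k _ => h.move_le hW hΛ hc hH hμ hU k

/-! ### Dispersion of the upper-level gradients at the start -/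

/-- The linear map `((x, y), θ) ↦ ((x, y - θ), 0)`. -/
def fold (dx dy : ℕ) : St dx dy →ₗ[ℝ] St dx dy where
  toFun s := st (pt s.fst.fst (s.fst.snd - s.snd)) 0
  map_add' s t := st_ext (pt_ext (by simp) (by simp; abel)) (by simp)
  map_smul' c s := st_ext (pt_ext (by simp) (by simp [smul_sub])) (by simp)

/-- The linear map `((x, y), θ) ↦ y - θ`. -/
def gap (dx dy : ℕ) : St dx dy →ₗ[ℝ] Vec dy where
  toFun s := s.fst.snd - s.snd
  map_add' s t := by simp; abel
  map_smul' c s := by simp [smul_sub]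

theorem gap_apply {dx dy : ℕ} (s : St dx dy) : gap dx dy s = s.fst.snd - s.snd := rfl

theorem norm_gap_sq_le {dx dy : ℕ} (s : St dx dy) : ‖gap dx dy s‖ ^ 2 ≤ 2 * ‖s‖ ^ 2 := by
  rw [norm_sq_st, norm_sq_pt]
  have h : ‖gap dx dy s‖ ≤ ‖s.fst.snd‖ + ‖s.snd‖ := norm_sub_le _ _
  nlinarith [norm_nonneg (gap dx dy s), sq_nonneg (‖s.fst.snd‖ - ‖s.snd‖), sq_nonneg ‖s.fst.fst‖]

theorem norm_fold_sq_le {dx dy : ℕ} (s : St dx dy) : ‖fold dx dy s‖ ^ 2 ≤ 2 * ‖s‖ ^ 2 := by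
  rw [norm_sq_st, norm_sq_pt, norm_sq_st s, norm_sq_pt s.fst]
  simp only [fold, LinearMap.coe_mk, AddHom.coe_mk, st_fst, st_snd, pt_fst, pt_snd, norm_zero]
  have h := norm_sub_le s.fst.snd s.snd
  nlinarith [norm_nonneg (s.fst.snd - s.snd), sq_nonneg (‖s.fst.snd‖ - ‖s.snd‖),
    sq_nonneg ‖s.fst.fst‖]

namespace Problem

variable {n dx dy : ℕ} {Sf Sg : Type*} {P : Problem n dx dy Sf Sg} {L₁ L₂ γ Lθ : ℝ}

theorem fold_dirA (i : Fin n) (s : St dx dy) : fold dx dy (P.dirA i s) = P.dirA i s :=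
  st_ext (pt_ext (by simp [fold, dirA]) (by simp [fold, dirA])) (by simp [fold, dirA])

/-- The y- and θ-directions carry the same proximal term, so their difference cancels it and leaves
a difference of ∇g_i at points y - θ apart. This bounds the folded direction without any bound on
∇g_i. -/
theorem fold_dirB (γ : ℝ) (i : Fin n) (s : St dx dy) :
    fold dx dy (P.dirB γ i s) = st (∇ (P.g i) s.fst - ∇ (P.g i) (pt s.fst.fst s.snd)) 0 := by
  refine st_ext (pt_ext ?_ ?_) ?_
  · simp [fold, dirB]
  · simp only [fold, dirB, LinearMap.coe_mk, AddHom.coe_mk, st_fst, st_snd, pt_snd, WithLp.sub_snd]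
    module
  · simp [fold]

theorem norm_fold_dirB_le (hS : Smooth P L₁ L₂) (γ : ℝ) (i : Fin n) (s : St dx dy) :
    ‖fold dx dy (P.dirB γ i s)‖ ≤ L₂ * ‖gap dx dy s‖ := by
  rw [fold_dirB, st, WithLp.norm_toLp_fst]
  refine (hS.smooth_g i _ _).trans (le_of_eq ?_)
  have e : s.fst - pt s.fst.fst s.snd = pt 0 (gap dx dy s) :=
    pt_ext (by simp) (by simp [gap_apply])
  rw [e, pt, WithLp.norm_toLp_snd]

/-- The dispersion of the upper-level gradients is controlled by the first trackers. -/
theorem dev_mix_dirA_le (hn : 0 < n) (hS : Smooth P L₁ L₂) (hL₁ : 0 < L₁)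
    {W : Matrix (Fin n) (Fin n) ℝ} {ρ : ℝ} (hW : Mixes W (St dx dy) ρ) {μ₀ : ℝ}
    {s H ν : Fin n → St dx dy} (hH : ∀ i, H i = μ₀ • P.dirA i (s i) + P.dirB γ i (s i) + ν i) :
    μ₀ ^ 2 * dev (mix W fun i => P.dirA i (mean s)) ≤ 4 * dev (mix W H)
      + 6 * (L₂ ^ 2 * (2 * dev s + ‖gap dx dy (mean s)‖ ^ 2) + 2 * msq ν
        + μ₀ ^ 2 * L₁ ^ 2 * dev s) := by
  -- Folding leaves `dirA` unchanged, so μ₀ A_i at the average is the folded estimator minus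
  -- lower-level differences, noise and a Lipschitz error.
  set R : Fin n → St dx dy := (fun i => fold dx dy (P.dirB γ i (s i))) + (fun i => fold dx dy (ν i))
    + fun i => μ₀ • (P.dirA i (s i) - P.dirA i (mean s)) with hR
  have e : (μ₀ • fun i => P.dirA i (mean s)) = (fun i => fold dx dy (H i)) - R := by
    ext1 i
    simp only [hR, Pi.smul_apply, Pi.sub_apply, Pi.add_apply, hH, map_add, map_smul, fold_dirA]
    module
  have h1 : dev (mix W R) ≤ 3 * (L₂ ^ 2 * (2 * dev s + ‖gap dx dy (mean s)‖ ^ 2) + 2 * msq ν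
      + μ₀ ^ 2 * L₁ ^ 2 * dev s) := by
    have g1 : msq (fun i => fold dx dy (P.dirB γ i (s i)))
        ≤ L₂ ^ 2 * (2 * dev s + ‖gap dx dy (mean s)‖ ^ 2) := by
      have : msq (fun i => fold dx dy (P.dirB γ i (s i))) ≤ L₂ ^ 2 * msq fun i => gap dx dy (s i) :=
        msq_mono fun i => by
          rw [← mul_pow]
          exact pow_le_pow_left₀ (norm_nonneg _) (norm_fold_dirB_le hS γ i (s i)) 2
      refine this.trans (mul_le_mul_of_nonneg_left ?_ (sq_nonneg _))
      rw [msq_eq hn, mean_map]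
      gcongr
      exact dev_map_le _ norm_gap_sq_le s
    have g2 : msq (fun i => fold dx dy (ν i)) ≤ 2 * msq ν := msq_mono fun i => norm_fold_sq_le _
    have g3 : msq (fun i => μ₀ • (P.dirA i (s i) - P.dirA i (mean s))) ≤ μ₀ ^ 2 * L₁ ^ 2 * dev s :=
      msq_mono fun i => by
        rw [norm_smul, mul_pow, mul_assoc, ← mul_pow L₁, Real.norm_eq_abs, sq_abs]
        gcongr
        exact norm_dirA_sub_le hS hL₁ i _ _
    refine ((hW.dev_mix_le R).trans (dev_le_msq hn R)).trans ?_
    have g4 : msq R ≤ 3 * (msq (fun i => fold dx dy (P.dirB γ i (s i)))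
        + msq (fun i => fold dx dy (ν i)) + msq fun i => μ₀ • (P.dirA i (s i) - P.dirA i (mean s))) := by
      unfold msq
      rw [← mul_add, ← mul_add, mul_left_comm, ← Finset.sum_add_distrib, ← Finset.sum_add_distrib,
        Finset.mul_sum _ _ (3 : ℝ)]
      exact mul_le_mul_of_nonneg_left (Finset.sum_le_sum fun i _ => norm_add₃_sq_le _ _ _)
        (by positivity)
    linarith
  have h2 : dev (mix W fun i => fold dx dy (H i)) ≤ 2 * dev (mix W H) := by
    rw [mix_map]
    exact dev_map_le _ norm_fold_sq_le _
  have h3 := dev_add_le (mix W fun i => fold dx dy (H i)) ((-1 : ℝ) • mix W R)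
  rw [dev_smul, neg_one_smul, ← sub_eq_add_neg, ← mix_sub, ← e, mix_smul, dev_smul] at h3
  linarith

section

variable (hn : 0 < n) (hS : Smooth P L₁ L₂) (hL₂ : 0 < L₂) (hγ : 0 < γ)
  (hγL : γ < 1 / (2 * L₂))
include hn hS hL₂ hγ hγL

/-- Bound of the terms that depend on the initial average. -/
theorem lyap_le_and_norm_gap_sq_le {Flow μ B : ℝ} (hμ : 0 ≤ μ) (hF : ∀ z, Flow ≤ P.F z)
    {s : St dx dy}
    (h₁ : μ * (P.F s.fst - Flow) + P.G s.fst - P.V γ s.fst ≤ B)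
    (h₂ : ‖s.snd - P.thetaStar γ s.fst‖ ^ 2 ≤ B) :
    P.lyap γ Flow μ s ≤ B + (L₂ + 1 / γ) * B ∧
      ‖gap dx dy s‖ ^ 2 ≤ 2 * (B / (1 / (2 * γ) - L₂) + B) := by
  have hM : 0 < L₂ + 1 / γ := by positivity
  have h3 := proxObj_sub_V_le hn hS hL₂ hγ hγL s.fst s.snd
  have h4 := le_G_sub_V hn hS hL₂ hγ hγL s.fst
  have h5 := mul_nonneg hμ (sub_nonneg.2 (hF s.fst))
  have h6 := mul_le_mul_of_nonneg_left h₂ hM.le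
  have hm := prox_modulus_pos hn hS hL₂ hγ hγL
  constructor
  · simp only [lyap]
    linarith
  · have h7 : ‖s.fst.snd - P.thetaStar γ s.fst‖ ^ 2 ≤ B / (1 / (2 * γ) - L₂) := by
      rw [le_div_iff₀ hm]
      linarith
    have e : gap dx dy s = (s.fst.snd - P.thetaStar γ s.fst) - (s.snd - P.thetaStar γ s.fst) := by
      rw [gap_apply, sub_sub_sub_cancel_right]
    rw [e]
    have h8 := norm_sub_le (s.fst.snd - P.thetaStar γ s.fst) (s.snd - P.thetaStar γ s.fst)
    nlinarith [norm_nonneg ((s.fst.snd - P.thetaStar γ s.fst) - (s.snd - P.thetaStar γ s.fst)),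
      sq_nonneg (‖s.fst.snd - P.thetaStar γ s.fst‖ - ‖s.snd - P.thetaStar γ s.fst‖)]

end

end Problem

/-! ### Bound in expectation -/

section Expectation

variable {n dx dy : ℕ} {Sf Sg Ω : Type*} [MeasurableSpace Sf] [MeasurableSpace Sg]
  [MeasurableSpace Ω] {Pr : Measure Ω} [IsProbabilityMeasure Pr] {P : Problem n dx dy Sf Sg}
  {W : Matrix (Fin n) (Fin n) ℝ} {ξf : ℕ → Fin n → Ω → Sf} {ξg : ℕ → Fin n → Ω → Sg}
  {δf δg L₁ L₂ γ Lθ cl lam μ₀ Flow : ℝ} {μ : ℕ → ℝ} {S D H : ℕ → Fin n → Ω → St dx dy}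

namespace Problem

theorem gPsi_lipschitz (hn : 0 < n) (hS : Smooth P L₁ L₂) (hL₁ : 0 < L₁) (hL₂ : 0 < L₂)
    (hγ : 0 < γ) (hγL : γ < 1 / (2 * L₂))
    (hθ : ∀ z z', ‖P.thetaStar γ z - P.thetaStar γ z'‖ ≤ Lθ * ‖z - z'‖) (μ : ℝ) :
    ∃ L, ∀ s t : St dx dy, ‖P.gPsi γ μ s.fst - P.gPsi γ μ t.fst‖ ≤ L * ‖s - t‖ := by
  refine ⟨_, fun s t => ((hasQuadGrad_Psi hn hS hL₁ hL₂ hγ hγL hθ μ).lipschitz _ _).trans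
    (mul_le_mul_of_nonneg_left (WithLp.norm_fst_le _ (s - t)) (by positivity))⟩

end Problem

theorem integral_le_of_le_affine {Ω : Type*} [MeasurableSpace Ω] {Pr : Measure Ω}
    [IsProbabilityMeasure Pr] {f f₁ f₂ f₃ f₄ f₅ : Ω → ℝ} (hf : Integrable f Pr)
    (h₁ : Integrable f₁ Pr) (h₂ : Integrable f₂ Pr) (h₃ : Integrable f₃ Pr) (h₄ : Integrable f₄ Pr)
    (h₅ : Integrable f₅ Pr) {c c₁ c₂ c₃ c₄ c₅ : ℝ}
    (h : ∀ ω, f ω ≤ c + (c₁ * f₁ ω + (c₂ * f₂ ω + (c₃ * f₃ ω + (c₄ * f₄ ω + c₅ * f₅ ω))))) :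
    ∫ ω, f ω ∂Pr ≤ c + (c₁ * ∫ ω, f₁ ω ∂Pr + (c₂ * ∫ ω, f₂ ω ∂Pr + (c₃ * ∫ ω, f₃ ω ∂Pr
      + (c₄ * ∫ ω, f₄ ω ∂Pr + c₅ * ∫ ω, f₅ ω ∂Pr)))) := by
  have i₅ := h₅.const_mul c₅
  have i₄ := (h₄.const_mul c₄).add i₅
  have i₃ := (h₃.const_mul c₃).add i₄
  have i₂ := (h₂.const_mul c₂).add i₃
  have i₁ := (h₁.const_mul c₁).add i₂
  have i₀ := (integrable_const (μ := Pr) c).add i₁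
  refine (integral_mono hf i₀ h).trans (le_of_eq ?_)
  rw [integral_add' (integrable_const c) i₁, integral_add' (h₁.const_mul c₁) i₂,
    integral_add' (h₂.const_mul c₂) i₃, integral_add' (h₃.const_mul c₃) i₄,
    integral_add' (h₄.const_mul c₄) i₅]
  simp only [integral_const_mul, integral_const, probReal_univ, one_smul]

/-- Expectation of a bound along sample paths. -/
theorem sum_integral_le_of_path {Ω : Type*} [MeasurableSpace Ω] {Pr : Measure Ω}
    [IsProbabilityMeasure Pr] {G I N A : ℕ → Ω → ℝ} {T : Ω → ℝ} {lam a b C U B Z σ2 : ℝ} {n K : ℕ}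
    (hlam : 0 < lam) (ha : 0 < a) (hC : 0 ≤ C) (hU : 0 ≤ b * U) (hB : 0 ≤ B) (hZ : 0 ≤ Z)
    (hσ : 0 ≤ σ2) (hK : 0 < K) (iG : ∀ k, Integrable (G k) Pr)
    (iI : ∀ k, Integrable (I k) Pr ∧ ∫ ω, I k ω ∂Pr = 0) (iT : Integrable T Pr)
    (eT : ∫ ω, T ω ∂Pr ≤ B) (iN : ∀ k, Integrable (N k) Pr) (eN : ∀ k, ∫ ω, N k ω ∂Pr ≤ σ2)
    (iA : ∀ k, Integrable (A k) Pr) (eA : ∀ k, ∫ ω, A k ω ∂Pr ≤ σ2 / n)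
    (path : ∀ ω, lam * ∑ k ∈ Finset.range K, G k ω
      ≤ b * (U - lam * ∑ k ∈ Finset.range K, I k ω)
        + C * (lam * (B / a + lam ^ 2 / a ^ 4 * (T ω + ∑ k ∈ Finset.range K, N k ω
          + (4 * T ω + 6 * (Z + 2 * N 0 ω)))) + lam ^ 2 * ∑ k ∈ Finset.range K, A k ω)) :
    lam * ∑ k ∈ Finset.range K, ∫ ω, G k ω ∂Pr
      ≤ (b * U + C * (1 + B + (5 * B + σ2 + 6 * (Z + 2 * σ2)) + σ2))
        * (1 + lam / a + lam ^ 3 * K / a ^ 4 + lam ^ 2 * K / n) := by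
  set r := lam ^ 2 / a ^ 4 with hr
  have hr0 : 0 ≤ r := by positivity
  have path' : ∀ ω, lam * ∑ k ∈ Finset.range K, G k ω
      ≤ (b * U + C * (lam * (B / a + r * (6 * Z))))
        + (-(b * lam) * (∑ k ∈ Finset.range K, I k ω) + (C * (lam * r) * 5 * T ω
        + (C * (lam * r) * (∑ k ∈ Finset.range K, N k ω) + (C * (lam * r) * 12 * N 0 ω
        + C * lam ^ 2 * ∑ k ∈ Finset.range K, A k ω)))) := fun ω =>
    (path ω).trans (le_of_eq (by ring))
  have key := integral_le_of_le_affine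
    ((integrable_finsetSum (Finset.range K) fun k _ => iG k).const_mul lam)
    (integrable_finsetSum (Finset.range K) fun k _ => (iI k).1) iT
    (integrable_finsetSum (Finset.range K) fun k _ => iN k) (iN 0)
    (integrable_finsetSum (Finset.range K) fun k _ => iA k) path'
  rw [integral_const_mul, integral_finsetSum _ fun k _ => iG k,
    integral_finsetSum _ fun k _ => (iI k).1, integral_finsetSum _ fun k _ => iN k,
    integral_finsetSum _ fun k _ => iA k, Finset.sum_eq_zero fun k _ => (iI k).2] at key
  have sN : ∑ k ∈ Finset.range K, ∫ ω, N k ω ∂Pr ≤ K * σ2 := by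
    refine (Finset.sum_le_sum fun k _ => eN k).trans (le_of_eq ?_)
    simp
  have sA : ∑ k ∈ Finset.range K, ∫ ω, A k ω ∂Pr ≤ K * (σ2 / n) := by
    refine (Finset.sum_le_sum fun k _ => eA k).trans (le_of_eq ?_)
    simp
  refine key.trans ?_
  have hK1 : (1 : ℝ) ≤ K := by exact_mod_cast hK
  have hlr : 0 ≤ C * (lam * r) := by positivity
  have b1 := mul_le_mul_of_nonneg_left eT (by positivity : 0 ≤ C * (lam * r) * 5)
  have b2 := mul_le_mul_of_nonneg_left sN hlr
  have b3 := mul_le_mul_of_nonneg_left (eN 0) (by positivity : 0 ≤ C * (lam * r) * 12)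
  have b4 := mul_le_mul_of_nonneg_left sA (by positivity : 0 ≤ C * lam ^ 2)
  have hx₁ : 0 ≤ lam / a := by positivity
  have hx₂ : 0 ≤ lam ^ 3 * K / a ^ 4 := by positivity
  have hx₃ : 0 ≤ lam ^ 2 * K / n := by positivity
  have f1 : C * (lam * (B / a)) = C * B * (lam / a) := by ring
  have f2 : C * lam ^ 2 * (K * (σ2 / n)) = C * σ2 * (lam ^ 2 * K / n) := by ring
  -- Terms occurring once per run are absorbed, by K ≥ 1, into the term proportional to K.
  have f3 : C * (lam * r) * (5 * B + 6 * (Z + 2 * σ2))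
      ≤ C * (lam * r) * (5 * B + 6 * (Z + 2 * σ2)) * K :=
    le_mul_of_one_le_right (by positivity) hK1
  have f4 : lam ^ 3 * K / a ^ 4 = lam * r * K := by rw [hr]; ring
  have g0 : 0 ≤ C * B := by positivity
  have g1 : 0 ≤ C * σ2 := by positivity
  have g2 : 0 ≤ C * Z := by positivity
  set k := b * U + C * (1 + B + (5 * B + σ2 + 6 * (Z + 2 * σ2)) + σ2) with hk
  have k0 : b * U * 1 ≤ k * 1 := by rw [hk]; gcongr; linarith
  have k1 : C * B * (lam / a) ≤ k * (lam / a) := by gcongr; rw [hk]; linarith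
  have k2 : C * (5 * B + σ2 + 6 * (Z + 2 * σ2)) * (lam ^ 3 * K / a ^ 4)
      ≤ k * (lam ^ 3 * K / a ^ 4) := by gcongr; rw [hk]; linarith
  have k3 : C * σ2 * (lam ^ 2 * K / n) ≤ k * (lam ^ 2 * K / n) := by gcongr; rw [hk]; linarith
  rw [f4] at k2 ⊢
  linarith

/-- Total expected dissipation of a random run. -/
theorem exists_sum_integral_le {L₁ L₂ γ Lθ cl μ₀ B : ℝ} (δf δg : ℝ) (hL₁ : 0 < L₁) (hL₂ : 0 < L₂)
    (hγ : 0 < γ) (hγL : γ < 1 / (2 * L₂)) (hcl : 0 < cl)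
    (hcl' : cl ≤ (1 / γ - L₂) / (32 * a₁ L₂ γ Lθ * Lθ ^ 2)) (hμ₀ : 0 < μ₀) (hB : 0 ≤ B) :
    ∃ C : ℝ, 1 ≤ C ∧ ∀ {n dx dy : ℕ} {Sf Sg Ω : Type*} [MeasurableSpace Sf] [MeasurableSpace Sg]
      [MeasurableSpace Ω] {Pr : Measure Ω} [IsProbabilityMeasure Pr] {P : Problem n dx dy Sf Sg}
      {W : Matrix (Fin n) (Fin n) ℝ} {ξf : ℕ → Fin n → Ω → Sf} {ξg : ℕ → Fin n → Ω → Sg}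
      {lam ρ Flow : ℝ} {μ : ℕ → ℝ} {S D H : ℕ → Fin n → Ω → St dx dy},
      Smooth P L₁ L₂ → Oracle Pr P ξf ξg δf δg → (∀ z, Flow ≤ P.F z) →
      (∀ z z', ‖P.thetaStar γ z - P.thetaStar γ z'‖ ≤ Lθ * ‖z - z'‖) →
      Mixes W (St dx dy) ρ → SlowDecay μ μ₀ → IsRandomRun P W γ cl lam μ ξf ξg S D H →
      (∀ ω, μ₀ * (P.F (mean fun i => S 0 i ω).fst - Flow) + P.G (mean fun i => S 0 i ω).fst
        - P.V γ (mean fun i => S 0 i ω).fst ≤ B) →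
      (∀ ω, ‖(mean fun i => S 0 i ω).snd
        - P.thetaStar γ (mean fun i => S 0 i ω).fst‖ ^ 2 ≤ B) →
      (∀ ω, dev (fun i => S 0 i ω) ≤ B) → ∫ ω, dev (fun i => D 0 i ω) ∂Pr ≤ B →
      0 < lam → C * lam ≤ (1 - ρ) ^ 2 → ∀ K : ℕ, 0 < K →
      lam * ∑ k ∈ Finset.range K, ∫ ω, ‖P.gPsi γ (μ k) (mean fun i => S k i ω).fst‖ ^ 2 ∂Pr
        ≤ C * (1 + lam / (1 - ρ) + lam ^ 3 * K / (1 - ρ) ^ 4 + lam ^ 2 * K / n) := by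
  set M := μ₀ * L₁ + L₂ + (L₂ + 1 / γ) + 2 * ((L₂ + 1 / γ) * (1 + Lθ ^ 2)) with hM
  have hc₁ : 0 < min cl (3 / 4) := lt_min hcl (by norm_num)
  obtain ⟨C, hC1, hC⟩ := exists_sum_dissipation_bound (c := cl ^ 2 + 1) (c₁ := min cl (3 / 4))
    (c₄ := 2 + 1 / (2 * cl)) (M := M) (L := L₁ + (3 * L₂ + 4 / γ)) (μ₀ := μ₀) (by positivity) hc₁
    (by positivity) (by positivity)
  set c₁ := min cl (3 / 4)
  set σ2 := 3 * (μ₀ ^ 2 * δf ^ 2 + δg ^ 2 + δg ^ 2) with hσ2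
  have hσ : 0 ≤ σ2 := by positivity
  have hm : 0 < 1 / (2 * γ) - L₂ := by
    rw [lt_div_iff₀ (by positivity)] at hγL
    rw [sub_pos, lt_div_iff₀ (by positivity)]
    linarith
  set U := B + (L₂ + 1 / γ) * B with hU
  set Y := 2 * (B / (1 / (2 * γ) - L₂) + B) with hY
  have hU0 : 0 ≤ 4 / c₁ * U := by positivity
  have hY0 : 0 ≤ Y := by positivity
  set Z := L₂ ^ 2 * (2 * B + Y) + μ₀ ^ 2 * L₁ ^ 2 * B with hZ
  have hZ0 : 0 ≤ Z := by positivity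
  have hCC : C ≤ 4 / c₁ * U + C * (1 + B + (5 * B + σ2 + 6 * (Z + 2 * σ2)) + σ2) := by
    have h2 : 0 ≤ C * (B + (5 * B + σ2 + 6 * (Z + 2 * σ2)) + σ2) := by positivity
    linarith
  refine ⟨4 / c₁ * U + C * (1 + B + (5 * B + σ2 + 6 * (Z + 2 * σ2)) + σ2), hC1.trans hCC, ?_⟩
  intro n dx dy Sf Sg Ω _ _ _ Pr _ P W ξf ξg lam ρ Flow μ S D H hS hO hF hθ hW hμ hR h₁ h₂ h₃ h₄
    hlam hClam K hK
  have hn := hW.pos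
  have ha : 0 < 1 - ρ := by linarith [hW.lt_one]
  have hClam' : C * lam ≤ (1 - ρ) ^ 2 := (mul_le_mul_of_nonneg_right hCC hlam.le).trans hClam
  have hSk := fun k => (memLp_run hS hL₁ hL₂ hγ hO hμ hR k).1
  have hνk := fun k i => runNoise_memLp hS hL₁ hL₂ hγ hO hμ hR k i
  refine sum_integral_le_of_path
    (I := fun k ω => inner ℝ (P.gLyap γ (μ k) (mean fun i => S k i ω))
      (precond dx dy cl (mean fun i => runNoise P μ ξf ξg S k i ω)))
    (N := fun k ω => msq fun i => runNoise P μ ξf ξg S k i ω)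
    (A := fun k ω => ‖mean fun i => runNoise P μ ξf ξg S k i ω‖ ^ 2)
    (T := fun ω => dev fun i => D 0 i ω) hlam ha (by linarith) hU0 hB hZ0 hσ hK (fun k => ?_)
    (fun k => integral_inner_mean_noise hS hL₁ hL₂ hγ hO hμ hR
      (Problem.hasQuadGrad_lyap hn hS hL₁ hL₂ hγ hγL hθ Flow (μ k)).lipschitz k)
    (integrable_dev (memLp_run hS hL₁ hL₂ hγ hO hμ hR 0).2) h₄
    (fun k => integrable_msq fun i => (hνk k i).1)
    (fun k => integral_msq_le hn (fun i => (hνk k i).1) fun i => (hνk k i).2)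
    (fun k => integrable_norm_sq (memLp_mean fun i => (hνk k i).1))
    (integral_norm_mean_noise_le hS hL₁ hL₂ hγ hO hμ hR hn) fun ω => ?_
  · obtain ⟨L, hL⟩ := Problem.gPsi_lipschitz hn hS hL₁ hL₂ hγ hγL hθ (μ k)
    exact integrable_norm_sq (memLp_lipschitz_comp hL (memLp_mean (hSk k)))
  have hL := Problem.isLyapunov hn hS hL₁ hL₂ hγ hγL hθ hF hcl hcl' hμ
  -- The path bound sums over `range (m + 1)`, so a positive horizon is written as a successor.
  obtain ⟨m, rfl⟩ : ∃ m, K = m + 1 := ⟨K - 1, by omega⟩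
  have h1 := hC (hR.tracking ω) hW (norm_precond_sq_le cl) (hR.isEstimator hS hL₁ hL₂ hγ ω) hμ hL
    hlam hClam' m
  have h2 := Problem.dev_mix_dirA_le hn hS hL₁ hW (s := fun i => S 0 i ω)
    (H := fun i => H 0 i ω) (ν := fun i => runNoise P μ ξf ξg S 0 i ω) (μ₀ := μ₀) (γ := γ)
    fun i => by rw [hR.est 0 i ω, hμ.zero]
  have h3 := Problem.lyap_le_and_norm_gap_sq_le hn hS hL₂ hγ hγL hμ₀.le hF (h₁ ω) (h₂ ω)
  rw [← (hR.tracking ω).tracker_zero] at h2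
  -- The θ-part of the dissipation has done its work and is dropped.
  have h5 : lam * ∑ k ∈ Finset.range (m + 1), ‖P.gPsi γ (μ k) (mean fun i => S k i ω).fst‖ ^ 2
      ≤ lam * ∑ k ∈ Finset.range (m + 1), P.dissip γ (μ k) (mean fun i => S k i ω) :=
    mul_le_mul_of_nonneg_left (Finset.sum_le_sum fun k _ =>
      le_add_of_nonneg_right (sq_nonneg _)) hlam.le
  refine h5.trans (h1.trans ?_)
  rw [hμ.zero]
  have h6 := h3.1
  have h7 : μ₀ ^ 2 * dev (mix W fun i => P.dirA i (mean fun i => S 0 i ω))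
      ≤ 4 * dev (fun i => D 0 i ω)
        + 6 * (Z + 2 * msq fun i => runNoise P μ ξf ξg S 0 i ω) := by
    refine h2.trans ?_
    have e1 := mul_le_mul_of_nonneg_left (h₃ ω) (sq_nonneg L₂)
    have e2 := mul_le_mul_of_nonneg_left h3.2 (sq_nonneg L₂)
    have e3 := mul_le_mul_of_nonneg_left (h₃ ω) (by positivity : 0 ≤ μ₀ ^ 2 * L₁ ^ 2)
    rw [hZ]
    linarith
  have h8 := h₃ ω
  gcongr

end Expectation

/-! ### Rates of SUN-DSBO-GT -/

section GTRun

variable {n dx dy : ℕ} {Sf Sg Ω : Type*} [MeasurableSpace Sf] [MeasurableSpace Sg]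
  [MeasurableSpace Ω] {Pr : Measure Ω} [IsProbabilityMeasure Pr] {P : Problem n dx dy Sf Sg}
  {W : Matrix (Fin n) (Fin n) ℝ} {ξf : ℕ → Fin n → Ω → Sf} {ξg : ℕ → Fin n → Ω → Sg}
  {δf δg L₁ L₂ γ Lθ cl μ₀ p Flow B ρ : ℝ}

/-- The run of SUN-DSBO-GT with constant learning rates on random samples. -/
def randomRun (P : Problem n dx dy Sf Sg) (W : Matrix (Fin n) (Fin n) ℝ) (γ cl lam : ℝ)
    (μ : ℕ → ℝ) (x₀ : Fin n → Vec dx) (y₀ θ₀ : Fin n → Vec dy) (ξf : ℕ → Fin n → Ω → Sf)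
    (ξg : ℕ → Fin n → Ω → Sg) (ω : Ω) : ℕ → GTState n dx dy :=
  gtRun P W γ μ (fun _ => lam) (fun _ => cl * lam) (fun _ => cl * lam) x₀ y₀ θ₀
    (fun j i => ξf j i ω) fun j i => ξg j i ω

theorem isRandomRun_randomRun (lam : ℝ) (μ : ℕ → ℝ) (x₀ : Fin n → Vec dx) (y₀ θ₀ : Fin n → Vec dy) :
    IsRandomRun P W γ cl lam μ ξf ξg
      (fun k i ω => runS (randomRun P W γ cl lam μ x₀ y₀ θ₀ ξf ξg ω) k i)
      (fun k i ω => runD (randomRun P W γ cl lam μ x₀ y₀ θ₀ ξf ξg ω) k i)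
      (fun k i ω => runH (randomRun P W γ cl lam μ x₀ y₀ θ₀ ξf ξg ω) k i) where
  tracking _ := isTracking_gtRun P W γ cl lam μ x₀ y₀ θ₀ _ _ rfl
  est k i _ := runH_eq P W γ μ x₀ y₀ θ₀ _ _ rfl k i
  init := ⟨comb x₀ y₀ θ₀, fun _ _ => rfl⟩

theorem stationarity_eq (hn : 0 < n) (hS : Smooth P L₁ L₂) (hL₁ : 0 < L₁) (hL₂ : 0 < L₂)
    (hγ : 0 < γ) (hγL : γ < 1 / (2 * L₂))
    (hθ : ∀ z z', ‖P.thetaStar γ z - P.thetaStar γ z'‖ ≤ Lθ * ‖z - z'‖)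
    (hO : Oracle Pr P ξf ξg δf δg) (hμ : SlowDecay (penalty μ₀ p) μ₀) (cθ : ℝ)
    (x₀ : Fin n → Vec dx) (y₀ θ₀ : Fin n → Vec dy) (K k : ℕ) :
    stationarity Pr P W γ μ₀ p cθ cl x₀ y₀ θ₀ ξf ξg K k = ENNReal.ofReal (∫ ω,
      ‖P.gPsi γ (penalty μ₀ p k) (mean fun i => runS (randomRun P W γ cl (rateTheta cθ n K)
        (penalty μ₀ p) x₀ y₀ θ₀ ξf ξg ω) k i).fst‖ ^ 2 ∂Pr) := by
  obtain ⟨L, hL⟩ := Problem.gPsi_lipschitz hn hS hL₁ hL₂ hγ hγL hθ (penalty μ₀ p k)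
  have hR := isRandomRun_randomRun (P := P) (W := W) (γ := γ) (cl := cl) (ξf := ξf) (ξg := ξg)
    (rateTheta cθ n K) (penalty μ₀ p) x₀ y₀ θ₀
  rw [← lintegral_enorm_sq_eq (memLp_lipschitz_comp hL
    (memLp_mean (memLp_run hS hL₁ hL₂ hγ hO hμ hR k).1))]
  refine lintegral_congr fun ω => ?_
  rw [((Problem.hasQuadGrad_Psi hn hS hL₁ hL₂ hγ hγL hθ _).hasGradientAt _).gradient]
  congr 4
  exact (congrArg WithLp.fst (mean_comb _ _ _)).symm

/-- `ENNReal.ofReal` truncates at 0, so a bound by `ENNReal.ofReal B` transfers to reals with `max B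
0`. -/
theorem le_max_of_ofReal_le {a b : ℝ} (h : ENNReal.ofReal a ≤ ENNReal.ofReal b) :
    a ≤ max b 0 := by
  rcases (ENNReal.ofReal_le_ofReal_iff').1 h with h | h
  · exact h.trans (le_max_left _ _)
  · exact h.trans (le_max_right _ _)

theorem sum_sqDev_eq (hn : 0 < n) (x : Fin n → Vec dx) (y θ : Fin n → Vec dy) :
    sqDev x + sqDev y + sqDev θ = ENNReal.ofReal (dev (comb x y θ)) := by
  rw [dev_comb, ENNReal.ofReal_add (add_nonneg (dev_nonneg _) (dev_nonneg _)) (dev_nonneg _),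
    ENNReal.ofReal_add (dev_nonneg _) (dev_nonneg _), sqDev_eq hn, sqDev_eq hn, sqDev_eq hn]

/-- The first trackers are computed before any learning rate acts, so the rates `cl` and `lam` on
the right are arbitrary and one bound `B` serves all horizons. -/
theorem initSize_eq (hn : 0 < n) (x₀ : Fin n → Vec dx) (y₀ θ₀ : Fin n → Vec dy) (lam : ℝ) :
    initSize Pr P W γ μ₀ Flow x₀ y₀ θ₀ ξf ξg
      = ENNReal.ofReal (μ₀ * (P.F (mean (comb x₀ y₀ θ₀)).fst - Flow)
          + P.G (mean (comb x₀ y₀ θ₀)).fst - P.V γ (mean (comb x₀ y₀ θ₀)).fst)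
        + ENNReal.ofReal (‖(mean (comb x₀ y₀ θ₀)).snd
          - P.thetaStar γ (mean (comb x₀ y₀ θ₀)).fst‖ ^ 2)
        + ENNReal.ofReal (dev (comb x₀ y₀ θ₀))
        + ∫⁻ ω, ENNReal.ofReal (dev (runD (randomRun P W γ cl lam (penalty μ₀ p) x₀ y₀ θ₀ ξf ξg ω)
          0)) ∂Pr := by
  have hp0 : penalty μ₀ p 0 = μ₀ := by simp [penalty]
  have h0 : ∀ ω, runD (randomRun P W γ cl lam (penalty μ₀ p) x₀ y₀ θ₀ ξf ξg ω) 0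
      = comb (mix W (P.estX μ₀ (fun i => ξf 0 i ω) (fun i => ξg 0 i ω) x₀ y₀ θ₀))
        (mix W (P.estY γ μ₀ (fun i => ξf 0 i ω) (fun i => ξg 0 i ω) x₀ y₀ θ₀))
        (mix W (P.estTheta γ (fun i => ξg 0 i ω) x₀ y₀ θ₀)) := fun ω => by
    simp only [runD, randomRun, gtRun, gtStep, zero_add, sub_zero, hp0]
  simp only [h0]
  rw [initSize, mean_comb, ENNReal.ofReal_pow (norm_nonneg _), ofReal_norm]
  simp only [sum_sqDev_eq hn, st_fst, st_snd]

end GTRun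

/-- Arithmetic of the linear speedup. -/
theorem avg_le_of_sum_le {n K : ℕ} {a C cθ lam E : ℝ} (hn : 0 < n) (ha : 0 < a) (ha1 : a ≤ 1)
    (hC : 0 ≤ C) (hcθ : 0 < cθ) (hlam : lam = rateTheta cθ n K) (hK : (n : ℝ) ^ 3 / a ^ 8 ≤ K)
    (h : lam * E ≤ C * (1 + lam / a + lam ^ 3 * K / a ^ 4 + lam ^ 2 * K / n)) :
    (K : ℝ)⁻¹ * E ≤ C * (1 / cθ + 1 + cθ ^ 2 + cθ) / √((n : ℝ) * K) := by
  have hn1 : (1 : ℝ) ≤ n := by exact_mod_cast hn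
  have hn0 : (0 : ℝ) < n := by linarith
  have hK0 : (0 : ℝ) < K := lt_of_lt_of_le (by positivity) hK
  set q := √((n : ℝ) * K) with hq
  have hq0 : 0 < q := Real.sqrt_pos.2 (by positivity)
  have hq2 : q ^ 2 = n * K := Real.sq_sqrt (by positivity)
  -- In terms of q = √(nK) all four rates become rational in n, K, q and a.
  have hlamq : lam = cθ * n / q := by
    have h1 : √(n : ℝ) * √(n : ℝ) = n := Real.mul_self_sqrt hn0.le
    have h2 : 0 < √(n : ℝ) := Real.sqrt_pos.2 hn0
    have h3 : 0 < √(K : ℝ) := Real.sqrt_pos.2 hK0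
    rw [hlam, rateTheta, hq, Real.sqrt_mul hn0.le, div_eq_div_iff (by positivity) (by positivity)]
    linear_combination cθ * √(K : ℝ) * h1
  have hK' : (n : ℝ) ^ 3 ≤ K * a ^ 8 := (div_le_iff₀ (by positivity)).1 hK
  have h1 : (n : ℝ) ≤ a ^ 2 * K := by
    have e1 : (n : ℝ) ≤ n ^ 3 := le_self_pow₀ hn1 (by norm_num)
    have e2 : a ^ 8 ≤ a ^ 2 := pow_le_pow_of_le_one ha.le ha1 (by norm_num)
    nlinarith
  have h2 : q ≤ a * K := by
    refine le_of_sq_le_sq ?_ (by positivity)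
    rw [hq2]
    nlinarith
  -- Squared, this is n³ ≤ K a⁸: the transient condition is what brings lam²/a⁴ down to the order of
  -- 1/q.
  have h3 : (n : ℝ) ^ 2 ≤ q * a ^ 4 := by
    refine le_of_sq_le_sq ?_ (by positivity)
    rw [mul_pow, hq2]
    nlinarith
  have hlam0 : 0 < lam := by rw [hlamq]; positivity
  have hKe : (K : ℝ) = q ^ 2 / n := by rw [hq2]; field_simp
  have t1 : 1 / (lam * K) = 1 / cθ / q := by rw [hlamq, hKe]; field_simp
  have t2 : 1 / (a * K) ≤ 1 / q := one_div_le_one_div_of_le hq0 h2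
  have t3 : lam ^ 2 / a ^ 4 ≤ cθ ^ 2 / q := by
    rw [hlamq, div_le_div_iff₀ (by positivity) hq0, div_pow, mul_pow, div_mul_eq_mul_div,
      div_le_iff₀ (by positivity)]
    have := mul_le_mul_of_nonneg_left h3 (by positivity : 0 ≤ cθ ^ 2 * q)
    linarith
  have t4 : lam / n = cθ / q := by rw [hlamq]; field_simp
  calc (K : ℝ)⁻¹ * E = (lam * E) / (lam * K) := by field_simp
    _ ≤ C * (1 + lam / a + lam ^ 3 * K / a ^ 4 + lam ^ 2 * K / n) / (lam * K) := by gcongr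
    _ = C * (1 / (lam * K) + 1 / (a * K) + lam ^ 2 / a ^ 4 + lam / n) := by field_simp
    _ ≤ C * (1 / cθ / q + 1 / q + cθ ^ 2 / q + cθ / q) := by rw [t1, t4]; gcongr
    _ = _ := by ring

/-- The step size restriction only needs K of order n/a⁴, which the transient condition exceeds
because n ≥ 1 and a ≤ 1. -/
theorem mul_rateTheta_le {n K : ℕ} {a C cθ : ℝ} (hn : 0 < n) (ha : 0 < a) (ha1 : a ≤ 1)
    (hcθ : 0 < cθ) (hK : C ^ 2 * cθ ^ 2 * ((n : ℝ) ^ 3 / a ^ 8) ≤ K) (hK0 : 0 < K) :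
    C * rateTheta cθ n K ≤ a ^ 2 := by
  have hn1 : (1 : ℝ) ≤ n := by exact_mod_cast hn
  have hK0' : (0 : ℝ) < K := by exact_mod_cast hK0
  refine le_of_sq_le_sq ?_ (by positivity)
  rw [rateTheta, mul_pow, div_pow, mul_pow, Real.sq_sqrt (by positivity), Real.sq_sqrt hK0'.le,
    ← mul_div_assoc, div_le_iff₀ hK0']
  have e1 : (n : ℝ) ≤ n ^ 3 := le_self_pow₀ hn1 (by norm_num)
  have e2 : a ^ 8 ≤ a ^ 4 := pow_le_pow_of_le_one ha.le ha1 (by norm_num)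
  have e3 : (n : ℝ) ≤ (n : ℝ) ^ 3 / a ^ 8 * a ^ 4 := by
    rw [div_mul_eq_mul_div, le_div_iff₀ (by positivity)]
    exact mul_le_mul e1 e2 (by positivity) (by positivity)
  calc C ^ 2 * (cθ ^ 2 * n) = C ^ 2 * cθ ^ 2 * n := by ring
    _ ≤ C ^ 2 * cθ ^ 2 * ((n : ℝ) ^ 3 / a ^ 8 * a ^ 4) := by gcongr
    _ = a ^ 4 * (C ^ 2 * cθ ^ 2 * ((n : ℝ) ^ 3 / a ^ 8)) := by ring
    _ ≤ a ^ 4 * K := by gcongr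
    _ = (a ^ 2) ^ 2 * K := by ring

/-- Linear speedup after the transient phase. -/
theorem exists_linear_speedup (L₁ L₂ γ μ₀ p δf δg Lθ cθ cl B : ℝ)
    (hL₁ : 0 < L₁) (hL₂ : 0 < L₂) (hγ : 0 < γ) (hγL : γ < 1 / (2 * L₂))
    (hμ₀ : 0 < μ₀) (hp : 0 < p) (hp1 : p ≤ 1) (hcθ : 0 < cθ) (hcl : 0 < cl)
    (hcl' : cl ≤ (1 / γ - L₂) / (32 * a₁ L₂ γ Lθ * Lθ ^ 2)) :
    ∃ C : ℝ, 1 ≤ C ∧ ∀ {n dx dy : ℕ} {Sf Sg Ω : Type*} [MeasurableSpace Sf] [MeasurableSpace Sg]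
      [MeasurableSpace Ω] {Pr : Measure Ω} [IsProbabilityMeasure Pr] {P : Problem n dx dy Sf Sg}
      {W : Matrix (Fin n) (Fin n) ℝ} {x₀ : Fin n → Vec dx} {y₀ θ₀ : Fin n → Vec dy}
      {ξf : ℕ → Fin n → Ω → Sf} {ξg : ℕ → Fin n → Ω → Sg} {Flow ρ : ℝ},
      (∀ z, Flow ≤ P.F z) → Smooth P L₁ L₂ → Oracle Pr P ξf ξg δf δg →
      Mixes W (St dx dy) ρ →
      (∀ z z', ‖P.thetaStar γ z - P.thetaStar γ z'‖ ≤ Lθ * ‖z - z'‖) →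
      initSize Pr P W γ μ₀ Flow x₀ y₀ θ₀ ξf ξg ≤ ENNReal.ofReal B →
      ∀ K : ℕ, C * ((n : ℝ) ^ 3 / (1 - ρ) ^ 8) ≤ K →
      (K : ℝ≥0∞)⁻¹ * ∑ k ∈ Finset.range K, stationarity Pr P W γ μ₀ p cθ cl x₀ y₀ θ₀ ξf ξg K k
        ≤ ENNReal.ofReal (C / √((n : ℝ) * K)) := by
  obtain ⟨C, hC1, hC⟩ := exists_sum_integral_le δf δg hL₁ hL₂ hγ hγL hcl hcl' hμ₀ (le_max_right B 0)
  have hC0 : 0 ≤ C := by linarith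
  have p1 : 0 ≤ C ^ 2 * cθ ^ 2 := by positivity
  have p2 : 0 ≤ C * (1 / cθ + 1 + cθ ^ 2 + cθ) := by positivity
  -- The summands serve the transient condition, the step size restriction and the final rate, in
  -- this order.
  refine ⟨1 + C ^ 2 * cθ ^ 2 + C * (1 / cθ + 1 + cθ ^ 2 + cθ), by linarith, ?_⟩
  intro n dx dy Sf Sg Ω _ _ _ Pr _ P W x₀ y₀ θ₀ ξf ξg Flow ρ hF hS hO hW hθ hB K hK
  have hn := hW.pos
  have hn' : (0 : ℝ) < n := by positivity
  have ha : 0 < 1 - ρ := by linarith [hW.lt_one]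
  have ha1 : 1 - ρ ≤ 1 := by linarith [hW.nonneg]
  have hx : 0 < (n : ℝ) ^ 3 / (1 - ρ) ^ 8 := by positivity
  have hK1 : (n : ℝ) ^ 3 / (1 - ρ) ^ 8 ≤ K := (le_mul_of_one_le_left hx.le (by linarith)).trans hK
  have hK2 : C ^ 2 * cθ ^ 2 * ((n : ℝ) ^ 3 / (1 - ρ) ^ 8) ≤ K :=
    (mul_le_mul_of_nonneg_right (by linarith) hx.le).trans hK
  have hK0 : (0 : ℝ) < K := hx.trans_le hK1
  have hK0' : 0 < K := by exact_mod_cast hK0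
  have hμ := slowDecay_penalty hμ₀ hp hp1
  set lam := rateTheta cθ n K with hlam
  have hlam0 : 0 < lam := by
    have h1 : 0 < √(n : ℝ) := Real.sqrt_pos.2 hn'
    have h2 : 0 < √(K : ℝ) := Real.sqrt_pos.2 hK0
    rw [hlam, rateTheta]
    positivity
  have hR := isRandomRun_randomRun (P := P) (W := W) (γ := γ) (cl := cl) (ξf := ξf) (ξg := ξg)
    lam (penalty μ₀ p) x₀ y₀ θ₀
  rw [initSize_eq (cl := cl) (p := p) hn x₀ y₀ θ₀ lam] at hB
  have hB1 := le_max_of_ofReal_le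
    ((le_self_add.trans (le_self_add.trans le_self_add)).trans hB)
  have hB2 := le_max_of_ofReal_le
    ((le_add_self.trans (le_self_add.trans le_self_add)).trans hB)
  have hB3 := le_max_of_ofReal_le ((le_add_self.trans le_self_add).trans hB)
  have hB4 := le_add_self.trans hB
  have iD := integrable_dev (memLp_run hS hL₁ hL₂ hγ hO hμ hR 0).2
  rw [← ofReal_integral_eq_lintegral_ofReal iD
    (Filter.Eventually.of_forall fun ω => dev_nonneg _)] at hB4
  have key := hC hS hO hF hθ hW hμ hR (fun _ => hB1) (fun _ => hB2) (fun _ => hB3)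
    (le_max_of_ofReal_le hB4) hlam0 (mul_rateTheta_le hn ha ha1 hcθ hK2 hK0') K hK0'
  have avg := avg_le_of_sum_le hn ha ha1 hC0 hcθ hlam hK1 key
  have e : ∀ k, stationarity Pr P W γ μ₀ p cθ cl x₀ y₀ θ₀ ξf ξg K k = _ := fun k =>
    stationarity_eq hn hS hL₁ hL₂ hγ hγL hθ hO hμ cθ x₀ y₀ θ₀ K k
  simp only [e]
  rw [← ENNReal.ofReal_sum_of_nonneg fun k _ => integral_nonneg fun ω => sq_nonneg _,
    ← ENNReal.ofReal_natCast K, ← ENNReal.ofReal_inv_of_pos hK0,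
    ← ENNReal.ofReal_mul (by positivity)]
  refine ENNReal.ofReal_le_ofReal (avg.trans ?_)
  gcongr
  linarith

theorem exists_lt_le_of_avg_le {K : ℕ} (hK : 0 < K) {f : ℕ → ℝ≥0∞} {c : ℝ≥0∞}
    (h : (K : ℝ≥0∞)⁻¹ * ∑ k ∈ Finset.range K, f k ≤ c) : ∃ k < K, f k ≤ c := by
  by_contra! hc
  have hK0 : (K : ℝ≥0∞) ≠ 0 := by exact_mod_cast hK.ne'
  have h1 : ∑ k ∈ Finset.range K, f k ≤ K * c := by
    rwa [ENNReal.inv_mul_le_iff hK0 (ENNReal.natCast_ne_top K)] at h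
  have h2 : ∑ _k ∈ Finset.range K, c < ∑ k ∈ Finset.range K, f k :=
    ENNReal.sum_lt_sum_of_nonempty ⟨0, Finset.mem_range.2 hK⟩ fun k hk =>
      hc k (Finset.mem_range.1 hk)
  simp at h2
  exact absurd h1 (not_le.2 h2)

/-- Number of iterations for an `ε`-stationary point. -/
theorem exists_horizon {n : ℕ} {a C ε : ℝ} (hn : 0 < n) (ha : 0 < a) (ha1 : a ≤ 1) (hC : 1 ≤ C)
    (hε : 0 < ε) (hε' : ε ≤ a ^ 4 / (n : ℝ) ^ 2) :
    ∃ K₀ : ℕ, (gradEvals n K₀ : ℝ) ≤ (3 * C ^ 2 + 3) / ε ^ 2 ∧ ∀ K : ℕ, K₀ ≤ K →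
      0 < K ∧ C * ((n : ℝ) ^ 3 / a ^ 8) ≤ K ∧ C / √((n : ℝ) * K) ≤ ε := by
  have hn1 : (1 : ℝ) ≤ n := by exact_mod_cast hn
  have hn0 : (0 : ℝ) < n := by linarith
  have hsq : ε ^ 2 * (n : ℝ) ^ 4 ≤ a ^ 8 := by
    rw [le_div_iff₀ (by positivity)] at hε'
    have := pow_le_pow_left₀ (by positivity) hε' 2
    nlinarith
  have ha8 : a ^ 8 ≤ 1 := pow_le_one₀ ha.le ha1
  -- Solve C/√(nK) ≤ ε for K; the range of ε makes this horizon exceed the transient time.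
  refine ⟨⌈C ^ 2 / (n * ε ^ 2)⌉₊, ?_, fun K hK => ?_⟩
  · have h1 := (Nat.ceil_lt_add_one (by positivity : 0 ≤ C ^ 2 / (n * ε ^ 2))).le
    -- Rounding up costs at most 3n further evaluations, which the range of ε keeps below 3/ε².
    have h2 : (n : ℝ) ≤ 1 / ε ^ 2 := by
      rw [le_div_iff₀ (by positivity)]
      have : (n : ℝ) ≤ n ^ 4 := le_self_pow₀ hn1 (by norm_num)
      nlinarith [mul_le_mul_of_nonneg_left this (sq_nonneg ε)]
    have h3 : (gradEvals n ⌈C ^ 2 / (n * ε ^ 2)⌉₊ : ℝ) = 3 * n * ⌈C ^ 2 / (n * ε ^ 2)⌉₊ := by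
      simp [gradEvals]; ring
    rw [h3]
    calc 3 * n * (⌈C ^ 2 / (n * ε ^ 2)⌉₊ : ℝ) ≤ 3 * n * (C ^ 2 / (n * ε ^ 2) + 1) := by gcongr
      _ = 3 * C ^ 2 / ε ^ 2 + 3 * n := by field_simp
      _ ≤ 3 * C ^ 2 / ε ^ 2 + 3 * (1 / ε ^ 2) := by gcongr
      _ = _ := by ring
  · have hK' : C ^ 2 / (n * ε ^ 2) ≤ K := (Nat.le_ceil _).trans (by exact_mod_cast hK)
    have hK0 : (0 : ℝ) < K := lt_of_lt_of_le (by positivity) hK'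
    refine ⟨by exact_mod_cast hK0, le_trans ?_ hK', ?_⟩
    · rw [← mul_div_assoc, div_le_div_iff₀ (by positivity) (by positivity)]
      have h1 : C ≤ C ^ 2 := le_self_pow₀ hC (by norm_num)
      calc C * (n : ℝ) ^ 3 * (n * ε ^ 2) = C * (ε ^ 2 * (n : ℝ) ^ 4) := by ring
        _ ≤ C ^ 2 * a ^ 8 := by gcongr
    · rw [div_le_iff₀ (Real.sqrt_pos.2 (by positivity)), ← div_le_iff₀' hε]
      refine Real.le_sqrt_of_sq_le ?_
      rw [div_le_iff₀ (by positivity)] at hK'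
      rw [div_pow, div_le_iff₀ (by positivity)]
      linarith

end SunDSBO

end

/-! ### The main theorem -/

theorem mainTheorem4
    (L₁ L₂ γ μ₀ p δf δg Lθ cθ cl B : ℝ)
    (hL₁ : 0 < L₁) (hL₂ : 0 < L₂) (hγ : 0 < γ) (hγL : γ < 1 / (2 * L₂))
    (hμ₀ : 0 < μ₀) (hp : 0 < p) (hp' : p < 1 / 4)
    (hδf : 0 ≤ δf) (hδg : 0 ≤ δg) (hLθ : 0 < Lθ) (hcθ : 0 < cθ) (hcl : 0 < cl)
    (hcl' : cl ≤ (1 / γ - L₂) / (32 * SunDSBO.a₁ L₂ γ Lθ * Lθ ^ 2)) :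
    ∃ C : ℝ, 0 < C ∧
      ∀ (n dx dy : ℕ) (Sf Sg Ω : Type*) [MeasurableSpace Sf] [MeasurableSpace Sg]
        [MeasurableSpace Ω] (Pr : Measure Ω) [IsProbabilityMeasure Pr]
        (P : SunDSBO.Problem n dx dy Sf Sg) (W : Matrix (Fin n) (Fin n) ℝ)
        (x₀ : Fin n → SunDSBO.Vec dx) (y₀ θ₀ : Fin n → SunDSBO.Vec dy)
        (ξf : ℕ → Fin n → Ω → Sf) (ξg : ℕ → Fin n → Ω → Sg) (Flow ρ : ℝ)
        (hW : W.IsHermitian),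
        0 < n →
        -- the upper-level objective is bounded below
        (∀ z, Flow ≤ P.F z) →
        SunDSBO.Smooth P L₁ L₂ →
        SunDSBO.Oracle Pr P ξf ξg δf δg →
        -- network topology
        W ∈ doublyStochastic ℝ (Fin n) →
        ρ = SunDSBO.connectivity hW → ρ < 1 →
        -- `Lθ` is a Lipschitz constant of `θ*_γ`
        (∀ z z', ‖P.thetaStar γ z - P.thetaStar γ z'‖ ≤ Lθ * ‖z - z'‖) →
        -- the initial data are bounded by `B`
        SunDSBO.initSize Pr P W γ μ₀ Flow x₀ y₀ θ₀ ξf ξg ≤ ENNReal.ofReal B →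
        -- the stationarity measure is well defined
        (∀ μ : ℝ, Differentiable ℝ (P.Psi γ μ)) ∧
        -- sample complexity
        (∀ ε : ℝ, 0 < ε → ε ≤ (1 - ρ) ^ 4 / (n : ℝ) ^ 2 →
          ∃ K₀ : ℕ, (SunDSBO.gradEvals n K₀ : ℝ) ≤ C / ε ^ 2 ∧
            ∀ K : ℕ, K₀ ≤ K → ∃ k < K,
              SunDSBO.stationarity Pr P W γ μ₀ p cθ cl x₀ y₀ θ₀ ξf ξg K k
                ≤ ENNReal.ofReal ε) ∧
        -- transient iteration complexity
        (∀ K : ℕ, C * ((n : ℝ) ^ 3 / (1 - ρ) ^ 8) ≤ K →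
          (K : ℝ≥0∞)⁻¹ * ∑ k ∈ Finset.range K,
              SunDSBO.stationarity Pr P W γ μ₀ p cθ cl x₀ y₀ θ₀ ξf ξg K k
            ≤ ENNReal.ofReal (C / √((n : ℝ) * K))) := by
  obtain ⟨C, hC1, hC⟩ := SunDSBO.exists_linear_speedup L₁ L₂ γ μ₀ p δf δg Lθ cθ cl B hL₁ hL₂ hγ hγL
    hμ₀ hp (by linarith) hcθ hcl hcl'
  -- The constant 3C² + 3 comes from `exists_horizon` and dominates the constant of the speedup
  -- bound, so it serves both claims.
  have hCC : C ≤ 3 * C ^ 2 + 3 := by nlinarith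
  refine ⟨3 * C ^ 2 + 3, by positivity, ?_⟩
  intro n dx dy Sf Sg Ω _ _ _ Pr _ P W x₀ y₀ θ₀ ξf ξg Flow ρ hW hn hF hS hO hW' hρ hρ1 hθ hB
  subst hρ
  have ha : 0 < 1 - SunDSBO.connectivity hW := by linarith
  have ha1 : 1 - SunDSBO.connectivity hW ≤ 1 := by linarith [SunDSBO.connectivity_nonneg hW]
  have hmix : SunDSBO.Mixes W (SunDSBO.St dx dy) (SunDSBO.connectivity hW) :=
    ⟨SunDSBO.connectivity_nonneg hW, hρ1, hn, hW', SunDSBO.dev_mix_le hW hW' hρ1⟩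
  have key := hC hF hS hO hmix hθ hB
  refine ⟨fun μ z => ((SunDSBO.Problem.hasQuadGrad_Psi hn hS hL₁ hL₂ hγ hγL hθ
    μ).hasGradientAt z).differentiableAt, fun ε hε hε' => ?_, fun K hK => ?_⟩
  · obtain ⟨K₀, h1, h2⟩ := SunDSBO.exists_horizon hn ha ha1 hC1 hε hε'
    refine ⟨K₀, h1, fun K hK => ?_⟩
    obtain ⟨hK0, hK1, hK2⟩ := h2 K hK
    exact SunDSBO.exists_lt_le_of_avg_le hK0
      ((key K hK1).trans (ENNReal.ofReal_le_ofReal hK2))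
  · refine (key K (le_trans ?_ hK)).trans (ENNReal.ofReal_le_ofReal ?_) <;> gcongr
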